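/- Let $\mathcal V$ be a braided monoidal category which is closed (each $u\otimes -$ has a right adjoint). A $\mathcal V$-monoidal category $\mathcal C$ is a $\mathcal V$-category with a unit object $1_{\mathcal C}$, a tensor product of objects, morphisms $\mathcal C(a\to b)\otimes\mathcal C(c\to d)\to\mathcal C(ac\to bd)$ preserving identities and satisfying the braided interchange law, and $\mathcal V$-natural associators and unitors (in the underlying monoidal category $\mathcal C^{\mathcal V}$, whose hom sets are $\mathcal V(1_{\mathcal V},\mathcal C(a\to b))$) satisfying the pentagon and triangle equations. It is *closed* if every $\mathcal V$-functor $a\otimes-$ has a right $\mathcal V$-adjoint, *biclosed* if moreover every $\mathcal V$-functor $-\otimes a$ has one, *rigid* if $\mathcal C^{\mathcal V}$ is rigid (every object has both a left and a right dual), and *tensored* if every $\mathcal V$-functor $\mathcal C(a\to-)$ from $\mathcal C$ to the self-enrichment $\widehat{\mathcal V}$ has a left $\mathcal V$-adjoint. Two $\mathcal V$-monoidal categories are equivalent if there is a (strong) $\mathcal V$-monoidal functor between them which is $\mathcal V$-fully faithful and essentially surjective. Consider pairs $(\mathcal T,F^Z)$ with $\mathcal T$ a monoidal category and $F^Z:\mathcal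 V\to Z(\mathcal T)$ a braided oplax monoidal functor to the Drinfeld center, which is strongly unital (its counit $F^Z(1)\to 1$ is invertible). Here objects of $Z(\mathcal T)$ carry half-braidings $e_{a,x}:ax\to xa$, and the braiding of $Z(\mathcal T)$ is $e_{x,y}$. Let $F:\mathcal V\to\mathcal T$ be the composite of $F^Z$ with the forgetful functor. Two pairs are equivalent if there are a monoidal equivalence $K:\mathcal T\to\mathcal T'$ and a natural isomorphism $KF\cong F'$ compatible with counits, oplaxitors and half-braidings. Call $\mathcal T$ closed if each $a\otimes -$ has a right adjoint, biclosed if moreover each $-\otimes a$ has one. Suppose $\mathcal C^{\mathcal V}(1_{\mathcal C}\to -):=\mathcal C(1_{\mathcal C}\to-):\mathcal C^{\mathcal V}\to\mathcal V$ has a left adjoint $F$, with unit $\eta$. A *classifying functor* of $\mathcal C$ is a strongly unital braided oplax monoidal functor $F^Z:\mathcal V\to Z(\mathcal C^{\mathcal V})$ lifting such an $F$, whose counit is the mate of the identity element $j_{1_{\mathcal C}}$, whose oplaxitor $F(uv)\to F(u)F(v)$ is the mate of $\eta_u\otimes\eta_v$, and whose half-braiding $aF(v)\to F(v)a$ is the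 canonical morphism carrying $j_a\otimes\eta_v$ to $\eta_v\otimes j_a$. We say that $\mathcal C$ *has invertible half-braidings* if these canonical morphisms are isomorphisms for all $a$, $v$ and all left adjoints $F$ of $\mathcal C(1_{\mathcal C}\to -)$. **Theorem.** Sending $\mathcal C$ to $\mathcal C^{\mathcal V}$ with its classifying functor is well defined and is a bijection, on equivalence classes, from closed $\mathcal V$-monoidal categories $\mathcal C$ with invertible half-braidings for which $\mathcal C(1_{\mathcal C}\to-)$ has a left adjoint, to pairs $(\mathcal T,F^Z)$ with $\mathcal T$ closed, $F^Z$ strongly unital braided oplax monoidal, and $F$ admitting a right adjoint. It restricts to a bijection from tensored closed $\mathcal V$-monoidal categories with invertible half-braidings to pairs with $\mathcal T$ closed, $F^Z$ braided strong monoidal and $F$ admitting a right adjoint. In the same way there are bijections from tensored biclosed $\mathcal V$-monoidal categories to such pairs with $F^Z$ strong and $\mathcal T$ biclosed, and from tensored rigid $\mathcal V$-monoidal categories to such pairs with $F^Z$ strong and $\mathcal T$ rigid; in these two cases no condition on half-braidings is imposed. Moreover, a classifying functor of a closed $\mathcal V$-monoidal category $\mathcal C$ is strong if and only if $\mathcal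 C$ is tensored. -/

import Mathlib

open CategoryTheory MonoidalCategory

universe v u w w₁ w₂

namespace BraidedEnriched

/-! ### Categories enriched in a monoidal category -/

section Enriched

variable {V : Type u} [Category.{v} V] [MonoidalCategory V]

section

variable {C : Type w} [EnrichedCategory V C]

/-- Precomposition with `f : a → b`, as a morphism `C(b → c) ⟶ C(a → c)` of `V`. -/
def ePre {a b : C} (f : 𝟙_ V ⟶ (a ⟶[V] b)) (c : C) : (b ⟶[V] c) ⟶ (a ⟶[V] c) :=
  (λ_ _).inv ≫ f ▷ _ ≫ eComp V a b c

/-- Postcomposition with `f : b → c`, as a morphism `C(a → b) ⟶ C(a → c)` of `V`. -/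
def ePost (a : C) {b c : C} (f : 𝟙_ V ⟶ (b ⟶[V] c)) : (a ⟶[V] b) ⟶ (a ⟶[V] c) :=
  (ρ_ _).inv ≫ _ ◁ f ≫ eComp V a b c

theorem ePost_eId (a b : C) : ePost a (eId V b) = 𝟙 (a ⟶[V] b) := e_comp_id V a b

theorem ePost_comp (a : C) {b c d : C} (f : 𝟙_ V ⟶ (b ⟶[V] c)) (g : 𝟙_ V ⟶ (c ⟶[V] d)) :
    ePost a (((λ_ (𝟙_ V)).inv ≫ (f ⊗ₘ g)) ≫ eComp V b c d) = ePost a f ≫ ePost a g := by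
  simp only [ePost, Category.assoc, MonoidalCategory.whiskerLeft_comp]
  rw [← e_assoc]
  have h : eComp V a b c ≫ (ρ_ _).inv ≫ (a ⟶[V] c) ◁ g =
      (ρ_ _).inv ≫ (_ ◁ g) ≫ eComp V a b c ▷ _ := by
    rw [rightUnitor_inv_naturality_assoc, whisker_exchange]
  have h' := congrArg (· ≫ eComp V a c d) h
  simp only [Category.assoc] at h'
  rw [h']
  simp only [MonoidalCategory.tensorHom_def, MonoidalCategory.whiskerLeft_comp, ← Category.assoc]
  congr 2
  rw [unitors_inv_equal]
  monoidal

theorem elt_comp_ePost (a : C) {b c : C} (f : 𝟙_ V ⟶ (a ⟶[V] b)) (g : 𝟙_ V ⟶ (b ⟶[V] c)) :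
    f ≫ ePost a g = ((λ_ (𝟙_ V)).inv ≫ (f ⊗ₘ g)) ≫ eComp V a b c := by
  rw [ePost, rightUnitor_inv_naturality_assoc, ← MonoidalCategory.tensorHom_def_assoc,
    unitors_inv_equal, Category.assoc]

theorem elt_comp_ePre {a b : C} (c : C) (f : 𝟙_ V ⟶ (a ⟶[V] b)) (g : 𝟙_ V ⟶ (b ⟶[V] c)) :
    g ≫ ePre f c = ((λ_ (𝟙_ V)).inv ≫ (f ⊗ₘ g)) ≫ eComp V a b c := by
  rw [ePre, leftUnitor_inv_naturality_assoc, ← MonoidalCategory.tensorHom_def'_assoc,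
    Category.assoc]

theorem eId_eComp (a : C) :
    (λ_ (𝟙_ V)).inv ≫ (eId V a ⊗ₘ eId V a) ≫ eComp V a a a = eId V a := by
  rw [← Category.assoc, ← elt_comp_ePost, ePost_eId, Category.comp_id]

variable (V) in
/-- The representable functor `C(a → -)` from the underlying category of `C` to `V`. -/
def representable (a : C) : ForgetEnrichment V C ⥤ V where
  obj b := a ⟶[V] ForgetEnrichment.to V b
  map f := ePost a (ForgetEnrichment.homTo V f)
  map_id b := by
    rw [ForgetEnrichment.homTo_id]
    exact ePost_eId _ _
  map_comp f g := by
    rw [ForgetEnrichment.homTo_comp]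
    exact ePost_comp _ _ _

end

/-- A `V`-adjunction `L ⊣ R` between `V`-functors `L : C → D` and `R : D → C`. -/
structure EnrichedAdjunction {C : Type w₁} [EnrichedCategory V C] {D : Type w₂}
    [EnrichedCategory V D] (L : EnrichedFunctor V C D) (R : EnrichedFunctor V D C) where
  /-- the isomorphisms of hom objects -/
  θ (a : C) (d : D) : (L.obj a ⟶[V] d) ≅ (a ⟶[V] R.obj d)
  naturality_left (a b : C) (d : D) :
    eComp V a b (R.obj d) ≫ (θ a d).inv =
      (L.map a b ⊗ₘ (θ b d).inv) ≫ eComp V (L.obj a) (L.obj b) d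
  naturality_right (a : C) (c d : D) :
    eComp V (L.obj a) c d ≫ (θ a d).hom =
      ((θ a c).hom ⊗ₘ R.map c d) ≫ eComp V a (R.obj c) (R.obj d)

section Tensored

variable [MonoidalClosed V]

open scoped MonoidalClosed

theorem whiskerLeft_tensorHom_comp_uncurry_comp {X Y Z P Q : V} (f : P ⟶ (ihom X).obj Y)
    (g : Q ⟶ (ihom Y).obj Z) :
    X ◁ (f ⊗ₘ g) ≫ MonoidalClosed.uncurry (MonoidalClosed.comp X Y Z) =
      (α_ _ _ _).inv ≫ MonoidalClosed.uncurry f ▷ Q ≫ MonoidalClosed.uncurry g := by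
  rw [MonoidalClosed.comp_eq, MonoidalClosed.uncurry_curry, MonoidalClosed.compTranspose_eq,
    MonoidalClosed.uncurry_eq, MonoidalClosed.uncurry_eq, MonoidalCategory.tensorHom_def,
    MonoidalCategory.whiskerLeft_comp, Category.assoc, associator_inv_naturality_right_assoc,
    whisker_exchange_assoc, associator_inv_naturality_middle_assoc, comp_whiskerRight_assoc]
  rfl

variable (V) in
/-- The `V`-functor `C(a → -)` from `C` to the self-enrichment of `V`: on hom objects it is the
transpose of the composition of `C`. -/
def enrichedRepresentable {C : Type w} [EnrichedCategory V C] (a : C) : EnrichedFunctor V C V where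
  obj b := a ⟶[V] b
  map b c := MonoidalClosed.curry (eComp V a b c)
  map_id b := by
    apply MonoidalClosed.uncurry_injective
    rw [MonoidalClosed.uncurry_natural_left, MonoidalClosed.uncurry_curry,
      MonoidalClosed.enrichedCategorySelf_id, MonoidalClosed.id_eq, MonoidalClosed.uncurry_curry,
      ← cancel_epi (ρ_ _).inv, e_comp_id, Iso.inv_hom_id]
  map_comp b c d := by
    apply MonoidalClosed.uncurry_injective
    rw [MonoidalClosed.uncurry_natural_left, MonoidalClosed.uncurry_curry,
      MonoidalClosed.uncurry_natural_left, ← e_assoc]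
    refine Eq.symm ((whiskerLeft_tensorHom_comp_uncurry_comp _ _).trans ?_)
    rw [MonoidalClosed.uncurry_curry, MonoidalClosed.uncurry_curry]

variable (V) in
/-- A `V`-category is tensored if each `V`-functor `C(a → -)` to the self-enrichment of `V` has a
left `V`-adjoint. -/
def IsTensored (C : Type w) [EnrichedCategory V C] : Prop :=
  ∀ a : C, ∃ L : EnrichedFunctor V V C, Nonempty (EnrichedAdjunction L (enrichedRepresentable V a))

end Tensored

end Enriched

/-! ### `V`-monoidal categories -/

/-- The underlying data of the tensor product of a `V`-monoidal category. -/
class EnrichedTensor (V : Type u) [Category.{v} V] [MonoidalCategory V] (C : Type w)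
    [EnrichedCategory V C] where
  /-- the unit object -/
  unit : C
  /-- the tensor product of objects -/
  tObj : C → C → C
  /-- the tensor product of hom objects -/
  tHom (a b c d : C) : (a ⟶[V] b) ⊗ (c ⟶[V] d) ⟶ (tObj a c ⟶[V] tObj b d)

open EnrichedTensor

/-- The tensor product `f ⊗ g : a ⊗ c → b ⊗ d` of `f : a → b` and `g : c → d` in the underlying
category. -/
def tensorElt {V : Type u} [Category.{v} V] [MonoidalCategory V] {C : Type w}
    [EnrichedCategory V C] [EnrichedTensor V C] {a b c d : C}
    (f : 𝟙_ V ⟶ (a ⟶[V] b)) (g : 𝟙_ V ⟶ (c ⟶[V] d)) :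
    𝟙_ V ⟶ (tObj V a c ⟶[V] tObj V b d) :=
  (λ_ (𝟙_ V)).inv ≫ (f ⊗ₘ g) ≫ tHom a b c d

/-- A monoidal category enriched in the braided monoidal category `V`: a `V`-category with a tensor
product satisfying the braided interchange law (`tensorμ` uses the braiding of `V` once, to
exchange the two middle factors), with `V`-natural associators and unitors in the underlying
category satisfying the pentagon and triangle equations. Strict `V`-monoidal categories are those
in which the tensor product of objects is strictly associative and unital and the associators and
unitors are identities. -/
class EnrichedMonoidalCategory (V : Type u) [Category.{v} V] [MonoidalCategory V]
    [BraidedCategory V] (C : Type w) [EnrichedCategory V C] extends EnrichedTensor V C where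
  associator (a b c : C) :
    ForgetEnrichment.of V (tObj (tObj a b) c) ≅ ForgetEnrichment.of V (tObj a (tObj b c))
  leftUnitor (a : C) : ForgetEnrichment.of V (tObj unit a) ≅ ForgetEnrichment.of V a
  rightUnitor (a : C) : ForgetEnrichment.of V (tObj a unit) ≅ ForgetEnrichment.of V a
  tensor_id (a b : C) : tensorElt (eId V a) (eId V b) = eId V (tObj a b)
  interchange (a b c d e f : C) :
    (tHom a b d e ⊗ₘ tHom b c e f) ≫ eComp V (tObj a d) (tObj b e) (tObj c f) =
      tensorμ (a ⟶[V] b) (d ⟶[V] e) (b ⟶[V] c) (e ⟶[V] f) ≫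
        (eComp V a b c ⊗ₘ eComp V d e f) ≫ tHom a c d f
  associator_naturality (a a' b b' c c' : C) :
    tHom a a' b b' ▷ (c ⟶[V] c') ≫ tHom (tObj a b) (tObj a' b') c c' ≫
        ePost _ (ForgetEnrichment.homTo V (associator a' b' c').hom) =
      (α_ _ _ _).hom ≫ (a ⟶[V] a') ◁ tHom b b' c c' ≫ tHom a a' (tObj b c) (tObj b' c') ≫
        ePre (ForgetEnrichment.homTo V (associator a b c).hom) _
  leftUnitor_naturality (a b : C) :
    (λ_ _).inv ≫ eId V unit ▷ (a ⟶[V] b) ≫ tHom unit unit a b ≫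
        ePost _ (ForgetEnrichment.homTo V (leftUnitor b).hom) =
      ePre (ForgetEnrichment.homTo V (leftUnitor a).hom) b
  rightUnitor_naturality (a b : C) :
    (ρ_ _).inv ≫ (a ⟶[V] b) ◁ eId V unit ≫ tHom a b unit unit ≫
        ePost _ (ForgetEnrichment.homTo V (rightUnitor b).hom) =
      ePre (ForgetEnrichment.homTo V (rightUnitor a).hom) b
  pentagon (a b c d : C) :
    ForgetEnrichment.homOf V (tensorElt (ForgetEnrichment.homTo V (associator a b c).hom)
        (eId V d)) ≫
      (associator a (tObj b c) d).hom ≫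
      ForgetEnrichment.homOf V (tensorElt (eId V a)
        (ForgetEnrichment.homTo V (associator b c d).hom)) =
    (associator (tObj a b) c d).hom ≫ (associator a b (tObj c d)).hom
  triangle (a b : C) :
    (associator a unit b).hom ≫
      ForgetEnrichment.homOf V (tensorElt (eId V a)
        (ForgetEnrichment.homTo V (leftUnitor b).hom)) =
    ForgetEnrichment.homOf V (tensorElt (ForgetEnrichment.homTo V (rightUnitor a).hom) (eId V b))


section VMonoidal

variable {V : Type u} [Category.{v} V] [MonoidalCategory V] [BraidedCategory V]

theorem leftUnitor_inv_tensor_comp_tensorμ (X Y : V) :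
    ((λ_ X).inv ⊗ₘ (λ_ Y).inv) ≫ tensorμ (𝟙_ V) X (𝟙_ V) Y =
      (λ_ (X ⊗ Y)).inv ≫ (λ_ (𝟙_ V)).inv ▷ (X ⊗ Y) := by
  simp only [tensorμ, braiding_tensorUnit_right]
  monoidal

theorem rightUnitor_inv_tensor_comp_tensorμ (X Y : V) :
    ((ρ_ X).inv ⊗ₘ (ρ_ Y).inv) ≫ tensorμ X (𝟙_ V) Y (𝟙_ V) =
      (ρ_ (X ⊗ Y)).inv ≫ (X ⊗ Y) ◁ (λ_ (𝟙_ V)).inv := by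
  simp only [tensorμ, braiding_tensorUnit_left]
  monoidal

variable {C : Type w} [EnrichedCategory V C] [EnrichedMonoidalCategory V C]

open EnrichedMonoidalCategory

variable (V) in
/-- The `V`-functor `a ⊗ -`. -/
def tensorLeftEnriched (a : C) : EnrichedFunctor V C C where
  obj b := tObj V a b
  map b c := (λ_ _).inv ≫ eId V a ▷ _ ≫ tHom a a b c
  map_id b := by
    rw [leftUnitor_inv_naturality_assoc, ← tensor_id, tensorElt, MonoidalCategory.tensorHom_def',
      Category.assoc]
  map_comp b c d := by
    have h := interchange (V := V) a a a b c d
    have e : ∀ x y : C, (λ_ (x ⟶[V] y)).inv ≫ eId V a ▷ _ ≫ tHom a a x y =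
        ((λ_ _).inv ≫ (eId V a ⊗ₘ 𝟙 _)) ≫ tHom a a x y := fun x y => by
      rw [MonoidalCategory.tensorHom_id, Category.assoc]
    rw [e, e, e, ← tensorHom_comp_tensorHom]
    simp only [Category.assoc]
    rw [h, ← tensorHom_comp_tensorHom_assoc, tensorμ_natural_assoc, tensorHom_comp_tensorHom_assoc,
      reassoc_of% (leftUnitor_inv_tensor_comp_tensorμ (b ⟶[V] c) (c ⟶[V] d)),
      id_tensorHom_id, Category.id_comp, leftUnitor_inv_naturality_assoc,
      ← MonoidalCategory.id_tensorHom, ← MonoidalCategory.tensorHom_id,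
      tensorHom_comp_tensorHom_assoc, tensorHom_comp_tensorHom_assoc,
      Category.id_comp, Category.id_comp, Category.comp_id, eId_eComp]

variable (V) in
/-- The `V`-functor `- ⊗ a`. -/
def tensorRightEnriched (a : C) : EnrichedFunctor V C C where
  obj b := tObj V b a
  map b c := (ρ_ _).inv ≫ _ ◁ eId V a ≫ tHom b c a a
  map_id b := by
    rw [rightUnitor_inv_naturality_assoc, ← tensor_id, tensorElt, MonoidalCategory.tensorHom_def,
      Category.assoc, unitors_inv_equal]
  map_comp b c d := by
    have h := interchange (V := V) b c d a a a
    have e : ∀ x y : C, (ρ_ (x ⟶[V] y)).inv ≫ _ ◁ eId V a ≫ tHom x y a a =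
        ((ρ_ _).inv ≫ (𝟙 _ ⊗ₘ eId V a)) ≫ tHom x y a a := fun x y => by
      rw [MonoidalCategory.id_tensorHom, Category.assoc]
    rw [e, e, e, ← tensorHom_comp_tensorHom]
    simp only [Category.assoc]
    rw [h, ← tensorHom_comp_tensorHom_assoc, tensorμ_natural_assoc, tensorHom_comp_tensorHom_assoc,
      reassoc_of% (rightUnitor_inv_tensor_comp_tensorμ (b ⟶[V] c) (c ⟶[V] d)),
      id_tensorHom_id, Category.id_comp, rightUnitor_inv_naturality_assoc,
      ← MonoidalCategory.id_tensorHom, ← MonoidalCategory.tensorHom_id,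
      tensorHom_comp_tensorHom_assoc, tensorHom_comp_tensorHom_assoc,
      Category.id_comp, Category.id_comp, Category.comp_id, eId_eComp]

variable (V C) in
/-- A `V`-monoidal category is closed if each `V`-functor `a ⊗ -` has a right `V`-adjoint. -/
def IsClosedEnriched : Prop :=
  ∀ a : C, ∃ R : EnrichedFunctor V C C, Nonempty (EnrichedAdjunction (tensorLeftEnriched V a) R)

variable (V C) in
/-- A `V`-monoidal category is biclosed if each `V`-functor `a ⊗ -` and each `V`-functor `- ⊗ a`
has a right `V`-adjoint. -/
def IsBiclosedEnriched : Prop :=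
  IsClosedEnriched V C ∧ ∀ a : C, ∃ R : EnrichedFunctor V C C,
    Nonempty (EnrichedAdjunction (tensorRightEnriched V a) R)

/-- Data of the monoidal structure on the underlying category of a `V`-monoidal category. -/
instance : MonoidalCategoryStruct (ForgetEnrichment V C) where
  tensorObj X Y := ForgetEnrichment.of V
    (tObj V (ForgetEnrichment.to V X) (ForgetEnrichment.to V Y))
  tensorHom f g := ForgetEnrichment.homOf V
    (tensorElt (ForgetEnrichment.homTo V f) (ForgetEnrichment.homTo V g))
  whiskerLeft X _ _ f := ForgetEnrichment.homOf V
    (tensorElt (eId V (ForgetEnrichment.to V X)) (ForgetEnrichment.homTo V f))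
  whiskerRight f Y := ForgetEnrichment.homOf V
    (tensorElt (ForgetEnrichment.homTo V f) (eId V (ForgetEnrichment.to V Y)))
  tensorUnit := ForgetEnrichment.of V (unit V : C)
  associator X Y Z := associator (ForgetEnrichment.to V X) (ForgetEnrichment.to V Y)
    (ForgetEnrichment.to V Z)
  leftUnitor X := leftUnitor (ForgetEnrichment.to V X)
  rightUnitor X := rightUnitor (ForgetEnrichment.to V X)

theorem tensorElt_comp {a b c d e f : C} (p : 𝟙_ V ⟶ (a ⟶[V] b)) (q : 𝟙_ V ⟶ (b ⟶[V] c))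
    (r : 𝟙_ V ⟶ (d ⟶[V] e)) (s : 𝟙_ V ⟶ (e ⟶[V] f)) :
    tensorElt (((λ_ (𝟙_ V)).inv ≫ (p ⊗ₘ q)) ≫ eComp V a b c)
        (((λ_ (𝟙_ V)).inv ≫ (r ⊗ₘ s)) ≫ eComp V d e f) =
      ((λ_ (𝟙_ V)).inv ≫ (tensorElt p r ⊗ₘ tensorElt q s)) ≫ eComp V _ _ _ := by
  simp only [tensorElt, ← tensorHom_comp_tensorHom, Category.assoc, interchange]
  rw [tensorμ_natural_assoc,
    reassoc_of% (leftUnitor_inv_tensor_comp_tensorμ (𝟙_ V) (𝟙_ V))]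
  simp only [← Category.assoc]
  congr 3
  monoidal

theorem elt_comp_associator {a a' b b' c c' : C} (f : 𝟙_ V ⟶ (a ⟶[V] a'))
    (g : 𝟙_ V ⟶ (b ⟶[V] b')) (h : 𝟙_ V ⟶ (c ⟶[V] c')) :
    tensorElt (tensorElt f g) h ≫
        ePost _ (ForgetEnrichment.homTo V (associator a' b' c').hom) =
      tensorElt f (tensorElt g h) ≫
        ePre (ForgetEnrichment.homTo V (associator a b c).hom) _ := by
  have e₁ : tensorElt (tensorElt f g) h =
      ((λ_ (𝟙_ V)).inv ≫ (λ_ (𝟙_ V)).inv ▷ _ ≫ ((f ⊗ₘ g) ⊗ₘ h)) ≫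
        tHom a a' b b' ▷ (c ⟶[V] c') ≫ tHom (tObj V a b) (tObj V a' b') c c' := by
    simp only [tensorElt, Category.assoc, ← MonoidalCategory.tensorHom_id,
      tensorHom_comp_tensorHom_assoc, Category.id_comp, Category.comp_id]
  have e₂ : tensorElt f (tensorElt g h) =
      ((λ_ (𝟙_ V)).inv ≫ _ ◁ (λ_ (𝟙_ V)).inv ≫ (f ⊗ₘ (g ⊗ₘ h))) ≫
        (a ⟶[V] a') ◁ tHom b b' c c' ≫ tHom a a' (tObj V b c) (tObj V b' c') := by
    simp only [tensorElt, Category.assoc, ← MonoidalCategory.id_tensorHom,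
      tensorHom_comp_tensorHom_assoc, Category.id_comp, Category.comp_id]
  rw [e₁, e₂]
  simp only [Category.assoc]
  rw [EnrichedMonoidalCategory.associator_naturality,
    MonoidalCategory.associator_naturality_assoc]
  simp only [← Category.assoc]
  congr 4
  monoidal

theorem elt_comp_leftUnitor {a b : C} (f : 𝟙_ V ⟶ (a ⟶[V] b)) :
    tensorElt (eId V (unit V : C)) f ≫ ePost _ (ForgetEnrichment.homTo V (leftUnitor b).hom) =
      f ≫ ePre (ForgetEnrichment.homTo V (leftUnitor a).hom) b := by
  rw [← EnrichedMonoidalCategory.leftUnitor_naturality, leftUnitor_inv_naturality_assoc,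
    ← MonoidalCategory.tensorHom_def'_assoc, tensorElt, Category.assoc, Category.assoc]

theorem elt_comp_rightUnitor {a b : C} (f : 𝟙_ V ⟶ (a ⟶[V] b)) :
    tensorElt f (eId V (unit V : C)) ≫ ePost _ (ForgetEnrichment.homTo V (rightUnitor b).hom) =
      f ≫ ePre (ForgetEnrichment.homTo V (rightUnitor a).hom) b := by
  rw [← EnrichedMonoidalCategory.rightUnitor_naturality, rightUnitor_inv_naturality_assoc,
    ← MonoidalCategory.tensorHom_def_assoc, tensorElt, Category.assoc, Category.assoc,
    unitors_inv_equal]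

/-- The monoidal structure on the underlying category of a `V`-monoidal category. -/
instance : MonoidalCategory (ForgetEnrichment V C) where
  tensorHom_def {X₁ Y₁ X₂ Y₂} f g := by
    have h := tensorElt_comp (ForgetEnrichment.homTo V f)
      (ForgetEnrichment.homTo V (𝟙 Y₁)) (ForgetEnrichment.homTo V (𝟙 X₂))
      (ForgetEnrichment.homTo V g)
    rw [← ForgetEnrichment.homTo_comp, ← ForgetEnrichment.homTo_comp, Category.comp_id,
      Category.id_comp, ForgetEnrichment.homTo_id, ForgetEnrichment.homTo_id] at h
    exact h
  id_tensorHom_id X Y := by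
    change ForgetEnrichment.homOf V (tensorElt _ _) = _
    rw [ForgetEnrichment.homTo_id, ForgetEnrichment.homTo_id, tensor_id]
    exact ForgetEnrichment.homOf_eId V _
  tensorHom_comp_tensorHom f g h k :=
    (tensorElt_comp (ForgetEnrichment.homTo V f) (ForgetEnrichment.homTo V h)
      (ForgetEnrichment.homTo V g) (ForgetEnrichment.homTo V k)).symm
  whiskerLeft_id X Y := by
    change ForgetEnrichment.homOf V (tensorElt _ _) = _
    rw [ForgetEnrichment.homTo_id, tensor_id]
    exact ForgetEnrichment.homOf_eId V _
  id_whiskerRight X Y := by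
    change ForgetEnrichment.homOf V (tensorElt _ _) = _
    rw [ForgetEnrichment.homTo_id, tensor_id]
    exact ForgetEnrichment.homOf_eId V _
  associator_naturality f g h := by
    have e := elt_comp_associator (ForgetEnrichment.homTo V f) (ForgetEnrichment.homTo V g)
      (ForgetEnrichment.homTo V h)
    rw [elt_comp_ePost, elt_comp_ePre] at e
    exact e
  leftUnitor_naturality f := by
    have e := elt_comp_leftUnitor (ForgetEnrichment.homTo V f)
    rw [elt_comp_ePost, elt_comp_ePre] at e
    exact e
  rightUnitor_naturality f := by
    have e := elt_comp_rightUnitor (ForgetEnrichment.homTo V f)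
    rw [elt_comp_ePost, elt_comp_ePre] at e
    exact e
  pentagon W X Y Z := EnrichedMonoidalCategory.pentagon (V := V) (C := C) W X Y Z
  triangle X Y := EnrichedMonoidalCategory.triangle (V := V) (C := C) X Y

variable (V C) in
/-- A `V`-monoidal category is rigid if its underlying monoidal category is rigid. -/
def IsRigidEnriched : Prop := Nonempty (RigidCategory (ForgetEnrichment V C))

/-- For a morphism `f : v ⟶ C(1 → x)` of `V`, the morphism `j_a ⊗ f : v ⟶ C(a → a ⊗ x)`. -/
def idTensor (a : C) {v : V} {x : C} (f : v ⟶ (unit V ⟶[V] x)) : v ⟶ (a ⟶[V] tObj V a x) :=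
  (λ_ v).inv ≫ (eId V a ⊗ₘ f) ≫ tHom a a (unit V) x ≫
    ePre (ForgetEnrichment.homTo V (rightUnitor a).inv) (tObj V a x)

/-- For a morphism `f : v ⟶ C(1 → x)` of `V`, the morphism `f ⊗ j_a : v ⟶ C(a → x ⊗ a)`. -/
def tensorId {v : V} {x : C} (f : v ⟶ (unit V ⟶[V] x)) (a : C) : v ⟶ (a ⟶[V] tObj V x a) :=
  (ρ_ v).inv ≫ (f ⊗ₘ eId V a) ≫ tHom (unit V) x a a ≫
    ePre (ForgetEnrichment.homTo V (leftUnitor a).inv) (tObj V x a)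

/-- For morphisms `f : u ⟶ C(1 → x)` and `g : v ⟶ C(1 → y)` of `V`, the morphism
`f ⊗ g : u ⊗ v ⟶ C(1 → x ⊗ y)`. -/
def tensorUnitElt {u v : V} {x y : C} (f : u ⟶ (unit V ⟶[V] x)) (g : v ⟶ (unit V ⟶[V] y)) :
    u ⊗ v ⟶ (unit V ⟶[V] tObj V x y) :=
  (f ⊗ₘ g) ≫ tHom (unit V) x (unit V) y ≫
    ePre (ForgetEnrichment.homTo V (leftUnitor (unit V : C)).inv) (tObj V x y)

variable (V C) in
/-- The functor `C(1 → -)` from the underlying category of `C` to `V`. -/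
abbrev unitRepresentable : ForgetEnrichment V C ⥤ V := representable V (unit V : C)

/-- The unit `v ⟶ C(1 → F v)` of an adjunction between a functor `F` from `V` to the underlying
category of `C` and `C(1 → -)`. -/
def unitElt {F : V ⥤ ForgetEnrichment V C} (adj : F ⊣ unitRepresentable V C) (v : V) :
    v ⟶ (unit V ⟶[V] ForgetEnrichment.to V (F.obj v)) :=
  adj.unit.app v

variable (V C) in
/-- For every left adjoint `F` of `C(1 → -)`, with unit `η`, the canonical morphisms
`a ⊗ F v ⟶ F v ⊗ a` (which carry `j_a ⊗ η_v` to `η_v ⊗ j_a`) are isomorphisms. -/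
def HasInvertibleHalfBraidings : Prop :=
  ∀ (F : V ⥤ ForgetEnrichment V C) (adj : F ⊣ unitRepresentable V C) (a : C) (v : V),
    ∃ e : ForgetEnrichment.of V a ⊗ F.obj v ≅ F.obj v ⊗ ForgetEnrichment.of V a,
      idTensor a (unitElt adj v) ≫ ePost a (ForgetEnrichment.homTo V e.hom) =
        tensorId (unitElt adj v) a

end VMonoidal

/-! ### Braided oplax monoidal functors to the Drinfeld center -/

/-- A strongly unital braided oplax monoidal functor from `V` to the Drinfeld center `Z(T)`.
An object of `Z(T)` is regarded as an object `x` of `T` with the half-braiding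
`e_{a,x} : a ⊗ x ⟶ x ⊗ a` (the inverse of `HalfBraiding.β`), and the braiding of `x` and `y` in
`Z(T)` is `e_{x,y} : x ⊗ y ⟶ y ⊗ x`, that is, the inverse of the braiding `β_ y x` of
`CategoryTheory.Center T`. -/
structure BraidedOplaxFunctor (V : Type u) [Category.{v} V] [MonoidalCategory V]
    [BraidedCategory V] (T : Type w) [Category.{v} T] [MonoidalCategory T] where
  /-- the functor to the center -/
  functor : V ⥤ Center T
  [oplaxMonoidal : functor.OplaxMonoidal]
  isIso_counit : IsIso (Functor.OplaxMonoidal.η functor)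
  braided (x y : V) :
    Functor.OplaxMonoidal.δ functor x y ≫ (β_ (functor.obj y) (functor.obj x)).inv =
      functor.map (β_ x y).hom ≫ Functor.OplaxMonoidal.δ functor y x

attribute [instance] BraidedOplaxFunctor.oplaxMonoidal

namespace BraidedOplaxFunctor

variable {V : Type u} [Category.{v} V] [MonoidalCategory V] [BraidedCategory V]
  {T : Type w} [Category.{v} T] [MonoidalCategory T] (Φ : BraidedOplaxFunctor V T)

/-- The composite with the forgetful functor `Z(T) ⥤ T`. -/
abbrev toT : V ⥤ T := Φ.functor ⋙ Center.forget T

/-- The counit `F 1 ⟶ 1`, in `T`. -/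
def counit : Φ.toT.obj (𝟙_ V) ⟶ 𝟙_ T := (Functor.OplaxMonoidal.η Φ.functor).f

/-- The oplaxitor `ν_{x,y} : F (x ⊗ y) ⟶ F x ⊗ F y`, in `T`. -/
def oplaxitor (x y : V) : Φ.toT.obj (x ⊗ y) ⟶ Φ.toT.obj x ⊗ Φ.toT.obj y :=
  (Functor.OplaxMonoidal.δ Φ.functor x y).f

/-- The half-braiding `e_{a,F v} : a ⊗ F v ≅ F v ⊗ a`. -/
def halfBraiding (a : T) (v : V) : a ⊗ Φ.toT.obj v ≅ Φ.toT.obj v ⊗ a :=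
  ((Φ.functor.obj v).2.β a).symm

/-- The functor is strong monoidal if its oplaxitors are isomorphisms. -/
def IsStrong : Prop := ∀ x y : V, IsIso (Functor.OplaxMonoidal.δ Φ.functor x y)

end BraidedOplaxFunctor

/-- A pair `(T, F^Z)` of a monoidal category `T` and a strongly unital braided oplax monoidal
functor `F^Z` from `V` to the center of `T`. -/
structure CenterPair (V : Type u) [Category.{v} V] [MonoidalCategory V] [BraidedCategory V] where
  /-- the monoidal category -/
  T : Type w
  [category : Category.{v} T]
  [monoidalCategory : MonoidalCategory T]
  /-- the functor to its center -/
  F : BraidedOplaxFunctor V T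

attribute [instance] CenterPair.category CenterPair.monoidalCategory

namespace CenterPair

variable {V : Type u} [Category.{v} V] [MonoidalCategory V] [BraidedCategory V]

/-- Two pairs `(T, F^Z)` and `(T', F'^Z)` are equivalent if there are a monoidal equivalence
`K : T ⥤ T'` and a natural isomorphism between `F ⋙ K` and `F'` which is compatible with the
counits, the oplaxitors and the half-braidings. -/
def Equivalent (P Q : CenterPair.{v, u, w} V) : Prop :=
  ∃ (K : P.T ⥤ Q.T) (_ : K.Monoidal) (φ : P.F.toT ⋙ K ≅ Q.F.toT),
    K.IsEquivalence ∧
    K.map P.F.counit ≫ Functor.OplaxMonoidal.η K = φ.hom.app (𝟙_ V) ≫ Q.F.counit ∧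
    (∀ x y : V, K.map (P.F.oplaxitor x y) ≫ Functor.OplaxMonoidal.δ K _ _ ≫
      (φ.hom.app x ⊗ₘ φ.hom.app y) = φ.hom.app (x ⊗ y) ≫ Q.F.oplaxitor x y) ∧
    ∀ (a : P.T) (v : V), Functor.LaxMonoidal.μ K a (P.F.toT.obj v) ≫
      K.map (P.F.halfBraiding a v).hom ≫ Functor.OplaxMonoidal.δ K (P.F.toT.obj v) a ≫
        φ.hom.app v ▷ K.obj a =
      K.obj a ◁ φ.hom.app v ≫ (Q.F.halfBraiding (K.obj a) v).hom

variable (P : CenterPair.{v, u, w} V)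

/-- The underlying functor `F : V ⥤ T` has a right adjoint. -/
def HasRightAdjoint : Prop := P.F.toT.IsLeftAdjoint

/-- `T` is closed: each functor `a ⊗ -` has a right adjoint. -/
def IsClosed : Prop := ∀ a : P.T, (tensorLeft a).IsLeftAdjoint

/-- `T` is biclosed: each functor `a ⊗ -` and each functor `- ⊗ a` has a right adjoint. -/
def IsBiclosed : Prop := P.IsClosed ∧ ∀ a : P.T, (tensorRight a).IsLeftAdjoint

/-- `T` is rigid. -/
def IsRigid : Prop := Nonempty (RigidCategory P.T)

end CenterPair

/-! ### The correspondence -/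

/-- A bundled `V`-monoidal category. -/
structure EnrMonCat (V : Type u) [Category.{v} V] [MonoidalCategory V] [BraidedCategory V] where
  /-- the objects -/
  carrier : Type w
  [enrichedCategory : EnrichedCategory V carrier]
  [enrichedMonoidal : EnrichedMonoidalCategory V carrier]

attribute [instance] EnrMonCat.enrichedCategory EnrMonCat.enrichedMonoidal

/-- A (strong) `V`-monoidal functor: a `V`-functor with a monoidal structure on the underlying
functor whose tensorators are natural in the enriched sense. -/
structure EnrichedMonoidalFunctor {V : Type u} [Category.{v} V] [MonoidalCategory V]
    [BraidedCategory V] (C : Type w₁) [EnrichedCategory V C] [EnrichedMonoidalCategory V C]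
    (D : Type w₂) [EnrichedCategory V D] [EnrichedMonoidalCategory V D] where
  /-- the `V`-functor -/
  toFunctor : EnrichedFunctor V C D
  [monoidal : toFunctor.forget.Monoidal]
  naturality (a b c d : C) :
    (toFunctor.map a c ⊗ₘ toFunctor.map b d) ≫ tHom _ _ _ _ ≫
        ePre (ForgetEnrichment.homTo V (Functor.OplaxMonoidal.δ toFunctor.forget
          (ForgetEnrichment.of V a) (ForgetEnrichment.of V b))) _ =
      tHom a c b d ≫ toFunctor.map _ _ ≫
        ePost _ (ForgetEnrichment.homTo V (Functor.OplaxMonoidal.δ toFunctor.forget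
          (ForgetEnrichment.of V c) (ForgetEnrichment.of V d)))

namespace EnrMonCat

variable {V : Type u} [Category.{v} V] [MonoidalCategory V] [BraidedCategory V]

/-- Two `V`-monoidal categories are equivalent if there is a `V`-monoidal functor between them
which is fully faithful in the enriched sense and essentially surjective. -/
def Equivalent (C D : EnrMonCat.{v, u, w} V) : Prop :=
  ∃ H : EnrichedMonoidalFunctor (V := V) C.carrier D.carrier,
    (∀ a b, IsIso (H.toFunctor.map a b)) ∧ H.toFunctor.forget.EssSurj

variable (C : EnrMonCat.{v, u, w} V)

/-- The underlying monoidal category. -/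
abbrev underlying : Type w := ForgetEnrichment V C.carrier

/-- The functor `C(1 → -)` on the underlying category has a left adjoint. -/
def HasLeftAdjoint : Prop := (unitRepresentable V C.carrier).IsRightAdjoint

/-- `Φ` is a classifying functor of `C`: its underlying functor `F` is left adjoint to
`C(1 → -)`, say with unit `η`; the counit `F 1 ⟶ 1` is the mate of `j_1`; the oplaxitor
`F (x ⊗ y) ⟶ F x ⊗ F y` is the mate of `η_x ⊗ η_y`; and the half-braiding
`a ⊗ F v ⟶ F v ⊗ a` carries `j_a ⊗ η_v` to `η_v ⊗ j_a`. -/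
def IsClassifying (Φ : BraidedOplaxFunctor V C.underlying) : Prop :=
  ∃ adj : Φ.toT ⊣ unitRepresentable V C.carrier,
    adj.homEquiv _ _ Φ.counit = eId V (unit V : C.carrier) ∧
    (∀ x y : V, adj.homEquiv _ _ (Φ.oplaxitor x y) =
      tensorUnitElt (unitElt adj x) (unitElt adj y)) ∧
    ∀ (a : C.carrier) (v : V),
      idTensor a (unitElt adj v) ≫
          ePost a (ForgetEnrichment.homTo V (Φ.halfBraiding (ForgetEnrichment.of V a) v).hom) =
        tensorId (unitElt adj v) a

/-- The pair of the underlying monoidal category and a functor to its center. -/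
def pair (Φ : BraidedOplaxFunctor V C.underlying) : CenterPair.{v, u, w} V where
  T := C.underlying
  F := Φ

end EnrMonCat

/-- Sending a `V`-monoidal category to its underlying monoidal category together with its
classifying functor is a well-defined bijection from the equivalence classes of `V`-monoidal
categories satisfying `A` to the equivalence classes of pairs satisfying `B`: each `C` in `A` has
a classifying functor; every classifying functor of such a `C` gives a pair in `B`; two objects of
`A` are equivalent if and only if their pairs are; and each pair in `B` is equivalent to
the pair of an object of `A`. -/
def InducesBijection {V : Type u} [Category.{v} V] [MonoidalCategory V] [BraidedCategory V]
    (A : EnrMonCat.{v, u, w} V → Prop) (B : CenterPair.{v, u, w} V → Prop) : Prop :=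
  (∀ C, A C → ∃ Φ, C.IsClassifying Φ) ∧
  (∀ C, A C → ∀ Φ, C.IsClassifying Φ → B (C.pair Φ)) ∧
  (∀ C D, A C → A D → ∀ Φ Ψ, C.IsClassifying Φ → D.IsClassifying Ψ →
    (C.Equivalent D ↔ (C.pair Φ).Equivalent (D.pair Ψ))) ∧
  ∀ P, B P → ∃ C, A C ∧ ∃ Φ, C.IsClassifying Φ ∧ (C.pair Φ).Equivalent P

end BraidedEnriched

namespace BraidedEnriched

/-! ### Graded morphisms of an enriched category -/

section Graded

open ForgetEnrichment

variable {V : Type u} [Category.{v} V] [MonoidalCategory V]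
  {C : Type w} [EnrichedCategory V C]

/-- The `v`-graded morphisms `X ⟶ Y` of a `V`-category. -/
abbrev GHom (v : V) (X Y : ForgetEnrichment V C) := v ⟶ (ForgetEnrichment.to V X ⟶[V] ForgetEnrichment.to V Y)

/-- The identity as a morphism of degree `𝟙_ V`. -/
abbrev gid (X : ForgetEnrichment V C) : GHom (𝟙_ V) X X := eId V (ForgetEnrichment.to V X)

/-- Composition of graded morphisms. -/
def gcomp {u v : V} {X Y Z : ForgetEnrichment V C} (f : GHom u X Y) (g : GHom v Y Z) :
    GHom (u ⊗ v) X Z :=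
  (f ⊗ₘ g) ≫ eComp V (ForgetEnrichment.to V X) (ForgetEnrichment.to V Y) (ForgetEnrichment.to V Z)

/-- Postcomposition of a graded morphism with a morphism of the underlying category. -/
def gpost {v : V} {X Y Z : ForgetEnrichment V C} (f : GHom v X Y) (t : Y ⟶ Z) : GHom v X Z :=
  f ≫ ePost (ForgetEnrichment.to V X) (homTo V t)

/-- Precomposition of a graded morphism with a morphism of the underlying category. -/
def gpre {v : V} {X Y Z : ForgetEnrichment V C} (t : X ⟶ Y) (f : GHom v Y Z) : GHom v X Z :=
  f ≫ ePre (homTo V t) (ForgetEnrichment.to V Z)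

section

variable {u v v' w : V} {X Y Z W : ForgetEnrichment V C}

theorem gcomp_pull {u' : V} (p : u' ⟶ u) (q : v' ⟶ v) (f : GHom u X Y) (g : GHom v Y Z) :
    gcomp (p ≫ f) (q ≫ g) = (p ⊗ₘ q) ≫ gcomp f g := by
  simp [gcomp]

theorem gcomp_pull_left {u' : V} (p : u' ⟶ u) (f : GHom u X Y) (g : GHom v Y Z) :
    gcomp (p ≫ f) g = p ▷ v ≫ gcomp f g := by
  simp [gcomp, MonoidalCategory.tensorHom_def]

theorem gcomp_pull_right (q : v' ⟶ v) (f : GHom u X Y) (g : GHom v Y Z) :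
    gcomp f (q ≫ g) = u ◁ q ≫ gcomp f g := by
  simp [gcomp, MonoidalCategory.tensorHom_def']

theorem gcomp_assoc (f : GHom u X Y) (g : GHom v Y Z) (h : GHom w Z W) :
    gcomp (gcomp f g) h = (α_ u v w).hom ≫ gcomp f (gcomp g h) := by
  have e₁ : gcomp (gcomp f g) h =
      ((f ⊗ₘ g) ⊗ₘ h) ≫ eComp V _ _ _ ▷ _ ≫ eComp V (ForgetEnrichment.to V X) (ForgetEnrichment.to V Z) (ForgetEnrichment.to V W) := by
    rw [← MonoidalCategory.tensorHom_id, tensorHom_comp_tensorHom_assoc, Category.comp_id]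
    rfl
  have e₂ : gcomp f (gcomp g h) =
      (f ⊗ₘ (g ⊗ₘ h)) ≫ _ ◁ eComp V _ _ _ ≫ eComp V (ForgetEnrichment.to V X) (ForgetEnrichment.to V Y) (ForgetEnrichment.to V W) := by
    rw [← MonoidalCategory.id_tensorHom, tensorHom_comp_tensorHom_assoc, Category.comp_id]
    rfl
  rw [e₁, e₂, ← e_assoc', associator_naturality_assoc]

theorem gid_gcomp (f : GHom v X Y) : gcomp (gid X) f = (λ_ v).hom ≫ f := by
  have h : gcomp (gid X) f = (λ_ v).hom ≫ f ≫ (λ_ _).inv ≫ eId V _ ▷ _ ≫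
      eComp V (ForgetEnrichment.to V X) (ForgetEnrichment.to V X) (ForgetEnrichment.to V Y) := by
    rw [leftUnitor_inv_naturality_assoc, Iso.hom_inv_id_assoc, gcomp, MonoidalCategory.tensorHom_def',
      Category.assoc]
  rw [h, e_id_comp, Category.comp_id]

theorem gcomp_gid (f : GHom v X Y) : gcomp f (gid Y) = (ρ_ v).hom ≫ f := by
  have h : gcomp f (gid Y) = (ρ_ v).hom ≫ f ≫ (ρ_ _).inv ≫ _ ◁ eId V _ ≫
      eComp V (ForgetEnrichment.to V X) (ForgetEnrichment.to V Y) (ForgetEnrichment.to V Y) := by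
    rw [rightUnitor_inv_naturality_assoc, Iso.hom_inv_id_assoc, gcomp, MonoidalCategory.tensorHom_def,
      Category.assoc]
  rw [h, e_comp_id, Category.comp_id]

theorem gpost_eq (f : GHom v X Y) (t : Y ⟶ Z) :
    gpost f t = (ρ_ v).inv ≫ gcomp f (homTo V t) := by
  rw [gpost, ePost, rightUnitor_inv_naturality_assoc, gcomp, MonoidalCategory.tensorHom_def, Category.assoc]

theorem gpre_eq (t : X ⟶ Y) (f : GHom v Y Z) :
    gpre t f = (λ_ v).inv ≫ gcomp (homTo V t) f := by
  rw [gpre, ePre, leftUnitor_inv_naturality_assoc, gcomp, MonoidalCategory.tensorHom_def', Category.assoc]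

theorem gcomp_homTo (f : GHom v X Y) (t : Y ⟶ Z) :
    gcomp f (homTo V t) = (ρ_ v).hom ≫ gpost f t := by
  rw [gpost_eq, Iso.hom_inv_id_assoc]

theorem gpost_id (f : GHom v X Y) : gpost f (𝟙 Y) = f := by
  rw [gpost_eq, homTo_id, gcomp_gid, Iso.inv_hom_id_assoc]

theorem gpre_id (f : GHom v X Y) : gpre (𝟙 X) f = f := by
  rw [gpre_eq, homTo_id, gid_gcomp, Iso.inv_hom_id_assoc]

theorem homTo_comp_eq (t : X ⟶ Y) (s : Y ⟶ Z) :
    homTo V (t ≫ s) = (λ_ (𝟙_ V)).inv ≫ gcomp (homTo V t) (homTo V s) := by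
  rw [homTo_comp, gcomp, Category.assoc]

theorem homTo_gpost (t : X ⟶ Y) (s : Y ⟶ Z) : gpost (homTo V t) s = homTo V (t ≫ s) := by
  rw [gpost_eq, homTo_comp_eq, unitors_inv_equal]

theorem gpre_homTo (t : X ⟶ Y) (s : Y ⟶ Z) : gpre t (homTo V s) = homTo V (t ≫ s) := by
  rw [gpre_eq, homTo_comp_eq]

theorem gid_gpost (t : X ⟶ Y) : gpost (gid X) t = homTo V t := by
  have := homTo_gpost (𝟙 X) t
  rwa [homTo_id, Category.id_comp] at this

theorem gpre_gid (t : X ⟶ Y) : gpre t (gid Y) = homTo V t := by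
  have := gpre_homTo t (𝟙 Y)
  rwa [homTo_id, Category.comp_id] at this

theorem pull_gpost (p : v' ⟶ v) (f : GHom v X Y) (t : Y ⟶ Z) :
    p ≫ gpost f t = gpost (p ≫ f) t := by
  simp [gpost]

theorem pull_gpre (p : v' ⟶ v) (t : X ⟶ Y) (f : GHom v Y Z) :
    p ≫ gpre t f = gpre t (p ≫ f) := by
  simp [gpre]

theorem gcomp_gpost (f : GHom u X Y) (g : GHom v Y Z) (t : Z ⟶ W) :
    gcomp f (gpost g t) = gpost (gcomp f g) t := by
  rw [gpost_eq, gpost_eq, gcomp_pull_right, gcomp_assoc, rightUnitor_tensor_inv]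
  simp

theorem gpre_gcomp (t : X ⟶ Y) (f : GHom u Y Z) (g : GHom v Z W) :
    gcomp (gpre t f) g = gpre t (gcomp f g) := by
  rw [gpre_eq, gpre_eq, gcomp_pull_left, gcomp_assoc, leftUnitor_tensor_inv]
  simp

theorem gpost_gcomp (f : GHom u X Y) (t : Y ⟶ Z) (g : GHom v Z W) :
    gcomp (gpost f t) g = gcomp f (gpre t g) := by
  rw [gpost_eq, gpre_eq, gcomp_pull_left, gcomp_pull_right, gcomp_assoc]
  simp

theorem gpost_gpost (f : GHom v X Y) (t : Y ⟶ Z) (s : Z ⟶ W) :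
    gpost (gpost f t) s = gpost f (t ≫ s) := by
  conv_rhs => rw [gpost_eq, ← homTo_gpost, gcomp_gpost, pull_gpost, ← gpost_eq]

theorem gpre_gpre (t : X ⟶ Y) (s : Y ⟶ Z) (f : GHom v Z W) :
    gpre t (gpre s f) = gpre (t ≫ s) f := by
  conv_rhs => rw [gpre_eq, ← gpre_homTo, gpre_gcomp, pull_gpre, ← gpre_eq]

theorem gpre_gpost (t : X ⟶ Y) (f : GHom v Y Z) (s : Z ⟶ W) :
    gpost (gpre t f) s = gpre t (gpost f s) := by
  rw [gpost_eq, gpre_gcomp, pull_gpre, ← gpost_eq]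

theorem gpost_iso_cancel {f g : GHom v X Y} (t : Y ≅ Z) (h : gpost f t.hom = gpost g t.hom) :
    f = g := by
  rw [← gpost_id f, ← gpost_id g, ← t.hom_inv_id, ← gpost_gpost, h, gpost_gpost]

end

end Graded

/-! ### Tensor products and whiskerings of graded morphisms. -/

section GradedMonoidal

open ForgetEnrichment EnrichedTensor

variable {V : Type u} [Category.{v} V] [MonoidalCategory V] [BraidedCategory V]
  {C : Type w} [EnrichedCategory V C] [EnrichedMonoidalCategory V C]

/-- The tensor product of graded morphisms. -/
def gtensor {u v : V} {X Y Z W : ForgetEnrichment V C} (f : GHom u X Y) (g : GHom v Z W) :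
    GHom (u ⊗ v) (X ⊗ Z) (Y ⊗ W) :=
  (f ⊗ₘ g) ≫ tHom (ForgetEnrichment.to V X) (ForgetEnrichment.to V Y) (ForgetEnrichment.to V Z) (ForgetEnrichment.to V W)

/-- Left whiskering of a graded morphism. -/
def gwl {v : V} (Z : ForgetEnrichment V C) {X Y : ForgetEnrichment V C} (f : GHom v X Y) :
    GHom v (Z ⊗ X) (Z ⊗ Y) :=
  f ≫ (tensorLeftEnriched V (ForgetEnrichment.to V Z)).map (ForgetEnrichment.to V X) (ForgetEnrichment.to V Y)

/-- Right whiskering of a graded morphism. -/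
def gwr {v : V} {X Y : ForgetEnrichment V C} (f : GHom v X Y) (Z : ForgetEnrichment V C) :
    GHom v (X ⊗ Z) (Y ⊗ Z) :=
  f ≫ (tensorRightEnriched V (ForgetEnrichment.to V Z)).map (ForgetEnrichment.to V X) (ForgetEnrichment.to V Y)

variable {u v v' w : V} {X Y Z W : ForgetEnrichment V C}

theorem gwl_eq (f : GHom v X Y) : gwl Z f = (λ_ v).inv ≫ gtensor (gid Z) f := by
  change f ≫ (λ_ _).inv ≫ _ ▷ _ ≫ tHom _ _ _ _ = (λ_ v).inv ≫ (_ ⊗ₘ _) ≫ tHom _ _ _ _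
  rw [leftUnitor_inv_naturality_assoc, MonoidalCategory.tensorHom_def', Category.assoc]

theorem gwr_eq (f : GHom v X Y) : gwr f Z = (ρ_ v).inv ≫ gtensor f (gid Z) := by
  change f ≫ (ρ_ _).inv ≫ _ ◁ _ ≫ tHom _ _ _ _ = (ρ_ v).inv ≫ (_ ⊗ₘ _) ≫ tHom _ _ _ _
  rw [rightUnitor_inv_naturality_assoc, MonoidalCategory.tensorHom_def, Category.assoc]

theorem gtensor_pull {u' : V} (p : u' ⟶ u) (q : v' ⟶ v) (f : GHom u X Y) (g : GHom v Z W) :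
    gtensor (p ≫ f) (q ≫ g) = (p ⊗ₘ q) ≫ gtensor f g := by
  simp [gtensor]

theorem gtensor_pull_left {u' : V} (p : u' ⟶ u) (f : GHom u X Y) (g : GHom v Z W) :
    gtensor (p ≫ f) g = p ▷ v ≫ gtensor f g := by
  have := gtensor_pull p (𝟙 v) f g
  rwa [Category.id_comp, MonoidalCategory.tensorHom_id] at this

theorem gtensor_pull_right (q : v' ⟶ v) (f : GHom u X Y) (g : GHom v Z W) :
    gtensor f (q ≫ g) = u ◁ q ≫ gtensor f g := by
  have := gtensor_pull (𝟙 u) q f g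
  rwa [Category.id_comp, MonoidalCategory.id_tensorHom] at this

theorem gtensor_gid_gid :
    gtensor (gid X) (gid Y) = (λ_ (𝟙_ V)).hom ≫ gid (X ⊗ Y) := by
  have h := EnrichedMonoidalCategory.tensor_id (V := V) (ForgetEnrichment.to V X) (ForgetEnrichment.to V Y)
  have h' : gid (X ⊗ Y) = (λ_ (𝟙_ V)).inv ≫ gtensor (gid X) (gid Y) := h.symm
  rw [h', Iso.hom_inv_id_assoc]

theorem gtensor_interchange {X₁ X₂ X₃ Y₁ Y₂ Y₃ : ForgetEnrichment V C}
    (f : GHom u X₁ X₂) (g : GHom v Y₁ Y₂) (f' : GHom v' X₂ X₃) (g' : GHom w Y₂ Y₃) :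
    gcomp (gtensor f g) (gtensor f' g') =
      tensorμ u v v' w ≫ gtensor (gcomp f f') (gcomp g g') := by
  have h := EnrichedMonoidalCategory.interchange (V := V) (ForgetEnrichment.to V X₁) (ForgetEnrichment.to V X₂) (ForgetEnrichment.to V X₃)
    (ForgetEnrichment.to V Y₁) (ForgetEnrichment.to V Y₂) (ForgetEnrichment.to V Y₃)
  change (((f ⊗ₘ g) ≫ tHom _ _ _ _) ⊗ₘ ((f' ⊗ₘ g') ≫ tHom _ _ _ _)) ≫ eComp V (tObj V _ _)
    (tObj V _ _) (tObj V _ _) = _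
  rw [← tensorHom_comp_tensorHom, Category.assoc, h, tensorμ_natural_assoc,
    tensorHom_comp_tensorHom_assoc]
  rfl

/-- Interchange against identities: the two middle degrees are both `𝟙_ V`, so the braiding inside
`tensorμ` is trivial. Tensor products can therefore be replaced by whiskerings. -/
theorem gtensor_eq_gcomp (f : GHom u X Y) (g : GHom v Z W) :
    gtensor f g = gcomp (gwr f Z) (gwl Y g) := by
  rw [gwr_eq, gwl_eq, gcomp_pull, gtensor_interchange, gcomp_gid, gid_gcomp, gtensor_pull]
  have : ((ρ_ u).inv ⊗ₘ (λ_ v).inv) ≫ tensorμ u (𝟙_ V) (𝟙_ V) v ≫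
      ((ρ_ u).hom ⊗ₘ (λ_ v).hom) = 𝟙 _ := by
    simp only [tensorμ, braiding_tensorUnit_left]
    monoidal
  rw [reassoc_of% this]

/-- In the opposite order the two middle degrees are `v` and `u`, so the braiding inside `tensorμ`
survives. In this form the interchange law yields the braidedness of the classifying functor. -/
theorem gwl_gcomp_gwr (f : GHom u X Y) (g : GHom v Z W) :
    gcomp (gwl X g) (gwr f W) = (β_ v u).hom ≫ gcomp (gwr f Z) (gwl Y g) := by
  rw [← gtensor_eq_gcomp, gwr_eq, gwl_eq, gcomp_pull, gtensor_interchange, gcomp_gid, gid_gcomp,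
    gtensor_pull]
  have : ((λ_ v).inv ⊗ₘ (ρ_ u).inv) ≫ tensorμ (𝟙_ V) v u (𝟙_ V) ≫
      ((λ_ u).hom ⊗ₘ (ρ_ v).hom) = (β_ v u).hom := by
    simp only [tensorμ]
    monoidal
  rw [reassoc_of% this]

theorem pull_gwl (p : v' ⟶ v) (f : GHom v X Y) : gwl Z (p ≫ f) = p ≫ gwl Z f :=
  Category.assoc _ _ _

theorem pull_gwr (p : v' ⟶ v) (f : GHom v X Y) : gwr (p ≫ f) Z = p ≫ gwr f Z :=
  Category.assoc _ _ _

theorem gwl_gcomp (f : GHom u X Y) (g : GHom v Y W) :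
    gwl Z (gcomp f g) = gcomp (gwl Z f) (gwl Z g) := by
  have h := congrArg ((f ⊗ₘ g) ≫ ·) ((tensorLeftEnriched V (ForgetEnrichment.to V Z)).map_comp
    (ForgetEnrichment.to V X) (ForgetEnrichment.to V Y) (ForgetEnrichment.to V W))
  simp only [tensorHom_comp_tensorHom_assoc] at h
  exact (Category.assoc _ _ _).trans h

theorem gwr_gcomp (f : GHom u X Y) (g : GHom v Y W) :
    gwr (gcomp f g) Z = gcomp (gwr f Z) (gwr g Z) := by
  have h := congrArg ((f ⊗ₘ g) ≫ ·) ((tensorRightEnriched V (ForgetEnrichment.to V Z)).map_comp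
    (ForgetEnrichment.to V X) (ForgetEnrichment.to V Y) (ForgetEnrichment.to V W))
  simp only [tensorHom_comp_tensorHom_assoc] at h
  exact (Category.assoc _ _ _).trans h

theorem gwl_homTo (t : X ⟶ Y) : gwl Z (homTo V t) = homTo V (Z ◁ t) := by
  rw [gwl_eq]
  rfl

theorem gwr_homTo (t : X ⟶ Y) : gwr (homTo V t) Z = homTo V (t ▷ Z) := by
  rw [gwr_eq, ← unitors_inv_equal]
  rfl

theorem gwl_gid : gwl Z (gid X) = gid (Z ⊗ X) := by
  rw [gwl_eq, gtensor_gid_gid, Iso.inv_hom_id_assoc]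

theorem gwr_gid : gwr (gid X) Z = gid (X ⊗ Z) := by
  rw [gwr_eq, gtensor_gid_gid, ← unitors_inv_equal, Iso.inv_hom_id_assoc]

theorem gwl_gpost (f : GHom v X Y) (t : Y ⟶ W) :
    gwl Z (gpost f t) = gpost (gwl Z f) (Z ◁ t) := by
  rw [gpost_eq, gpost_eq, pull_gwl, gwl_gcomp, gwl_homTo]

theorem gwl_gpre (t : X ⟶ Y) (f : GHom v Y W) :
    gwl Z (gpre t f) = gpre (Z ◁ t) (gwl Z f) := by
  rw [gpre_eq, gpre_eq, pull_gwl, gwl_gcomp, gwl_homTo]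

theorem gwr_gpost (f : GHom v X Y) (t : Y ⟶ W) :
    gwr (gpost f t) Z = gpost (gwr f Z) (t ▷ Z) := by
  rw [gpost_eq, gpost_eq, pull_gwr, gwr_gcomp, gwr_homTo]

theorem gwr_gpre (t : X ⟶ Y) (f : GHom v Y W) :
    gwr (gpre t f) Z = gpre (t ▷ Z) (gwr f Z) := by
  rw [gpre_eq, gpre_eq, pull_gwr, gwr_gcomp, gwr_homTo]

/-- The exchange law with one factor of degree `𝟙_ V`, where the braiding is trivial. -/
theorem gwl_naturality (t : Z ⟶ W) (f : GHom v X Y) :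
    gpost (gwl Z f) (t ▷ Y) = gpre (t ▷ X) (gwl W f) := by
  rw [gpost_eq, gpre_eq, ← gwr_homTo, gwl_gcomp_gwr, gwr_homTo]
  simp

theorem gwr_naturality (f : GHom v X Y) (t : Z ⟶ W) :
    gpost (gwr f Z) (Y ◁ t) = gpre (X ◁ t) (gwr f W) := by
  rw [gpost_eq, gpre_eq, ← gwl_homTo, ← gwl_homTo, gwl_gcomp_gwr]
  simp

theorem gtensor_associator {X₁ X₂ X₃ Y₁ Y₂ Y₃ : ForgetEnrichment V C} (f : GHom u X₁ Y₁)
    (g : GHom v X₂ Y₂) (h : GHom w X₃ Y₃) :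
    gpost (gtensor (gtensor f g) h) (α_ Y₁ Y₂ Y₃).hom =
      (α_ u v w).hom ≫ gpre (α_ X₁ X₂ X₃).hom (gtensor f (gtensor g h)) := by
  have e := EnrichedMonoidalCategory.associator_naturality (V := V) (ForgetEnrichment.to V X₁) (ForgetEnrichment.to V Y₁)
    (ForgetEnrichment.to V X₂) (ForgetEnrichment.to V Y₂) (ForgetEnrichment.to V X₃) (ForgetEnrichment.to V Y₃)
  have e₁ : gtensor (gtensor f g) h = ((f ⊗ₘ g) ⊗ₘ h) ≫ tHom _ _ _ _ ▷ _ ≫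
      tHom (tObj V (ForgetEnrichment.to V X₁) (ForgetEnrichment.to V X₂)) (tObj V (ForgetEnrichment.to V Y₁) (ForgetEnrichment.to V Y₂)) (ForgetEnrichment.to V X₃) (ForgetEnrichment.to V Y₃) := by
    rw [← MonoidalCategory.tensorHom_id, tensorHom_comp_tensorHom_assoc, Category.comp_id]
    rfl
  have e₂ : gtensor f (gtensor g h) = (f ⊗ₘ (g ⊗ₘ h)) ≫ _ ◁ tHom _ _ _ _ ≫
      tHom (ForgetEnrichment.to V X₁) (ForgetEnrichment.to V Y₁) (tObj V (ForgetEnrichment.to V X₂) (ForgetEnrichment.to V X₃)) (tObj V (ForgetEnrichment.to V Y₂) (ForgetEnrichment.to V Y₃)) := by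
    rw [← MonoidalCategory.id_tensorHom, tensorHom_comp_tensorHom_assoc, Category.comp_id]
    rfl
  rw [gpost, gpre, e₁, e₂]
  simp only [Category.assoc]
  rw [← MonoidalCategory.associator_naturality_assoc]
  exact congrArg (((f ⊗ₘ g) ⊗ₘ h) ≫ ·) e

theorem gwl_tensor (f : GHom v X Y) :
    gpost (gwl (Z ⊗ W) f) (α_ Z W Y).hom = gpre (α_ Z W X).hom (gwl Z (gwl W f)) := by
  have h : gwl (Z ⊗ W) f = (λ_ v).inv ≫ (λ_ (𝟙_ V)).inv ▷ v ≫
      gtensor (gtensor (gid Z) (gid W)) f := by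
    rw [gtensor_gid_gid, gtensor_pull_left, inv_hom_whiskerRight_assoc, gwl_eq]
  rw [h, ← pull_gpost, ← pull_gpost, gtensor_associator, gwl_eq, gwl_eq, gtensor_pull_right,
    ← pull_gpre, ← pull_gpre]
  simp only [← Category.assoc]
  congr 1
  monoidal

theorem gwr_tensor (f : GHom v X Y) :
    gpost (gwr (gwr f Z) W) (α_ Y Z W).hom = gpre (α_ X Z W).hom (gwr f (Z ⊗ W)) := by
  have h : gwr f (Z ⊗ W) = (ρ_ v).inv ≫ v ◁ (λ_ (𝟙_ V)).inv ≫
      gtensor f (gtensor (gid Z) (gid W)) := by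
    rw [gtensor_gid_gid, gtensor_pull_right, whiskerLeft_inv_hom_assoc, gwr_eq]
  rw [h, gwr_eq, gwr_eq, gtensor_pull_left, ← pull_gpost, ← pull_gpost, gtensor_associator,
    ← pull_gpre, ← pull_gpre]
  simp only [← Category.assoc]
  congr 1
  monoidal

theorem gwl_gwr (f : GHom v X Y) :
    gpost (gwr (gwl Z f) W) (α_ Z Y W).hom = gpre (α_ Z X W).hom (gwl Z (gwr f W)) := by
  rw [gwl_eq, gwr_eq, gwl_eq, gwr_eq, gtensor_pull_left, gtensor_pull_right, ← pull_gpost,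
    ← pull_gpost, gtensor_associator, ← pull_gpre, ← pull_gpre]
  simp only [← Category.assoc]
  congr 1
  monoidal

theorem gwl_unit (f : GHom v X Y) :
    gpost (gwl (𝟙_ _) f) (λ_ Y).hom = gpre (λ_ X).hom f := by
  have e := congrArg (f ≫ ·) (EnrichedMonoidalCategory.leftUnitor_naturality (V := V)
    (ForgetEnrichment.to V X) (ForgetEnrichment.to V Y))
  refine Eq.trans (b := (f ≫ (λ_ _).inv ≫ eId V (unit V) ▷ _ ≫ tHom _ _ _ _) ≫
    ePost _ (homTo V (EnrichedMonoidalCategory.leftUnitor _).hom)) rfl (Eq.trans ?_ e)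
  simp only [Category.assoc]

theorem gwr_unit (f : GHom v X Y) :
    gpost (gwr f (𝟙_ _)) (ρ_ Y).hom = gpre (ρ_ X).hom f := by
  have e := congrArg (f ≫ ·) (EnrichedMonoidalCategory.rightUnitor_naturality (V := V)
    (ForgetEnrichment.to V X) (ForgetEnrichment.to V Y))
  refine Eq.trans (b := (f ≫ (ρ_ _).inv ≫ _ ◁ eId V (unit V) ≫ tHom _ _ _ _) ≫
    ePost _ (homTo V (EnrichedMonoidalCategory.rightUnitor _).hom)) rfl (Eq.trans ?_ e)
  simp only [Category.assoc]

end GradedMonoidal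

end BraidedEnriched

namespace BraidedEnriched

/-! ### Universal graded morphisms and enriched adjunctions -/

section Universal

open ForgetEnrichment

variable {V : Type u} [Category.{v} V] [MonoidalCategory V]
  {C : Type w₁} [EnrichedCategory V C] {D : Type w₂} [EnrichedCategory V D]

/-- A graded morphism is universal if every graded morphism of the same degree and source factors
uniquely through it. -/
def IsUniv {v : V} {X Y : ForgetEnrichment V C} (f : GHom v X Y) : Prop :=
  ∀ Z : ForgetEnrichment V C, Function.Bijective (fun t : Y ⟶ Z => gpost f t)

/-- The image of a graded morphism under a `V`-functor. -/
def EnrichedFunctor.gmap (L : EnrichedFunctor V C D) {v : V} {X Y : ForgetEnrichment V C}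
    (f : GHom v X Y) : GHom v (L.forget.obj X) (L.forget.obj Y) :=
  f ≫ L.map (ForgetEnrichment.to V X) (ForgetEnrichment.to V Y)

section

variable (L : EnrichedFunctor V C D) {u v : V} {X Y Z : ForgetEnrichment V C}

theorem EnrichedFunctor.gmap_gcomp (f : GHom u X Y) (g : GHom v Y Z) :
    EnrichedFunctor.gmap L (gcomp f g) =
      gcomp (EnrichedFunctor.gmap L f) (EnrichedFunctor.gmap L g) := by
  have h := congrArg ((f ⊗ₘ g) ≫ ·) (L.map_comp
    (ForgetEnrichment.to V X) (ForgetEnrichment.to V Y) (ForgetEnrichment.to V Z))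
  simp only [tensorHom_comp_tensorHom_assoc] at h
  exact (Category.assoc _ _ _).trans h

theorem EnrichedFunctor.gmap_pull {v' : V} (p : v' ⟶ v) (f : GHom v X Y) :
    EnrichedFunctor.gmap L (p ≫ f) = p ≫ EnrichedFunctor.gmap L f :=
  Category.assoc _ _ _

theorem EnrichedFunctor.gmap_homTo (t : X ⟶ Y) :
    EnrichedFunctor.gmap L (homTo V t) = homTo V (L.forget.map t) :=
  rfl

theorem EnrichedFunctor.gmap_gid : EnrichedFunctor.gmap L (gid X) = gid (L.forget.obj X) :=
  L.map_id _

theorem EnrichedFunctor.gmap_gpost (f : GHom v X Y) (t : Y ⟶ Z) :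
    EnrichedFunctor.gmap L (gpost f t) = gpost (EnrichedFunctor.gmap L f) (L.forget.map t) := by
  rw [gpost_eq, gpost_eq, EnrichedFunctor.gmap_pull, EnrichedFunctor.gmap_gcomp,
    EnrichedFunctor.gmap_homTo]

theorem EnrichedFunctor.gmap_gpre (t : X ⟶ Y) (f : GHom v Y Z) :
    EnrichedFunctor.gmap L (gpre t f) = gpre (L.forget.map t) (EnrichedFunctor.gmap L f) := by
  rw [gpre_eq, gpre_eq, EnrichedFunctor.gmap_pull, EnrichedFunctor.gmap_gcomp,
    EnrichedFunctor.gmap_homTo]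

end

theorem IsUniv.existsUnique {v : V} {X Y Z : ForgetEnrichment V C} {f : GHom v X Y}
    (hf : IsUniv f) (g : GHom v X Z) : ∃! t : Y ⟶ Z, gpost f t = g :=
  (hf Z).existsUnique g

theorem IsUniv.hom_ext {v : V} {X Y Z : ForgetEnrichment V C} {f : GHom v X Y}
    (hf : IsUniv f) {s t : Y ⟶ Z} (h : gpost f s = gpost f t) : s = t :=
  (hf Z).1 h

theorem IsUniv.exists_iso {v : V} {X Y Z : ForgetEnrichment V C} {f : GHom v X Y}
    (hf : IsUniv f) {g : GHom v X Z} (hg : IsUniv g) : ∃ e : Y ≅ Z, gpost f e.hom = g := by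
  obtain ⟨s, hs⟩ := (hf Z).2 g
  obtain ⟨t, ht⟩ := (hg Y).2 f
  dsimp only at hs ht
  refine ⟨⟨s, t, hf.hom_ext ?_, hg.hom_ext ?_⟩, hs⟩
  · rw [← gpost_gpost, hs, ht, gpost_id]
  · rw [← gpost_gpost, ht, hs, gpost_id]

theorem gpre_iso_bijective {v : V} {X Y : ForgetEnrichment V C} (e : X ≅ Y)
    (Z : ForgetEnrichment V C) :
    Function.Bijective (fun f : GHom v Y Z => gpre e.hom f) := by
  refine Function.bijective_iff_has_inverse.2 ⟨fun f => gpre e.inv f, fun f => ?_, fun f => ?_⟩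
  · dsimp only
    rw [gpre_gpre, e.inv_hom_id, gpre_id]
  · dsimp only
    rw [gpre_gpre, e.hom_inv_id, gpre_id]

theorem IsUniv.gpre_iso {v : V} {X Y Z : ForgetEnrichment V C} {f : GHom v Y Z}
    (hf : IsUniv f) (e : X ≅ Y) : IsUniv (gpre e.hom f) := by
  intro W
  have : (fun t : Z ⟶ W => gpost (gpre e.hom f) t) =
      (fun g => gpre e.hom g) ∘ fun t : Z ⟶ W => gpost f t := by
    funext t
    exact gpre_gpost _ _ _
  rw [this]
  exact (gpre_iso_bijective e W).comp (hf W)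

theorem iso_comp_bijective {V : Type u} [Category.{v} V] {v a b : V} (e : a ≅ b) :
    Function.Bijective (fun f : v ⟶ a => f ≫ e.hom) :=
  e.homToEquiv.bijective

/-- Left `V`-adjoints preserve universal graded morphisms. -/
theorem IsUniv.gmap {L : EnrichedFunctor V C D} {R : EnrichedFunctor V D C}
    (adj : EnrichedAdjunction L R) {v : V} {X Y : ForgetEnrichment V C} {f : GHom v X Y}
    (hf : IsUniv f) : IsUniv (EnrichedFunctor.gmap L f) := by
  intro Z
  let T (s : Y ⟶ R.forget.obj Z) : L.forget.obj Y ⟶ Z := homOf V (homTo V s ≫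
    (adj.θ (ForgetEnrichment.to V Y) (ForgetEnrichment.to V Z)).inv)
  have hT : Function.Bijective T :=
    iso_comp_bijective (adj.θ (ForgetEnrichment.to V Y) (ForgetEnrichment.to V Z)).symm
  rw [← Function.Bijective.of_comp_iff _ hT]
  -- Naturality of `θ` in the first variable: transposition turns composition with `f` into
  -- composition with its image, so bijectivity passes from the one to the other.
  have key : (fun t => gpost (EnrichedFunctor.gmap L f) t) ∘ T =
      (fun g : GHom v X (R.forget.obj Z) =>
        g ≫ (adj.θ (ForgetEnrichment.to V X) (ForgetEnrichment.to V Z)).inv) ∘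
          fun s => gpost f s := by
    funext s
    have h := congrArg ((f ⊗ₘ homTo V s) ≫ ·) (adj.naturality_left
      (ForgetEnrichment.to V X) (ForgetEnrichment.to V Y) (ForgetEnrichment.to V Z))
    simp only [tensorHom_comp_tensorHom_assoc] at h
    refine (gpost_eq (EnrichedFunctor.gmap L f) (T s)).trans (Eq.trans ?_
      (congrArg (· ≫ _) (gpost_eq f s)).symm)
    rw [Category.assoc]
    exact congrArg (_ ≫ ·) (h.symm.trans (Category.assoc _ _ _).symm)
  rw [key]
  exact (iso_comp_bijective
    (adj.θ (ForgetEnrichment.to V X) (ForgetEnrichment.to V Z)).symm).comp (hf _)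

/-- The transposition along a morphism `ε : L Z ⟶ Y`. -/
def transposeRight (L : EnrichedFunctor V C D) (X : ForgetEnrichment V C)
    {Z : ForgetEnrichment V C} {Y : ForgetEnrichment V D} (ε : L.forget.obj Z ⟶ Y) :
    (ForgetEnrichment.to V X ⟶[V] ForgetEnrichment.to V Z) ⟶
      (ForgetEnrichment.to V (L.forget.obj X) ⟶[V] ForgetEnrichment.to V Y) :=
  gpost (EnrichedFunctor.gmap L (𝟙 _ : GHom _ X Z)) ε

theorem comp_transposeRight (L : EnrichedFunctor V C D) {v : V} {X Z : ForgetEnrichment V C}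
    {Y : ForgetEnrichment V D} (ε : L.forget.obj Z ⟶ Y) (f : GHom v X Z) :
    f ≫ transposeRight L X ε = gpost (EnrichedFunctor.gmap L f) ε := by
  rw [transposeRight, pull_gpost, ← EnrichedFunctor.gmap_pull, Category.comp_id]

theorem gcomp_comp_transposeRight (L : EnrichedFunctor V C D) {u v : V}
    {X Z W : ForgetEnrichment V C} {Y : ForgetEnrichment V D} (ε : L.forget.obj W ⟶ Y)
    (f : GHom u X Z) (g : GHom v Z W) :
    gcomp f g ≫ transposeRight L X ε =
      gcomp (EnrichedFunctor.gmap L f) (g ≫ transposeRight L Z ε) := by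
  rw [comp_transposeRight, comp_transposeRight, EnrichedFunctor.gmap_gcomp, gcomp_gpost]

/-- Identities of hom objects are the generic graded morphisms, so statements about `eComp` follow
from statements about `gcomp`. -/
theorem eComp_eq_gcomp (X Y Z : ForgetEnrichment V C) :
    eComp V (ForgetEnrichment.to V X) (ForgetEnrichment.to V Y) (ForgetEnrichment.to V Z) =
      gcomp (𝟙 _ : GHom _ X Y) (𝟙 _ : GHom _ Y Z) := by
  rw [gcomp, id_tensorHom_id, Category.id_comp]

theorem gcomp_eq_comp {u v : V} {X Y Z : ForgetEnrichment V C} (f : GHom u X Y) (g : GHom v Y Z) :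
    (f ⊗ₘ g) ≫ eComp V (ForgetEnrichment.to V X) (ForgetEnrichment.to V Y)
      (ForgetEnrichment.to V Z) = gcomp f g :=
  rfl

/-! ### Right `V`-adjoints from universal arrows. -/

section RightAdjoint

variable (L : EnrichedFunctor V C D) (R : ForgetEnrichment V D → ForgetEnrichment V C)
  (ε : ∀ Y, L.forget.obj (R Y) ⟶ Y) [∀ X Y, IsIso (transposeRight L X (ε Y))]

/-- The action on hom objects of a right `V`-adjoint given by universal arrows. -/
noncomputable def rightAdjointMap (X Y : ForgetEnrichment V D) :
    (ForgetEnrichment.to V X ⟶[V] ForgetEnrichment.to V Y) ⟶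
      (ForgetEnrichment.to V (R X) ⟶[V] ForgetEnrichment.to V (R Y)) :=
  gpre (ε X) (𝟙 _ : GHom _ X Y) ≫ inv (transposeRight L (R X) (ε Y))

theorem comp_rightAdjointMap {v : V} {X Y : ForgetEnrichment V D} (f : GHom v X Y) :
    f ≫ rightAdjointMap L R ε X Y = gpre (ε X) f ≫ inv (transposeRight L (R X) (ε Y)) := by
  rw [rightAdjointMap, ← Category.assoc, pull_gpre, Category.comp_id]

/-- Becomes the associativity-type rule for `transposeRight` after composing with the invertible
transposition. Taken at generic graded morphisms it gives both functoriality of the right adjoint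
and naturality of the adjunction in the second variable. -/
theorem gcomp_comp_inv_transposeRight {u v : V} {X : ForgetEnrichment V C}
    {Y Z : ForgetEnrichment V D} (f : GHom u (L.forget.obj X) Y) (g : GHom v Y Z) :
    gcomp f g ≫ inv (transposeRight L X (ε Z)) =
      gcomp (f ≫ inv (transposeRight L X (ε Y))) (g ≫ rightAdjointMap L R ε Y Z) := by
  rw [← cancel_mono (transposeRight L X (ε Z)), Category.assoc, IsIso.inv_hom_id,
    Category.comp_id, gcomp_comp_transposeRight, comp_rightAdjointMap, Category.assoc,
    IsIso.inv_hom_id, Category.comp_id, ← gpost_gcomp, ← comp_transposeRight, Category.assoc,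
    IsIso.inv_hom_id, Category.comp_id]

/-- The right `V`-adjoint given by universal arrows. -/
noncomputable def rightAdjointOfUniversal : EnrichedFunctor V D C where
  obj Y := ForgetEnrichment.to V (R (ForgetEnrichment.of V Y))
  map X Y := rightAdjointMap L R ε (ForgetEnrichment.of V X) (ForgetEnrichment.of V Y)
  map_id Y := by
    refine (comp_rightAdjointMap L R ε (gid (ForgetEnrichment.of V Y))).trans ?_
    rw [gpre_gid, IsIso.comp_inv_eq]
    refine Eq.symm ((comp_transposeRight L (ε (ForgetEnrichment.of V Y)) (gid _)).trans ?_)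
    rw [EnrichedFunctor.gmap_gid, gid_gpost]
  map_comp X Y Z := by
    refine Eq.trans ?_ (gcomp_eq_comp (rightAdjointMap L R ε (ForgetEnrichment.of V X)
      (ForgetEnrichment.of V Y)) (rightAdjointMap L R ε (ForgetEnrichment.of V Y)
      (ForgetEnrichment.of V Z))).symm
    refine (congrArg (· ≫ rightAdjointMap L R ε (ForgetEnrichment.of V X)
      (ForgetEnrichment.of V Z)) (eComp_eq_gcomp (ForgetEnrichment.of V X)
      (ForgetEnrichment.of V Y) (ForgetEnrichment.of V Z))).trans ?_
    rw [comp_rightAdjointMap, ← gpre_gcomp, gcomp_comp_inv_transposeRight, Category.id_comp]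
    rfl

/-- The `V`-adjunction given by universal arrows. -/
noncomputable def adjunctionOfRightUniversal :
    EnrichedAdjunction L (rightAdjointOfUniversal L R ε) where
  θ X Y := (asIso (transposeRight L (ForgetEnrichment.of V X)
    (ε (ForgetEnrichment.of V Y)))).symm
  naturality_left X Y Z := by
    refine (congrArg (· ≫ transposeRight L (ForgetEnrichment.of V X)
      (ε (ForgetEnrichment.of V Z))) (eComp_eq_gcomp (ForgetEnrichment.of V X)
      (ForgetEnrichment.of V Y) (R (ForgetEnrichment.of V Z)))).trans ?_
    rw [gcomp_comp_transposeRight, Category.id_comp, EnrichedFunctor.gmap, Category.id_comp]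
    rfl
  naturality_right X Y Z := by
    refine (congrArg (· ≫ inv (transposeRight L (ForgetEnrichment.of V X)
      (ε (ForgetEnrichment.of V Z)))) (eComp_eq_gcomp (L.forget.obj (ForgetEnrichment.of V X))
      (ForgetEnrichment.of V Y) (ForgetEnrichment.of V Z))).trans ?_
    rw [gcomp_comp_inv_transposeRight, Category.id_comp, Category.id_comp]
    rfl

end RightAdjoint

/-- The transposition along a morphism `η : X ⟶ R Z`. -/
def transposeLeft (R : EnrichedFunctor V D C) {X : ForgetEnrichment V C}
    {Z : ForgetEnrichment V D} (η : X ⟶ R.forget.obj Z) (Y : ForgetEnrichment V D) :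
    (ForgetEnrichment.to V Z ⟶[V] ForgetEnrichment.to V Y) ⟶
      (ForgetEnrichment.to V X ⟶[V] ForgetEnrichment.to V (R.forget.obj Y)) :=
  gpre η (EnrichedFunctor.gmap R (𝟙 _ : GHom _ Z Y))

theorem comp_transposeLeft (R : EnrichedFunctor V D C) {v : V} {X : ForgetEnrichment V C}
    {Z Y : ForgetEnrichment V D} (η : X ⟶ R.forget.obj Z) (f : GHom v Z Y) :
    f ≫ transposeLeft R η Y = gpre η (EnrichedFunctor.gmap R f) := by
  rw [transposeLeft, pull_gpre, ← EnrichedFunctor.gmap_pull, Category.comp_id]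

theorem gcomp_comp_transposeLeft (R : EnrichedFunctor V D C) {u v : V}
    {X : ForgetEnrichment V C} {Z Y W : ForgetEnrichment V D} (η : X ⟶ R.forget.obj Z)
    (f : GHom u Z Y) (g : GHom v Y W) :
    gcomp f g ≫ transposeLeft R η W =
      gcomp (f ≫ transposeLeft R η Y) (EnrichedFunctor.gmap R g) := by
  rw [comp_transposeLeft, comp_transposeLeft, EnrichedFunctor.gmap_gcomp, gpre_gcomp]

/-- An invertible transposition, as an isomorphism. -/
noncomputable def transposeLeftIso (R : EnrichedFunctor V D C) {X : ForgetEnrichment V C}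
    (Z : ForgetEnrichment V D) (η : X ⟶ R.forget.obj Z) (Y : ForgetEnrichment V D)
    [IsIso (transposeLeft R η Y)] :
    (ForgetEnrichment.to V Z ⟶[V] ForgetEnrichment.to V Y) ≅
      (ForgetEnrichment.to V X ⟶[V] ForgetEnrichment.to V (R.forget.obj Y)) :=
  asIso (transposeLeft R η Y)

/-! ### Left `V`-adjoints from universal arrows. -/

section LeftAdjoint

variable (R : EnrichedFunctor V D C) (L : ForgetEnrichment V C → ForgetEnrichment V D)
  (η : ∀ X, X ⟶ R.forget.obj (L X)) [∀ X Y, IsIso (transposeLeft R (η X) Y)]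

/-- The action on hom objects of a left `V`-adjoint given by universal arrows. -/
noncomputable def leftAdjointMap (X Y : ForgetEnrichment V C) :
    (ForgetEnrichment.to V X ⟶[V] ForgetEnrichment.to V Y) ⟶
      (ForgetEnrichment.to V (L X) ⟶[V] ForgetEnrichment.to V (L Y)) :=
  gpost (𝟙 _ : GHom _ X Y) (η Y) ≫ inv (transposeLeft R (η X) (L Y))

theorem comp_leftAdjointMap {v : V} {X Y : ForgetEnrichment V C} (f : GHom v X Y) :
    f ≫ leftAdjointMap R L η X Y = gpost f (η Y) ≫ inv (transposeLeft R (η X) (L Y)) := by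
  rw [leftAdjointMap, ← Category.assoc, pull_gpost, Category.comp_id]

/-- The dual of `gcomp_comp_inv_transposeRight`: it gives functoriality of the left adjoint and
naturality in the first variable. -/
theorem gcomp_comp_inv_transposeLeft {u v : V} {X Y : ForgetEnrichment V C}
    {Z : ForgetEnrichment V D} (f : GHom u X Y) (g : GHom v Y (R.forget.obj Z)) :
    gcomp f g ≫ inv (transposeLeft R (η X) Z) =
      gcomp (f ≫ leftAdjointMap R L η X Y) (g ≫ inv (transposeLeft R (η Y) Z)) := by
  rw [← cancel_mono (transposeLeft R (η X) Z), Category.assoc, IsIso.inv_hom_id,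
    Category.comp_id, gcomp_comp_transposeLeft, comp_leftAdjointMap, Category.assoc,
    IsIso.inv_hom_id, Category.comp_id, gpost_gcomp, ← comp_transposeLeft, Category.assoc,
    IsIso.inv_hom_id, Category.comp_id]

/-- The left `V`-adjoint given by universal arrows. -/
noncomputable def leftAdjointOfUniversal : EnrichedFunctor V C D where
  obj X := ForgetEnrichment.to V (L (ForgetEnrichment.of V X))
  map X Y := leftAdjointMap R L η (ForgetEnrichment.of V X) (ForgetEnrichment.of V Y)
  map_id X := by
    refine (comp_leftAdjointMap R L η (gid (ForgetEnrichment.of V X))).trans ?_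
    rw [gid_gpost, IsIso.comp_inv_eq]
    refine Eq.symm ((comp_transposeLeft R (η (ForgetEnrichment.of V X)) (gid _)).trans ?_)
    rw [EnrichedFunctor.gmap_gid, gpre_gid]
  map_comp X Y Z := by
    refine Eq.trans ?_ (gcomp_eq_comp (leftAdjointMap R L η (ForgetEnrichment.of V X)
      (ForgetEnrichment.of V Y)) (leftAdjointMap R L η (ForgetEnrichment.of V Y)
      (ForgetEnrichment.of V Z))).symm
    refine (congrArg (· ≫ leftAdjointMap R L η (ForgetEnrichment.of V X)
      (ForgetEnrichment.of V Z)) (eComp_eq_gcomp (ForgetEnrichment.of V X)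
      (ForgetEnrichment.of V Y) (ForgetEnrichment.of V Z))).trans ?_
    rw [comp_leftAdjointMap, ← gcomp_gpost, gcomp_comp_inv_transposeLeft, Category.id_comp]
    rfl

/-- The `V`-adjunction given by universal arrows. -/
noncomputable def adjunctionOfLeftUniversal :
    EnrichedAdjunction (leftAdjointOfUniversal R L η) R where
  θ X Y := transposeLeftIso R (L (ForgetEnrichment.of V X)) (η (ForgetEnrichment.of V X))
    (ForgetEnrichment.of V Y)
  naturality_left X Y Z := by
    refine (congrArg (· ≫ inv (transposeLeft R (η (ForgetEnrichment.of V X))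
      (ForgetEnrichment.of V Z))) (eComp_eq_gcomp (ForgetEnrichment.of V X)
      (ForgetEnrichment.of V Y) (R.forget.obj (ForgetEnrichment.of V Z)))).trans ?_
    rw [gcomp_comp_inv_transposeLeft, Category.id_comp, Category.id_comp]
    rfl
  naturality_right X Y Z := by
    refine (congrArg (· ≫ transposeLeft R (η (ForgetEnrichment.of V X))
      (ForgetEnrichment.of V Z)) (eComp_eq_gcomp (L (ForgetEnrichment.of V X))
      (ForgetEnrichment.of V Y) (ForgetEnrichment.of V Z))).trans ?_
    rw [gcomp_comp_transposeLeft, Category.id_comp, EnrichedFunctor.gmap, Category.id_comp]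
    rfl

end LeftAdjoint

end Universal

end BraidedEnriched

namespace BraidedEnriched

/-! ### Construction of classifying functors -/

/-- `HalfBraiding.β` is inverse to the half-braidings `X ⊗ F v ⟶ F v ⊗ X` used here. This inverts a
compatibility with the latter into the condition for `ν` to be a morphism of the center. -/
theorem whiskerRight_eq_of_whiskerLeft_eq {T : Type w} [Category.{v} T] [MonoidalCategory T]
    {X A B P : T} (e : X ⊗ P ≅ P ⊗ X) (a : X ⊗ A ≅ A ⊗ X) (b : X ⊗ B ≅ B ⊗ X) (ν : P ⟶ A ⊗ B)
    (h : X ◁ ν ≫ (α_ _ _ _).inv ≫ a.hom ▷ B ≫ (α_ _ _ _).hom ≫ A ◁ b.hom ≫ (α_ _ _ _).inv =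
      e.hom ≫ ν ▷ X) :
    ν ▷ X ≫ (α_ _ _ _).hom ≫ A ◁ b.inv ≫ (α_ _ _ _).inv ≫ a.inv ▷ B ≫ (α_ _ _ _).hom =
      e.inv ≫ X ◁ ν := by
  rw [Iso.eq_inv_comp, ← reassoc_of% h]
  simp

section

open ForgetEnrichment EnrichedTensor

variable {V : Type u} [Category.{v} V] [MonoidalCategory V] [BraidedCategory V]
  {C : Type w} [EnrichedCategory V C] [EnrichedMonoidalCategory V C]

/-- The morphism `j_X ⊗ f : X ⟶ X ⊗ Y` for `f : 𝟙_ ⟶ Y`. -/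
def gidl {v : V} (X : ForgetEnrichment V C) {Y : ForgetEnrichment V C} (f : GHom v (𝟙_ _) Y) :
    GHom v X (X ⊗ Y) :=
  gpre (ρ_ X).inv (gwl X f)

/-- The morphism `f ⊗ j_X : X ⟶ Y ⊗ X` for `f : 𝟙_ ⟶ Y`. -/
def gidr {v : V} {Y : ForgetEnrichment V C} (f : GHom v (𝟙_ _) Y) (X : ForgetEnrichment V C) :
    GHom v X (Y ⊗ X) :=
  gpre (λ_ X).inv (gwr f X)

theorem idTensor_eq {v : V} (X : ForgetEnrichment V C) {Y : ForgetEnrichment V C}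
    (f : GHom v (𝟙_ (ForgetEnrichment V C)) Y) :
    idTensor (ForgetEnrichment.to V X) f = gidl X f := by
  rw [gidl, gwl_eq, gpre]
  simp only [gtensor, Category.assoc]
  rfl

theorem tensorId_eq {v : V} (X : ForgetEnrichment V C) {Y : ForgetEnrichment V C}
    (f : GHom v (𝟙_ (ForgetEnrichment V C)) Y) :
    tensorId f (ForgetEnrichment.to V X) = gidr f X := by
  rw [gidr, gwr_eq, gpre]
  simp only [gtensor, Category.assoc]
  rfl

section

variable {u v v' : V} {X Y Z W : ForgetEnrichment V C}

theorem gidl_naturality (t : Z ⟶ W) (f : GHom v (𝟙_ _) Y) :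
    gpre t (gidl W f) = gpost (gidl Z f) (t ▷ Y) := by
  rw [gidl, gidl, gpre_gpost, gwl_naturality, gpre_gpre, gpre_gpre, rightUnitor_inv_naturality]

theorem gidr_naturality (t : Z ⟶ W) (f : GHom v (𝟙_ _) Y) :
    gpre t (gidr f W) = gpost (gidr f Z) (Y ◁ t) := by
  rw [gidr, gidr, gpre_gpost, gwr_naturality, gpre_gpre, gpre_gpre, leftUnitor_inv_naturality]

theorem gidl_gpost (f : GHom v (𝟙_ _) Y) (t : Y ⟶ W) :
    gidl X (gpost f t) = gpost (gidl X f) (X ◁ t) := by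
  rw [gidl, gidl, gwl_gpost, gpre_gpost]

theorem gidr_gpost (f : GHom v (𝟙_ _) Y) (t : Y ⟶ W) :
    gidr (gpost f t) X = gpost (gidr f X) (t ▷ X) := by
  rw [gidr, gidr, gwr_gpost, gpre_gpost]

theorem pull_gidl (p : v' ⟶ v) (f : GHom v (𝟙_ _) Y) : gidl X (p ≫ f) = p ≫ gidl X f := by
  rw [gidl, gidl, pull_gwl, pull_gpre]

theorem pull_gidr (p : v' ⟶ v) (f : GHom v (𝟙_ _) Y) : gidr (p ≫ f) X = p ≫ gidr f X := by
  rw [gidr, gidr, pull_gwr, pull_gpre]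

theorem gidl_gcomp (f : GHom u (𝟙_ _) Y) (g : GHom v Y W) :
    gidl X (gcomp f g) = gcomp (gidl X f) (gwl X g) := by
  rw [gidl, gidl, gwl_gcomp, gpre_gcomp]

theorem gidr_gcomp (f : GHom u (𝟙_ _) Y) (g : GHom v Y W) :
    gidr (gcomp f g) X = gcomp (gidr f X) (gwr g X) := by
  rw [gidr, gidr, gwr_gcomp, gpre_gcomp]

theorem gwl_gidl (f : GHom v (𝟙_ _) Y) :
    gwl Z (gidl X f) = gpost (gidl (Z ⊗ X) f) (α_ Z X Y).hom := by
  rw [gidl, gidl, gwl_gpre, gpre_gpost, gwl_tensor, gpre_gpre]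
  congr 1
  monoidal

/-- Both sides are `j_Z ⊗ f ⊗ j_X`. Together with `gwl_gidl` and `gwr_gidr` it lets a half-braiding
cross a tensor product one factor at a time. -/
theorem gwl_gidr (f : GHom v (𝟙_ _) Y) :
    gwl Z (gidr f X) = gpost (gwr (gidl Z f) X) (α_ Z Y X).hom := by
  rw [gidl, gidr, gwl_gpre, gwr_gpre, gpre_gpost, gwl_gwr, gpre_gpre]
  congr 1
  monoidal

theorem gwr_gidr (f : GHom v (𝟙_ _) Y) :
    gpost (gwr (gidr f X) Z) (α_ Y X Z).hom = gidr f (X ⊗ Z) := by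
  rw [gidr, gidr, gwr_gpre, gpre_gpost, gwr_tensor, gpre_gpre]
  congr 1
  monoidal

theorem gidl_tensorUnit (f : GHom v (𝟙_ _) Y) : gidl (𝟙_ _) f = gpost f (λ_ Y).inv := by
  apply gpost_iso_cancel (λ_ Y)
  rw [gidl, gpre_gpost, gwl_unit, gpre_gpre, gpost_gpost, Iso.inv_hom_id, gpost_id]
  refine Eq.trans ?_ (gpre_id f)
  congr 1
  monoidal

theorem gidr_tensorUnit (f : GHom v (𝟙_ _) Y) : gidr f (𝟙_ _) = gpost f (ρ_ Y).inv := by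
  apply gpost_iso_cancel (ρ_ Y)
  rw [gidr, gpre_gpost, gwr_unit, gpre_gpre, gpost_gpost, Iso.inv_hom_id, gpost_id]
  refine Eq.trans ?_ (gpre_id f)
  congr 1
  monoidal

/-- Split the tensor product into whiskerings; over the unit object, `f ⊗ j` is `f` up to a unitor.
The oplaxitor thereby becomes a composite of graded morphisms, and its axioms follow from
associativity of `gcomp`. -/
theorem tensorUnitElt_eq (f : GHom u (𝟙_ (ForgetEnrichment V C)) Y)
    (g : GHom v (𝟙_ (ForgetEnrichment V C)) Z) :
    tensorUnitElt f g = gcomp f (gidl Y g) := by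
  have h : tensorUnitElt f g = gpre (λ_ (𝟙_ _)).inv (gtensor f g) := (Category.assoc _ _ _).symm
  rw [h, gtensor_eq_gcomp, ← gpre_gcomp]
  have h' := gidr_tensorUnit f
  rw [gidr] at h'
  rw [h', gpost_gcomp, gidl]

theorem gidl_gid : gidl X (gid (𝟙_ _)) = homTo V (ρ_ X).inv := by
  rw [gidl, gwl_gid, gpre_gid]

theorem gidr_gid : gidr (gid (𝟙_ _)) X = homTo V (λ_ X).inv := by
  rw [gidr, gwr_gid, gpre_gid]

end

/-- The unit of an adjunction with `C(1 → -)`, as a graded morphism. -/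
def gunit {F : V ⥤ ForgetEnrichment V C} (adj : F ⊣ unitRepresentable V C) (v : V) :
    GHom v (𝟙_ (ForgetEnrichment V C)) (F.obj v) :=
  adj.unit.app v

section

variable {F : V ⥤ ForgetEnrichment V C} (adj : F ⊣ unitRepresentable V C)

theorem homEquiv_eq_gpost {v : V} {X : ForgetEnrichment V C} (t : F.obj v ⟶ X) :
    adj.homEquiv v X t = gpost (gunit adj v) t := by
  rw [Adjunction.homEquiv_unit]
  rfl

/-- Universality of the unit is the adjunction itself, read through `homEquiv_eq_gpost`. -/
theorem isUniv_gunit (v : V) : IsUniv (gunit adj v) := by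
  intro Z
  have : (fun t => gpost (gunit adj v) t) = adj.homEquiv v Z := by
    funext t
    exact (homEquiv_eq_gpost adj t).symm
  rw [this]
  exact (adj.homEquiv v Z).bijective

theorem gunit_naturality {v v' : V} (p : v ⟶ v') :
    p ≫ gunit adj v' = gpost (gunit adj v) (F.map p) :=
  adj.unit.naturality p

theorem idTensor_unitElt (v : V) (X : ForgetEnrichment V C) :
    idTensor (ForgetEnrichment.to V X) (unitElt adj v) = gidl X (gunit adj v) :=
  idTensor_eq X (gunit adj v)

theorem tensorId_unitElt (v : V) (X : ForgetEnrichment V C) :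
    tensorId (unitElt adj v) (ForgetEnrichment.to V X) = gidr (gunit adj v) X :=
  tensorId_eq X (gunit adj v)

/-- Closedness enters here: `X ⊗ -` is a left `V`-adjoint and so preserves universal graded
morphisms, and a unitor then replaces `X ⊗ 𝟙_` by `X`. -/
theorem isUniv_gidl (h : IsClosedEnriched V C) (X : ForgetEnrichment V C) {v : V}
    {Y : ForgetEnrichment V C} {f : GHom v (𝟙_ _) Y} (hf : IsUniv f) : IsUniv (gidl X f) := by
  obtain ⟨R, ⟨θ⟩⟩ := h (ForgetEnrichment.to V X)
  have : IsUniv (gwl X f) := hf.gmap θ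
  exact this.gpre_iso (ρ_ X).symm

theorem isUniv_gidr (h : IsBiclosedEnriched V C) (X : ForgetEnrichment V C) {v : V}
    {Y : ForgetEnrichment V C} {f : GHom v (𝟙_ _) Y} (hf : IsUniv f) : IsUniv (gidr f X) := by
  obtain ⟨R, ⟨θ⟩⟩ := h.2 (ForgetEnrichment.to V X)
  have : IsUniv (gwr f X) := hf.gmap θ
  exact this.gpre_iso (λ_ X).symm

theorem hasInvertibleHalfBraidings_iff : HasInvertibleHalfBraidings V C ↔
    ∀ (F : V ⥤ ForgetEnrichment V C) (adj : F ⊣ unitRepresentable V C)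
      (X : ForgetEnrichment V C) (v : V), ∃ e : X ⊗ F.obj v ≅ F.obj v ⊗ X,
        gpost (gidl X (gunit adj v)) e.hom = gidr (gunit adj v) X := by
  refine forall_congr' fun F => forall_congr' fun adj => forall_congr' fun X =>
    forall_congr' fun v => exists_congr fun e => ?_
  exact iff_of_eq (congrArg₂ (fun a b => a ≫ ePost X (homTo V e.hom) = b)
    (idTensor_unitElt adj v (ForgetEnrichment.of V X))
    (tensorId_unitElt adj v (ForgetEnrichment.of V X)))

/-- Both `j_X ⊗ η_v` and `η_v ⊗ j_X` are universal of the same degree and source, hence they differ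
by a unique isomorphism. -/
theorem IsBiclosedEnriched.hasInvertibleHalfBraidings (h : IsBiclosedEnriched V C) :
    HasInvertibleHalfBraidings V C := by
  rw [hasInvertibleHalfBraidings_iff]
  intro F adj X v
  exact (isUniv_gidl h.1 X (isUniv_gunit adj v)).exists_iso
    (isUniv_gidr h X (isUniv_gunit adj v))

/-! ### Structure and axioms of the classifying functor, checked on universal elements. -/

section Classifying

variable (hu : ∀ (X : ForgetEnrichment V C) (v : V), IsUniv (gidl X (gunit adj v)))
  (e : ∀ (X : ForgetEnrichment V C) (v : V), X ⊗ F.obj v ≅ F.obj v ⊗ X)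
  (he : ∀ X v, gpost (gidl X (gunit adj v)) (e X v).hom = gidr (gunit adj v) X)

include hu he

theorem canonical_naturality {X Y : ForgetEnrichment V C} (t : X ⟶ Y) (v : V) :
    t ▷ F.obj v ≫ (e Y v).hom = (e X v).hom ≫ F.obj v ◁ t := by
  apply (hu X v).hom_ext
  rw [← gpost_gpost, ← gidl_naturality, gpre_gpost, he, ← gpost_gpost, he, gidr_naturality]

/-- Compare on the universal element: `η_v` passes `Y`, then `X`, taking `j_X ⊗ j_Y ⊗ η_v` to `j_X ⊗
η_v ⊗ j_Y` and then to `η_v ⊗ j_X ⊗ j_Y`. -/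
theorem canonical_tensor (X Y : ForgetEnrichment V C) (v : V) :
    (e (X ⊗ Y) v).hom = (α_ _ _ _).hom ≫ X ◁ (e Y v).hom ≫ (α_ _ _ _).inv ≫
      (e X v).hom ▷ Y ≫ (α_ _ _ _).hom := by
  apply (hu (X ⊗ Y) v).hom_ext
  rw [he, ← gpost_gpost, ← gwl_gidl, ← gpost_gpost, ← gwl_gpost, he, ← gpost_gpost, gwl_gidr,
    gpost_gpost _ (α_ X (F.obj v) Y).hom, Iso.hom_inv_id, gpost_id, ← gpost_gpost, ← gwr_gpost,
    he, gwr_gidr]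

theorem canonical_map (X : ForgetEnrichment V C) {u v : V} (p : u ⟶ v) :
    X ◁ F.map p ≫ (e X v).hom = (e X u).hom ≫ F.map p ▷ X := by
  apply (hu X u).hom_ext
  rw [← gpost_gpost, ← gidl_gpost, ← gpost_gpost, he, ← gidr_gpost, ← gunit_naturality,
    pull_gidl, ← pull_gpost, he, pull_gidr]

/-- The half-braiding of the classifying functor. -/
def classifyingHalfBraiding (v : V) : HalfBraiding (F.obj v) where
  β X := (e X v).symm
  monoidal X Y := by
    rw [← cancel_epi (e (X ⊗ Y) v).hom]
    simp only [Iso.symm_hom, Iso.hom_inv_id]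
    rw [canonical_tensor adj hu e he]
    simp
  naturality t := by
    simp only [Iso.symm_hom]
    rw [Iso.comp_inv_eq, Category.assoc, Iso.eq_inv_comp]
    exact (canonical_naturality adj hu e he t v).symm

/-- The underlying functor of the classifying functor. -/
def classifyingFunctor : V ⥤ Center (ForgetEnrichment V C) where
  obj v := ⟨F.obj v, classifyingHalfBraiding adj hu e he v⟩
  map p := ⟨F.map p, fun X => by
    change F.map p ▷ X ≫ (e X _).inv = (e X _).inv ≫ X ◁ F.map p
    rw [Iso.comp_inv_eq, Category.assoc, Iso.eq_inv_comp]
    exact (canonical_map adj hu e he X p).symm⟩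
  map_id v := by
    ext
    exact F.map_id v
  map_comp p q := by
    ext
    exact F.map_comp p q

omit hu he in
/-- The canonical oplaxitor. -/
noncomputable def classifyingδ (u v : V) : F.obj (u ⊗ v) ⟶ F.obj u ⊗ F.obj v :=
  ((isUniv_gunit adj (u ⊗ v)).existsUnique
    (gcomp (gunit adj u) (gidl (F.obj u) (gunit adj v)))).choose

omit hu he in
theorem gunit_classifyingδ (u v : V) : gpost (gunit adj (u ⊗ v)) (classifyingδ adj u v) =
    gcomp (gunit adj u) (gidl (F.obj u) (gunit adj v)) :=
  ((isUniv_gunit adj (u ⊗ v)).existsUnique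
    (gcomp (gunit adj u) (gidl (F.obj u) (gunit adj v)))).choose_spec.1

omit hu he in
/-- The canonical counit. -/
noncomputable def classifyingη : F.obj (𝟙_ V) ⟶ 𝟙_ (ForgetEnrichment V C) :=
  ((isUniv_gunit adj (𝟙_ V)).existsUnique (gid _)).choose

omit hu he in
theorem gunit_classifyingη : gpost (gunit adj (𝟙_ V)) (classifyingη adj) = gid _ :=
  ((isUniv_gunit adj (𝟙_ V)).existsUnique (gid (𝟙_ (ForgetEnrichment V C)))).choose_spec.1

-- Strong unitality: the identity of the unit object is itself universal of degree `𝟙_ V`, since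
-- graded morphisms of that degree are the morphisms of the underlying category.
omit hu he in
theorem isIso_classifyingη : IsIso (classifyingη adj) := by
  have h : IsUniv (gid (𝟙_ (ForgetEnrichment V C))) := by
    intro Z
    have : (fun t : 𝟙_ (ForgetEnrichment V C) ⟶ Z => gpost (gid _) t) = homTo V := by
      funext t
      exact gid_gpost t
    rw [this]
    exact ⟨fun a b hab => hab, fun b => ⟨homOf V b, rfl⟩⟩
  obtain ⟨i, hi⟩ := (isUniv_gunit adj (𝟙_ V)).exists_iso h
  have : classifyingη adj = i.hom :=
    (isUniv_gunit adj (𝟙_ V)).hom_ext ((gunit_classifyingη adj).trans hi.symm)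
  rw [this]
  infer_instance

omit hu he in
theorem classifyingδ_naturality {u u' v v' : V} (p : u ⟶ u') (q : v ⟶ v') :
    classifyingδ adj u v ≫ (F.map p ⊗ₘ F.map q) =
      F.map (p ⊗ₘ q) ≫ classifyingδ adj u' v' := by
  apply (isUniv_gunit adj _).hom_ext
  rw [← gpost_gpost, gunit_classifyingδ, ← gpost_gpost, ← gunit_naturality, ← pull_gpost,
    gunit_classifyingδ, ← gcomp_pull, ← pull_gidl, gunit_naturality, gunit_naturality,
    gpost_gcomp, gidl_naturality, gidl_gpost, gpost_gpost, gcomp_gpost,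
    MonoidalCategory.tensorHom_def']

-- Both sides send `η_{(uv)w}` to the triple composite of `η_u`, `j ⊗ η_v` and `j ⊗ η_w`, so this is
-- associativity of graded composition.
omit hu he in
theorem classifyingδ_assoc (u v w : V) :
    classifyingδ adj (u ⊗ v) w ≫ classifyingδ adj u v ▷ F.obj w ≫ (α_ _ _ _).hom =
      F.map (α_ u v w).hom ≫ classifyingδ adj u (v ⊗ w) ≫ F.obj u ◁ classifyingδ adj v w := by
  apply (isUniv_gunit adj _).hom_ext
  rw [← gpost_gpost, gunit_classifyingδ, ← gpost_gpost, ← gpost_gpost, ← gunit_naturality,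
    ← pull_gpost, ← gpost_gpost, gunit_classifyingδ, ← gcomp_gpost, ← gcomp_gpost,
    ← gcomp_gpost, ← gidl_naturality, ← gidl_gpost, gunit_classifyingδ, gpre_gpost,
    ← gpost_gcomp, gunit_classifyingδ, gcomp_assoc, gidl_gcomp, gwl_gidl, gcomp_gpost]

omit hu he in
theorem classifyingδ_left_unit (v : V) :
    (λ_ (F.obj v)).inv =
      F.map (λ_ v).inv ≫ classifyingδ adj (𝟙_ V) v ≫ classifyingη adj ▷ F.obj v := by
  apply (isUniv_gunit adj _).hom_ext
  rw [← gpost_gpost, ← gunit_naturality, ← pull_gpost, ← gpost_gpost, gunit_classifyingδ,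
    ← gcomp_gpost, ← gidl_naturality, ← gpost_gcomp, gunit_classifyingη, gid_gcomp,
    Iso.inv_hom_id_assoc, gidl_tensorUnit]

omit hu he in
theorem classifyingδ_right_unit (v : V) :
    (ρ_ (F.obj v)).inv =
      F.map (ρ_ v).inv ≫ classifyingδ adj v (𝟙_ V) ≫ F.obj v ◁ classifyingη adj := by
  apply (isUniv_gunit adj _).hom_ext
  rw [← gpost_gpost, ← gunit_naturality, ← pull_gpost, ← gpost_gpost, gunit_classifyingδ,
    ← gcomp_gpost, ← gidl_gpost, gunit_classifyingη, gidl_gid, gcomp_homTo,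
    Iso.inv_hom_id_assoc]

/-- Both sides send `j_X ⊗ η_{uv}` to the composite of `η_u ⊗ j_X` with `(j ⊗ η_v) ⊗ j_X`. The right
side is evaluated in `h`; on the left the half-braidings move `X` past one factor at a time. -/
theorem classifyingδ_canonical (X : ForgetEnrichment V C) (u v : V) :
    X ◁ classifyingδ adj u v ≫ (α_ _ _ _).inv ≫ (e X u).hom ▷ F.obj v ≫ (α_ _ _ _).hom ≫
        F.obj u ◁ (e X v).hom ≫ (α_ _ _ _).inv =
      (e X (u ⊗ v)).hom ≫ classifyingδ adj u v ▷ X := by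
  have h : gpost (gidl X (gunit adj (u ⊗ v))) ((e X (u ⊗ v)).hom ≫ classifyingδ adj u v ▷ X) =
      gcomp (gidr (gunit adj u) X) (gwr (gidl (F.obj u) (gunit adj v)) X) := by
    rw [← gpost_gpost, he, ← gidr_gpost, gunit_classifyingδ, gidr_gcomp]
  apply (hu X _).hom_ext
  rw [h, ← gpost_gpost, ← gidl_gpost, gunit_classifyingδ, gidl_gcomp, gwl_gidl, ← gcomp_gpost,
    gpost_gpost, Iso.hom_inv_id_assoc, ← gpost_gpost, ← gidl_naturality, gpre_gpost,
    ← gpost_gcomp, he, ← gpost_gpost, ← gwl_gidl, ← gpost_gpost, ← gwl_gpost, he, gwl_gidr,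
    gpost_gpost, Iso.hom_inv_id, gpost_id]

theorem classifyingη_canonical (X : ForgetEnrichment V C) :
    X ◁ classifyingη adj ≫ (ρ_ X).hom ≫ (λ_ X).inv =
      (e X (𝟙_ V)).hom ≫ classifyingη adj ▷ X := by
  apply (hu X _).hom_ext
  rw [← gpost_gpost, ← gidl_gpost, ← gpost_gpost _ (e X (𝟙_ V)).hom, he, ← gidr_gpost,
    gunit_classifyingη, gidl_gid, gidr_gid, homTo_gpost, Iso.inv_hom_id_assoc]

-- On `η_{uv}` the left side is `η_u` followed by `η_v ⊗ j`. Regarding `η_u` as `j_1 ⊗ η_u` makes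
-- this the exchange law `gwl_gcomp_gwr` for `η_u` and `η_v`.
omit hu in
theorem classifyingδ_braided (u v : V) :
    classifyingδ adj u v ≫ (e (F.obj u) v).hom = F.map (β_ u v).hom ≫ classifyingδ adj v u := by
  apply (isUniv_gunit adj _).hom_ext
  rw [← gpost_gpost, gunit_classifyingδ, ← gcomp_gpost, he, ← gpost_gpost, ← gunit_naturality,
    ← pull_gpost, gunit_classifyingδ, gidr, ← gpost_gcomp, ← gidl_tensorUnit, gidl,
    gpre_gcomp, gwl_gcomp_gwr, ← pull_gpre, ← gpre_gcomp, ← unitors_inv_equal]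
  have h' := gidr_tensorUnit (gunit adj v)
  rw [gidr] at h'
  rw [h', gpost_gcomp, gidl]

/-- The oplax monoidal structure of the classifying functor. -/
noncomputable abbrev classifyingOplaxMonoidal :
    (classifyingFunctor adj hu e he).OplaxMonoidal where
  η := ⟨classifyingη adj, fun X => by
    change classifyingη adj ▷ X ≫ (λ_ X).hom ≫ (ρ_ X).inv = (e X _).inv ≫ X ◁ classifyingη adj
    rw [Iso.eq_inv_comp, ← reassoc_of% (classifyingη_canonical adj hu e he X)]
    simp⟩
  δ u v := ⟨classifyingδ adj u v, fun X => by
    exact whiskerRight_eq_of_whiskerLeft_eq _ _ _ _ (classifyingδ_canonical adj hu e he X u v)⟩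
  δ_natural_left p v := by
    ext
    change classifyingδ adj _ _ ≫ F.map p ▷ F.obj v = F.map (p ▷ v) ≫ classifyingδ adj _ _
    have := classifyingδ_naturality adj p (𝟙 v)
    rwa [F.map_id, MonoidalCategory.tensorHom_id, MonoidalCategory.tensorHom_id] at this
  δ_natural_right u p := by
    ext
    change classifyingδ adj _ _ ≫ F.obj u ◁ F.map p = F.map (u ◁ p) ≫ classifyingδ adj _ _
    have := classifyingδ_naturality adj (𝟙 u) p
    rwa [F.map_id, MonoidalCategory.id_tensorHom, MonoidalCategory.id_tensorHom] at this
  oplax_associativity u v w := by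
    ext
    exact classifyingδ_assoc adj u v w
  oplax_left_unitality v := by
    ext
    rw [Center.leftUnitor_inv_f]
    exact classifyingδ_left_unit adj v
  oplax_right_unitality v := by
    ext
    rw [Center.rightUnitor_inv_f]
    exact classifyingδ_right_unit adj v

/-- The classifying functor of a `V`-monoidal category with universal elements and invertible
canonical half-braidings. -/
noncomputable def classifying : BraidedOplaxFunctor V (ForgetEnrichment V C) :=
  letI := classifyingOplaxMonoidal adj hu e he
  { functor := classifyingFunctor adj hu e he
    isIso_counit := by
      have : IsIso (Functor.OplaxMonoidal.η (classifyingFunctor adj hu e he)).f :=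
        isIso_classifyingη adj
      infer_instance
    braided := fun u v => by
      rw [Iso.comp_inv_eq]
      ext
      change classifyingδ adj u v = (F.map (β_ u v).hom ≫ classifyingδ adj v u) ≫
        (e (F.obj u) v).inv
      rw [Iso.eq_comp_inv]
      exact classifyingδ_braided adj e he u v }

end Classifying

end

end

/-! ### Existence of classifying functors. -/

namespace EnrMonCat

open ForgetEnrichment

variable {V : Type u} [Category.{v} V] [MonoidalCategory V] [BraidedCategory V]
  (C : EnrMonCat.{v, u, w} V)

theorem isClassifying_classifying {F : V ⥤ C.underlying}
    (adj : F ⊣ unitRepresentable V C.carrier)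
    (hu : ∀ (X : ForgetEnrichment V C.carrier) (v : V), IsUniv (gidl X (gunit adj v)))
    (e : ∀ (X : ForgetEnrichment V C.carrier) (v : V), X ⊗ F.obj v ≅ F.obj v ⊗ X)
    (he : ∀ X v, gpost (gidl X (gunit adj v)) (e X v).hom = gidr (gunit adj v) X) :
    C.IsClassifying (classifying adj hu e he) := by
  refine ⟨adj, ?_, fun u v => ?_, fun a v => ?_⟩
  · exact (homEquiv_eq_gpost adj _).trans (gunit_classifyingη adj)
  · refine (homEquiv_eq_gpost adj _).trans ((gunit_classifyingδ adj u v).trans ?_)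
    exact (tensorUnitElt_eq (gunit adj u) (gunit adj v)).symm
  · exact (congrArg (· ≫ ePost a (homTo V (e (ForgetEnrichment.of V a) v).hom))
      (idTensor_unitElt adj v (ForgetEnrichment.of V a))).trans
      ((he (ForgetEnrichment.of V a) v).trans
        (tensorId_unitElt adj v (ForgetEnrichment.of V a)).symm)

theorem exists_isClassifying (h : IsClosedEnriched V C.carrier)
    (h' : HasInvertibleHalfBraidings V C.carrier) (h'' : C.HasLeftAdjoint) :
    ∃ Φ, C.IsClassifying Φ := by
  obtain ⟨F, ⟨adj⟩⟩ := h''.exists_leftAdjoint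
  rw [hasInvertibleHalfBraidings_iff] at h'
  choose e he using h' F adj
  exact ⟨_, C.isClassifying_classifying adj
    (fun X v => isUniv_gidl h X (isUniv_gunit adj v)) e he⟩

end EnrMonCat

end BraidedEnriched

/-! ### The axioms of a pair, as equations in `T`. -/

namespace BraidedEnriched

/-- Naturality along `λ_ (𝟙_ T)` and the tensor rule at `𝟙_ ⊗ 𝟙_` say that `e` equals `e` composed
with itself up to unitors. As `e` is invertible it can be cancelled, so a half-braiding with the
unit object is forced. -/
theorem iso_hom_eq_of_unit_square {T : Type w} [Category.{v} T] [MonoidalCategory T] {A : T}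
    (e : 𝟙_ T ⊗ A ≅ A ⊗ 𝟙_ T) (h : (λ_ (𝟙_ T)).hom ▷ A ≫ e.hom = ((α_ _ _ _).hom ≫
      𝟙_ T ◁ e.hom ≫ (α_ _ _ _).inv ≫ e.hom ▷ 𝟙_ T ≫ (α_ _ _ _).hom) ≫ A ◁ (λ_ (𝟙_ T)).hom) :
    e.hom = (λ_ A).hom ≫ (ρ_ A).inv := by
  have h₂ : 𝟙_ T ◁ e.hom = (λ_ _).hom ≫ e.hom ≫ (λ_ _).inv := by simp
  have h₃ : e.hom ▷ 𝟙_ T = (ρ_ _).hom ≫ e.hom ≫ (ρ_ _).inv := by simp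
  have h₅ : (α_ _ _ _).hom ≫ (λ_ (𝟙_ T ⊗ A)).hom = (λ_ (𝟙_ T)).hom ▷ A := by monoidal
  have h₆ : (λ_ (A ⊗ 𝟙_ T)).inv ≫ (α_ (𝟙_ T) A (𝟙_ T)).inv ≫ (ρ_ _).hom =
      (ρ_ A).hom ≫ (λ_ A).inv := by monoidal
  have h₇ : (ρ_ (A ⊗ 𝟙_ T)).inv ≫ (α_ _ _ _).hom ≫ A ◁ (λ_ (𝟙_ T)).hom = 𝟙 _ := by monoidal
  rw [h₂, h₃] at h
  simp only [Category.assoc] at h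
  rw [reassoc_of% h₅, reassoc_of% h₆, h₇, Category.comp_id, cancel_epi] at h
  have h₉ : 𝟙 _ = (ρ_ A).hom ≫ (λ_ A).inv ≫ e.hom := by
    rwa [← cancel_epi e.hom, Category.comp_id]
  rw [← cancel_epi (λ_ A).inv, ← cancel_epi (ρ_ A).hom, ← h₉]
  simp

namespace BraidedOplaxFunctor

variable {V : Type u} [Category.{v} V] [MonoidalCategory V] [BraidedCategory V]
  {T : Type w} [Category.{v} T] [MonoidalCategory T] (Φ : BraidedOplaxFunctor V T)

/-- The underlying functor to `T`. -/
def F : V ⥤ T := Φ.toT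

/-- The counit, as a morphism of `T`. -/
def cou : Φ.F.obj (𝟙_ V) ⟶ 𝟙_ T := Φ.counit

/-- The oplaxitor, as a morphism of `T`. -/
def ν (x y : V) : Φ.F.obj (x ⊗ y) ⟶ Φ.F.obj x ⊗ Φ.F.obj y := Φ.oplaxitor x y

/-- The half-braiding with an object of `T`. -/
def hb (a : T) (v : V) : a ⊗ Φ.F.obj v ≅ Φ.F.obj v ⊗ a := Φ.halfBraiding a v

theorem ν_natural_left {u u' : V} (p : u ⟶ u') (v : V) :
    Φ.ν u v ≫ Φ.F.map p ▷ Φ.F.obj v = Φ.F.map (p ▷ v) ≫ Φ.ν u' v :=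
  congrArg Center.Hom.f (Functor.OplaxMonoidal.δ_natural_left Φ.functor p v)

theorem ν_natural_right (u : V) {v v' : V} (p : v ⟶ v') :
    Φ.ν u v ≫ Φ.F.obj u ◁ Φ.F.map p = Φ.F.map (u ◁ p) ≫ Φ.ν u v' :=
  congrArg Center.Hom.f (Functor.OplaxMonoidal.δ_natural_right Φ.functor u p)

theorem ν_assoc (u v w : V) :
    Φ.ν (u ⊗ v) w ≫ Φ.ν u v ▷ Φ.F.obj w ≫ (α_ _ _ _).hom =
      Φ.F.map (α_ u v w).hom ≫ Φ.ν u (v ⊗ w) ≫ Φ.F.obj u ◁ Φ.ν v w :=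
  congrArg Center.Hom.f (Functor.OplaxMonoidal.associativity Φ.functor u v w)

theorem ν_cou_left (v : V) :
    Φ.F.map (λ_ v).inv ≫ Φ.ν (𝟙_ V) v ≫ Φ.cou ▷ Φ.F.obj v =
      (λ_ (Φ.F.obj v)).inv := by
  have h := congrArg Center.Hom.f (Functor.OplaxMonoidal.left_unitality Φ.functor v)
  rw [Center.leftUnitor_inv_f] at h
  exact h.symm

theorem ν_cou_right (v : V) :
    Φ.F.map (ρ_ v).inv ≫ Φ.ν v (𝟙_ V) ≫ Φ.F.obj v ◁ Φ.cou =
      (ρ_ (Φ.F.obj v)).inv := by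
  have h := congrArg Center.Hom.f (Functor.OplaxMonoidal.right_unitality Φ.functor v)
  rw [Center.rightUnitor_inv_f] at h
  exact h.symm

theorem isIso_cou : IsIso Φ.cou := by
  have := Φ.isIso_counit
  exact Functor.map_isIso (Center.forget T) (Functor.OplaxMonoidal.η Φ.functor)

theorem hb_natural {a b : T} (t : a ⟶ b) (v : V) :
    t ▷ Φ.F.obj v ≫ (Φ.hb b v).hom = (Φ.hb a v).hom ≫ Φ.F.obj v ◁ t := by
  have h : Φ.F.obj v ◁ t ≫ (Φ.hb b v).inv =
    (Φ.hb a v).inv ≫ t ▷ Φ.F.obj v := (Φ.functor.obj v).2.naturality t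
  rw [← Iso.eq_comp_inv, Category.assoc, h, Iso.hom_inv_id_assoc]

theorem hb_map (a : T) {u v : V} (p : u ⟶ v) :
    a ◁ Φ.F.map p ≫ (Φ.hb a v).hom = (Φ.hb a u).hom ≫ Φ.F.map p ▷ a := by
  have h : Φ.F.map p ▷ a ≫ (Φ.hb a v).inv =
    (Φ.hb a u).inv ≫ a ◁ Φ.F.map p := (Φ.functor.map p).comm a
  rw [← Iso.eq_comp_inv, Category.assoc, h, Iso.hom_inv_id_assoc]

theorem hb_tensor (a b : T) (v : V) :
    (Φ.hb (a ⊗ b) v).hom = (α_ _ _ _).hom ≫ a ◁ (Φ.hb b v).hom ≫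
      (α_ _ _ _).inv ≫ (Φ.hb a v).hom ▷ b ≫ (α_ _ _ _).hom := by
  have h : (Φ.hb (a ⊗ b) v).inv = (α_ _ _ _).inv ≫ (Φ.hb a v).inv ▷ b ≫
      (α_ _ _ _).hom ≫ a ◁ (Φ.hb b v).inv ≫ (α_ _ _ _).inv :=
    (Φ.functor.obj v).2.monoidal a b
  rw [← cancel_mono (Φ.hb (a ⊗ b) v).inv, Iso.hom_inv_id, h]
  simp

theorem hb_ν (a : T) (u v : V) :
    a ◁ Φ.ν u v ≫ (α_ _ _ _).inv ≫ (Φ.hb a u).hom ▷ Φ.F.obj v ≫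
        (α_ _ _ _).hom ≫ Φ.F.obj u ◁ (Φ.hb a v).hom ≫ (α_ _ _ _).inv =
      (Φ.hb a (u ⊗ v)).hom ≫ Φ.ν u v ▷ a := by
  have h : Φ.ν u v ▷ a ≫ (α_ _ _ _).hom ≫ Φ.F.obj u ◁ (Φ.hb a v).inv ≫
      (α_ _ _ _).inv ≫ (Φ.hb a u).inv ▷ Φ.F.obj v ≫ (α_ _ _ _).hom =
      (Φ.hb a (u ⊗ v)).inv ≫ a ◁ Φ.ν u v :=
    (Functor.OplaxMonoidal.δ Φ.functor u v).comm a
  rw [Iso.eq_inv_comp] at h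
  rw [← reassoc_of% h]
  simp

theorem hb_cou (a : T) :
    a ◁ Φ.cou ≫ (ρ_ a).hom = (Φ.hb a (𝟙_ V)).hom ≫ Φ.cou ▷ a ≫ (λ_ a).hom := by
  have h : Φ.cou ▷ a ≫ (λ_ a).hom ≫ (ρ_ a).inv =
      (Φ.hb a (𝟙_ V)).inv ≫ a ◁ Φ.cou :=
    (Functor.OplaxMonoidal.η Φ.functor).comm a
  rw [Iso.eq_inv_comp] at h
  rw [← h]
  simp

theorem hb_braided (u v : V) :
    Φ.ν u v ≫ (Φ.hb (Φ.F.obj u) v).hom =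
      Φ.F.map (β_ u v).hom ≫ Φ.ν v u := by
  have h := congrArg Center.Hom.f (Φ.braided u v)
  have e : (Φ.hb (Φ.F.obj u) v).symm =
    (Center.forget T).mapIso (β_ (Φ.functor.obj v) (Φ.functor.obj u)) := Iso.ext rfl
  exact (congrArg (Φ.ν u v ≫ ·) (congrArg Iso.inv e)).trans h

theorem hb_tensorUnit (v : V) :
    (Φ.hb (𝟙_ T) v).hom = (λ_ _).hom ≫ (ρ_ _).inv := by
  have h := Φ.hb_natural (λ_ (𝟙_ T)).hom v
  rw [Φ.hb_tensor] at h
  exact iso_hom_eq_of_unit_square _ h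

end BraidedOplaxFunctor

/-! ### Graded morphisms of a `V`-monoidal category with a classifying functor -/

section

open ForgetEnrichment

variable {V : Type u} [Category.{v} V] [MonoidalCategory V] [BraidedCategory V]
  {C : Type w} [EnrichedCategory V C] [EnrichedMonoidalCategory V C]

/-- The defining properties of a classifying functor, in terms of graded morphisms. -/
structure Classifies (Φ : BraidedOplaxFunctor V (ForgetEnrichment V C))
    (adj : Φ.F ⊣ unitRepresentable V C) : Prop where
  counit : gpost (gunit adj (𝟙_ V)) Φ.cou = gid _
  oplaxitor (u v : V) : gpost (gunit adj (u ⊗ v)) (Φ.ν u v) =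
    gcomp (gunit adj u) (gidl (Φ.F.obj u) (gunit adj v))
  halfBraiding (X : ForgetEnrichment V C) (v : V) :
    gpost (gidl X (gunit adj v)) (Φ.hb X v).hom = gidr (gunit adj v) X

theorem EnrMonCat.IsClassifying.exists_classifies {C : EnrMonCat.{v, u, w} V}
    {Φ : BraidedOplaxFunctor V C.underlying} (h : C.IsClassifying Φ) :
    ∃ adj : Φ.F ⊣ unitRepresentable V C.carrier, Classifies Φ adj := by
  obtain ⟨adj, h₁, h₂, h₃⟩ := h
  refine ⟨adj, ⟨?_, fun u v => ?_, fun X v => ?_⟩⟩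
  · exact (homEquiv_eq_gpost adj _).symm.trans h₁
  · exact (homEquiv_eq_gpost adj _).symm.trans ((h₂ u v).trans
      (tensorUnitElt_eq (gunit adj u) (gunit adj v)))
  · exact (congrArg (· ≫ ePost (ForgetEnrichment.to V X) (homTo V (Φ.hb X v).hom))
      (idTensor_unitElt adj v X)).symm.trans
      ((h₃ (ForgetEnrichment.to V X) v).trans (tensorId_unitElt adj v X))

variable {Φ : BraidedOplaxFunctor V (ForgetEnrichment V C)} (adj : Φ.F ⊣ unitRepresentable V C)

/-- The graded morphism `X ⟶ Y` corresponding to a morphism `X ⊗ F v ⟶ Y`. -/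
def gev {v : V} {X Y : ForgetEnrichment V C} (t : X ⊗ Φ.F.obj v ⟶ Y) : GHom v X Y :=
  gpost (gidl X (gunit adj v)) t

variable {u v v' : V} {X Y Z W : ForgetEnrichment V C}

theorem pull_gev (p : v' ⟶ v) (t : X ⊗ Φ.F.obj v ⟶ Y) :
    p ≫ gev adj t = gev adj (X ◁ Φ.F.map p ≫ t) := by
  rw [gev, gev, ← gpost_gpost, ← gidl_gpost, ← gunit_naturality, pull_gidl, pull_gpost]

theorem gev_gpost (t : X ⊗ Φ.F.obj v ⟶ Y) (s : Y ⟶ Z) :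
    gpost (gev adj t) s = gev adj (t ≫ s) := by
  rw [gev, gev, gpost_gpost]

theorem gpre_gev (s : X ⟶ Y) (t : Y ⊗ Φ.F.obj v ⟶ Z) :
    gpre s (gev adj t) = gev adj (s ▷ Φ.F.obj v ≫ t) := by
  rw [gev, gev, ← gpre_gpost, gidl_naturality, gpost_gpost]

theorem gwl_gev (t : X ⊗ Φ.F.obj v ⟶ Y) :
    gwl Z (gev adj t) = gev adj ((α_ _ _ _).hom ≫ Z ◁ t) := by
  rw [gev, gev, gwl_gpost, gwl_gidl, gpost_gpost]

variable {adj} (h : Classifies Φ adj)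

include h

theorem Classifies.gid_eq (X : ForgetEnrichment V C) :
    gid X = gev adj (X ◁ Φ.cou ≫ (ρ_ X).hom) := by
  rw [gev, ← gpost_gpost, ← gidl_gpost, h.counit, gidl_gid, homTo_gpost, Iso.inv_hom_id, homTo_id]

/-- Slide `s` past `j ⊗ η_v`; what remains is `j_X` tensored with the composite of `η_u` and `j ⊗
η_v`, which is the image of `η_{uv}` under the oplaxitor. -/
theorem Classifies.gcomp_gev (s : X ⊗ Φ.F.obj u ⟶ Y) (t : Y ⊗ Φ.F.obj v ⟶ Z) :
    gcomp (gev adj s) (gev adj t) =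
      gev adj (X ◁ Φ.ν u v ≫ (α_ _ _ _).inv ≫ s ▷ Φ.F.obj v ≫ t) := by
  rw [gev, gpost_gcomp, gpre_gev, gev, gcomp_gpost, gev,
    ← gpost_gpost _ (X ◁ Φ.ν u v), ← gidl_gpost, h.oplaxitor, gidl_gcomp, gwl_gidl,
    gcomp_gpost, gpost_gpost, Iso.hom_inv_id_assoc]

/-- Whiskering on the right leaves `η_v` between `X` and `Z`, whereas `gev` wants it rightmost; the
half-braiding with `Z` makes up the difference. -/
theorem Classifies.gwr_gev (t : X ⊗ Φ.F.obj v ⟶ Y) :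
    gwr (gev adj t) Z = gev adj ((α_ _ _ _).hom ≫ X ◁ (Φ.hb Z v).hom ≫
      (α_ _ _ _).inv ≫ t ▷ Z) := by
  rw [gev, gwr_gpost, gev, ← gpost_gpost, ← gwl_gidl, ← gpost_gpost, ← gwl_gpost,
    h.halfBraiding, gwl_gidr, gpost_gpost, Iso.hom_inv_id_assoc]

end

end BraidedEnriched

namespace BraidedEnriched

open ForgetEnrichment Functor.LaxMonoidal Functor.OplaxMonoidal

variable {V : Type u} [Category.{v} V] [MonoidalCategory V] [BraidedCategory V]

/-! ### Representations of a `V`-monoidal category by a pair -/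

/-- A monoidal functor `K` from the underlying category of `C` to `T`, with a compatible
identification of the `v`-graded morphisms `X ⟶ Y` of `C` with the morphisms
`K X ⊗ F v ⟶ K Y` of `T`. -/
structure Representation (C : Type w₁) [EnrichedCategory V C] [EnrichedMonoidalCategory V C]
    {T : Type w₂} [Category.{v} T] [MonoidalCategory T] (Φ : BraidedOplaxFunctor V T) where
  /-- the functor -/
  K : ForgetEnrichment V C ⥤ T
  [monoidal : K.Monoidal]
  /-- the bijection -/
  E {v : V} {X Y : ForgetEnrichment V C} : GHom v X Y ≃ (K.obj X ⊗ Φ.F.obj v ⟶ K.obj Y)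
  E_pull {v v' : V} {X Y : ForgetEnrichment V C} (p : v' ⟶ v) (f : GHom v X Y) :
    E (p ≫ f) = K.obj X ◁ Φ.F.map p ≫ E f
  E_gpost {v : V} {X Y Z : ForgetEnrichment V C} (f : GHom v X Y) (t : Y ⟶ Z) :
    E (gpost f t) = E f ≫ K.map t
  E_gid (X : ForgetEnrichment V C) : E (gid X) = K.obj X ◁ Φ.cou ≫ (ρ_ _).hom
  E_gcomp {u v : V} {X Y Z : ForgetEnrichment V C} (f : GHom u X Y) (g : GHom v Y Z) :
    E (gcomp f g) = K.obj X ◁ Φ.ν u v ≫ (α_ _ _ _).inv ≫ E f ▷ Φ.F.obj v ≫ E g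
  E_gwl {v : V} (Z : ForgetEnrichment V C) {X Y : ForgetEnrichment V C} (f : GHom v X Y) :
    E (gwl Z f) = δ K Z X ▷ Φ.F.obj v ≫ (α_ _ _ _).hom ≫ K.obj Z ◁ E f ≫ μ K Z Y
  E_gwr {v : V} {X Y : ForgetEnrichment V C} (f : GHom v X Y) (Z : ForgetEnrichment V C) :
    E (gwr f Z) = δ K X Z ▷ Φ.F.obj v ≫ (α_ _ _ _).hom ≫ K.obj X ◁ (Φ.hb (K.obj Z) v).hom ≫
      (α_ _ _ _).inv ≫ E f ▷ K.obj Z ≫ μ K Y Z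

attribute [instance] Representation.monoidal

/-- The Yoneda criterion, tested only on objects of the form `K Z`; every object is isomorphic to
one of these. -/
theorem whiskerRight_isIso_of_forall_comp {A : Type w₁} [Category.{v} A] {B : Type w₂}
    [Category.{v} B] (K : A ⥤ B) [K.EssSurj] {X Y : B} (f : X ⟶ Y)
    (h : ∀ Z, Function.Bijective (fun t : Y ⟶ K.obj Z => f ≫ t)) : IsIso f := by
  refine isIso_of_coyoneda_map_bijective f fun T => ⟨fun s t hst => ?_, fun t => ?_⟩
  · rw [← cancel_mono (K.objObjPreimageIso T).inv]
    apply (h _).1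
    dsimp only at hst ⊢
    rw [reassoc_of% hst]
  · obtain ⟨s, hs⟩ := (h _).2 (t ≫ (K.objObjPreimageIso T).inv)
    refine ⟨s ≫ (K.objObjPreimageIso T).hom, ?_⟩
    dsimp only at hs ⊢
    rw [reassoc_of% hs, Iso.inv_hom_id, Category.comp_id]

namespace Representation

section

variable {C : Type w₁} [EnrichedCategory V C] [EnrichedMonoidalCategory V C]
  {T : Type w₂} [Category.{v} T] [MonoidalCategory T] {Φ : BraidedOplaxFunctor V T}
  (R : Representation C Φ)

theorem E_homTo {X Y : ForgetEnrichment V C} (t : X ⟶ Y) :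
    R.E (homTo V t) = R.K.obj X ◁ Φ.cou ≫ (ρ_ _).hom ≫ R.K.map t := by
  rw [← gid_gpost, R.E_gpost, R.E_gid, Category.assoc]

/-- Precomposition needs no field of its own: it is composition with a morphism of degree `𝟙_ V`,
and the left counit law removes the extra degree. -/
theorem E_gpre {v : V} {X Y Z : ForgetEnrichment V C} (t : X ⟶ Y) (f : GHom v Y Z) :
    R.E (gpre t f) = R.K.map t ▷ Φ.F.obj v ≫ R.E f := by
  rw [gpre_eq, R.E_pull, R.E_gcomp, R.E_homTo]
  have h := congrArg (R.K.obj X ◁ ·) (Φ.ν_cou_left v)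
  simp only [MonoidalCategory.whiskerLeft_comp] at h
  simp only [comp_whiskerRight, Category.assoc]
  have h' : R.K.obj X ◁ (λ_ (Φ.F.obj v)).inv ≫ (α_ _ _ _).inv ≫
    (ρ_ (R.K.obj X)).hom ▷ Φ.F.obj v = 𝟙 _ := by monoidal
  rw [← associator_inv_naturality_middle_assoc, reassoc_of% h, reassoc_of% h']

/-- The morphism `F v ⟶ K Y` corresponding to a graded morphism from the unit. -/
def elt {v : V} {Y : ForgetEnrichment V C} (f : GHom v (𝟙_ _) Y) : Φ.F.obj v ⟶ R.K.obj Y :=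
  (λ_ _).inv ≫ ε R.K ▷ _ ≫ R.E f

/-- With `E_gidr`, this shows that `j_X ⊗ f` and `f ⊗ j_X` are represented by isomorphisms as soon
as `f` is. -/
theorem E_gidl {v : V} (X : ForgetEnrichment V C) {Y : ForgetEnrichment V C}
    (f : GHom v (𝟙_ _) Y) : R.E (gidl X f) = R.K.obj X ◁ R.elt f ≫ μ R.K X Y := by
  have h : R.K.map (ρ_ X).inv ≫ δ R.K X (𝟙_ _) = (ρ_ _).inv ≫ R.K.obj X ◁ ε R.K := by
    rw [Functor.OplaxMonoidal.right_unitality R.K X]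
    simp
  rw [gidl, R.E_gpre, R.E_gwl, ← comp_whiskerRight_assoc, h, elt]
  simp only [comp_whiskerRight, MonoidalCategory.whiskerLeft_comp, Category.assoc]
  rw [associator_naturality_middle_assoc, triangle_assoc_comp_right_inv_assoc]

theorem E_gidr {v : V} {Y : ForgetEnrichment V C} (f : GHom v (𝟙_ _) Y)
    (X : ForgetEnrichment V C) :
    R.E (gidr f X) = (Φ.hb (R.K.obj X) v).hom ≫ R.elt f ▷ R.K.obj X ≫ μ R.K Y X := by
  have h : R.K.map (λ_ X).inv ≫ δ R.K (𝟙_ _) X = (λ_ _).inv ≫ ε R.K ▷ R.K.obj X := by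
    rw [Functor.OplaxMonoidal.left_unitality R.K X]
    simp
  rw [gidr, R.E_gpre, R.E_gwr, ← comp_whiskerRight_assoc, h, elt]
  simp only [comp_whiskerRight, Category.assoc]
  rw [associator_naturality_left_assoc, ← whisker_exchange_assoc,
    associator_inv_naturality_left_assoc, leftUnitor_inv_whiskerRight_assoc, Iso.inv_hom_id_assoc,
    ← leftUnitor_inv_naturality_assoc, leftUnitor_inv_whiskerRight_assoc]

theorem elt_gpost {v : V} {Y Z : ForgetEnrichment V C} (f : GHom v (𝟙_ _) Y) (t : Y ⟶ Z) :
    R.elt (gpost f t) = R.elt f ≫ R.K.map t := by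
  simp only [elt, R.E_gpost, Category.assoc]

theorem elt_gid : R.elt (gid (𝟙_ _)) = Φ.cou ≫ ε R.K := by
  rw [elt, R.E_gid, ← whisker_exchange_assoc]
  simp [unitors_inv_equal]

theorem elt_gcomp {u v : V} {X Y : ForgetEnrichment V C} (f : GHom u (𝟙_ _) X)
    (g : GHom v X Y) : R.elt (gcomp f g) = Φ.ν u v ≫ R.elt f ▷ Φ.F.obj v ≫ R.E g := by
  rw [elt, R.E_gcomp, ← whisker_exchange_assoc, elt]
  simp

theorem pull_elt {v v' : V} {Y : ForgetEnrichment V C} (p : v' ⟶ v) (f : GHom v (𝟙_ _) Y) :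
    R.elt (p ≫ f) = Φ.F.map p ≫ R.elt f := by
  rw [elt, R.E_pull, ← whisker_exchange_assoc, elt]
  simp

theorem isIso_elt_iff {v : V} {Y : ForgetEnrichment V C} (f : GHom v (𝟙_ _) Y) :
    IsIso (R.elt f) ↔ IsIso (R.E f) := by
  have : R.elt f = ((λ_ _).symm ≪≫ whiskerRightIso (Functor.Monoidal.εIso R.K) (Φ.F.obj v)).hom ≫
      R.E f := by
    simp [elt]
  rw [this, isIso_comp_left_iff]

/-- Under `E` and full faithfulness of `K`, composing `f` with morphisms of the underlying category
becomes composing with `E f`. With the converse `isUniv`, the universal graded morphisms are those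
represented by isomorphisms. -/
theorem isIso_E {v : V} {X Y : ForgetEnrichment V C} [R.K.IsEquivalence] {f : GHom v X Y}
    (hf : IsUniv f) : IsIso (R.E f) := by
  refine whiskerRight_isIso_of_forall_comp R.K _ fun Z => ?_
  rw [← Function.Bijective.of_comp_iff _ (Functor.FullyFaithful.ofFullyFaithful R.K |>.map_bijective Y Z)]
  have : (fun t => R.E f ≫ t) ∘ R.K.map = R.E ∘ fun t : Y ⟶ Z => gpost f t := by
    funext t
    exact (R.E_gpost f t).symm
  rw [this]
  exact R.E.bijective.comp (hf Z)

theorem isUniv {v : V} {X Y : ForgetEnrichment V C} [R.K.IsEquivalence] {f : GHom v X Y}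
    (hf : IsIso (R.E f)) : IsUniv f := by
  intro Z
  rw [← Function.Bijective.of_comp_iff' R.E.bijective]
  have : R.E ∘ (fun t : Y ⟶ Z => gpost f t) = (fun t => R.E f ≫ t) ∘ R.K.map := by
    funext t
    exact R.E_gpost f t
  rw [this]
  exact ((asIso (R.E f)).symm.homFromEquiv.bijective).comp (Functor.FullyFaithful.ofFullyFaithful R.K |>.map_bijective Y Z)

theorem isUniv_gidl [R.K.IsEquivalence] (X : ForgetEnrichment V C) {v : V}
    {Y : ForgetEnrichment V C} {f : GHom v (𝟙_ _) Y} (hf : IsUniv f) : IsUniv (gidl X f) := by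
  have := (R.isIso_elt_iff f).2 (R.isIso_E hf)
  apply R.isUniv
  rw [R.E_gidl]
  infer_instance

theorem isUniv_gidr [R.K.IsEquivalence] (X : ForgetEnrichment V C) {v : V}
    {Y : ForgetEnrichment V C} {f : GHom v (𝟙_ _) Y} (hf : IsUniv f) : IsUniv (gidr f X) := by
  have := (R.isIso_elt_iff f).2 (R.isIso_E hf)
  apply R.isUniv
  rw [R.E_gidr]
  infer_instance

/-- The half-braidings of the representing pair are invertible, so both `j_X ⊗ η_v` and `η_v ⊗ j_X`
are universal. No closedness is involved. -/
theorem hasInvertibleHalfBraidings [R.K.IsEquivalence] : HasInvertibleHalfBraidings V C := by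
  rw [hasInvertibleHalfBraidings_iff]
  intro F adj X v
  exact (R.isUniv_gidl X (isUniv_gunit adj v)).exists_iso
    (R.isUniv_gidr X (isUniv_gunit adj v))

end

section

variable {C : Type w} [EnrichedCategory V C] [EnrichedMonoidalCategory V C]
  {Φ : BraidedOplaxFunctor V (ForgetEnrichment V C)} {adj : Φ.F ⊣ unitRepresentable V C}
  (hu : ∀ (X : ForgetEnrichment V C) (v : V), IsUniv (gidl X (gunit adj v)))

/-- The bijection between morphisms `X ⊗ F v ⟶ Y` and graded morphisms `X ⟶ Y`. -/
noncomputable def gevEquiv {v : V} {X Y : ForgetEnrichment V C} :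
    (X ⊗ Φ.F.obj v ⟶ Y) ≃ GHom v X Y :=
  Equiv.ofBijective (fun t => gev adj t) (hu X v Y)

theorem gevEquiv_symm_gev {v : V} {X Y : ForgetEnrichment V C} (t : X ⊗ Φ.F.obj v ⟶ Y) :
    (gevEquiv hu).symm (gev adj t) = t :=
  (gevEquiv hu).symm_apply_apply t

theorem exists_gev_eq (hu : ∀ (X : ForgetEnrichment V C) (v : V), IsUniv (gidl X (gunit adj v)))
    {v : V} {X Y : ForgetEnrichment V C} (f : GHom v X Y) : ∃ t, gev adj t = f :=
  (hu X v Y).2 f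

/-- The representation of a `V`-monoidal category by its classifying functor. -/
noncomputable def ofClassifies (h : Classifies Φ adj) : Representation C Φ where
  K := 𝟭 _
  E := (gevEquiv hu).symm
  E_pull p f := by
    obtain ⟨t, rfl⟩ := exists_gev_eq hu f
    rw [pull_gev, gevEquiv_symm_gev, gevEquiv_symm_gev]
    rfl
  E_gpost f s := by
    obtain ⟨t, rfl⟩ := exists_gev_eq hu f
    rw [gev_gpost, gevEquiv_symm_gev, gevEquiv_symm_gev]
    rfl
  E_gid X := by
    rw [h.gid_eq, gevEquiv_symm_gev]
    rfl
  E_gcomp f g := by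
    obtain ⟨s, rfl⟩ := exists_gev_eq hu f
    obtain ⟨t, rfl⟩ := exists_gev_eq hu g
    rw [h.gcomp_gev, gevEquiv_symm_gev, gevEquiv_symm_gev, gevEquiv_symm_gev]
    rfl
  E_gwl {v} Z {X Y} f := by
    obtain ⟨t, rfl⟩ := exists_gev_eq hu f
    rw [gwl_gev, gevEquiv_symm_gev, gevEquiv_symm_gev]
    change _ = 𝟙 (Z ⊗ X) ▷ _ ≫ (α_ _ _ _).hom ≫ Z ◁ t ≫ 𝟙 _
    rw [id_whiskerRight, Category.id_comp, Category.comp_id]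
  E_gwr {v X Y} f Z := by
    obtain ⟨t, rfl⟩ := exists_gev_eq hu f
    rw [h.gwr_gev, gevEquiv_symm_gev, gevEquiv_symm_gev]
    change _ = 𝟙 (X ⊗ Z) ▷ _ ≫ (α_ _ _ _).hom ≫ X ◁ (Φ.hb Z v).hom ≫ (α_ _ _ _).inv ≫
      t ▷ Z ≫ 𝟙 _
    rw [id_whiskerRight, Category.id_comp, Category.comp_id]

end

end Representation

end BraidedEnriched

namespace BraidedEnriched

open ForgetEnrichment Functor.LaxMonoidal Functor.OplaxMonoidal

variable {V : Type u} [Category.{v} V] [MonoidalCategory V] [BraidedCategory V]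

/-! ### Equivalences of pairs and representations -/

/-- A monoidal functor between the categories of two pairs, with an isomorphism of the functors
from `V` compatible with counits, oplaxitors and half-braidings. -/
structure PairMorphism {T : Type w₁} [Category.{v} T] [MonoidalCategory T] {T' : Type w₂}
    [Category.{v} T'] [MonoidalCategory T'] (Φ : BraidedOplaxFunctor V T)
    (Ψ : BraidedOplaxFunctor V T') (K : T ⥤ T') [K.Monoidal] where
  /-- the isomorphism -/
  ψ (v : V) : Ψ.F.obj v ≅ K.obj (Φ.F.obj v)
  naturality {v v' : V} (p : v ⟶ v') :
    Ψ.F.map p ≫ (ψ v').hom = (ψ v).hom ≫ K.map (Φ.F.map p)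
  counit : (ψ (𝟙_ V)).hom ≫ K.map Φ.cou ≫ η K = Ψ.cou
  oplaxitor (x y : V) : (ψ (x ⊗ y)).hom ≫ K.map (Φ.ν x y) ≫ δ K _ _ =
    Ψ.ν x y ≫ ((ψ x).hom ⊗ₘ (ψ y).hom)
  halfBraiding (a : T) (v : V) :
    K.obj a ◁ (ψ v).hom ≫ μ K _ _ ≫ K.map (Φ.hb a v).hom ≫ δ K _ _ =
      (Ψ.hb (K.obj a) v).hom ≫ (ψ v).hom ▷ K.obj a

/-- The data agree up to inverting the isomorphism: `PairMorphism` points it towards `K (Φ.F v)`,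
the direction in which it can be precomposed with `K (R.E f)` in `transE`. -/
theorem CenterPair.equivalent_iff {P Q : CenterPair.{v, u, w} V} :
    P.Equivalent Q ↔ ∃ (K : P.T ⥤ Q.T) (_ : K.Monoidal), K.IsEquivalence ∧
      Nonempty (PairMorphism P.F Q.F K) := by
  constructor
  · rintro ⟨K, hK, φ, h₁, h₂, h₃, h₄⟩
    obtain ⟨ψ, k₁, k₂, k₃, k₄⟩ : ∃ ψ : ∀ v, Q.F.F.obj v ≅ K.obj (P.F.F.obj v),
        (∀ {v v' : V} (p : v ⟶ v'), Q.F.F.map p ≫ (ψ v').hom = (ψ v).hom ≫ K.map (P.F.F.map p)) ∧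
        K.map P.F.cou ≫ η K = (ψ _).inv ≫ Q.F.cou ∧
        (∀ x y, K.map (P.F.ν x y) ≫ δ K _ _ ≫ ((ψ x).inv ⊗ₘ (ψ y).inv) =
          (ψ (x ⊗ y)).inv ≫ Q.F.ν x y) ∧
        ∀ a v, μ K _ _ ≫ K.map (P.F.hb a v).hom ≫ δ K _ _ ≫ (ψ v).inv ▷ K.obj a =
          K.obj a ◁ (ψ v).inv ≫ (Q.F.hb (K.obj a) v).hom :=
      ⟨fun v => (φ.app v).symm, fun p => φ.inv.naturality p, h₂, h₃, h₄⟩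
    refine ⟨K, hK, h₁, ⟨⟨ψ, k₁, ?_, fun x y => ?_, fun a v => ?_⟩⟩⟩
    · rw [k₂, Iso.hom_inv_id_assoc]
    · have h := congrArg (fun t => (ψ (x ⊗ y)).hom ≫ t ≫ ((ψ x).hom ⊗ₘ (ψ y).hom)) (k₃ x y)
      simpa only [Category.assoc, tensorHom_comp_tensorHom, Iso.inv_hom_id, Category.comp_id,
        id_tensorHom_id, Iso.hom_inv_id_assoc] using h
    · have h := congrArg (fun t => K.obj a ◁ (ψ v).hom ≫ t ≫ (ψ v).hom ▷ K.obj a) (k₄ a v)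
      simpa only [Category.assoc, inv_hom_whiskerRight, whiskerLeft_hom_inv_assoc,
        Category.comp_id] using h
  · rintro ⟨K, hK, h₁, ⟨m⟩⟩
    refine ⟨K, hK, NatIso.ofComponents (fun v => (m.ψ v).symm) (fun {v v'} p => ?_), h₁, ?_,
      fun x y => ?_, fun a v => ?_⟩
    · change K.map (P.F.F.map p) ≫ (m.ψ v').inv = (m.ψ v).inv ≫ Q.F.F.map p
      rw [Iso.comp_inv_eq, Category.assoc, m.naturality, Iso.inv_hom_id_assoc]
    · change K.map P.F.cou ≫ η K = (m.ψ _).inv ≫ Q.F.cou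
      rw [Iso.eq_inv_comp, m.counit]
    · change K.map (P.F.ν x y) ≫ δ K _ _ ≫ ((m.ψ x).inv ⊗ₘ (m.ψ y).inv) =
        (m.ψ (x ⊗ y)).inv ≫ Q.F.ν x y
      rw [Iso.eq_inv_comp, reassoc_of% (m.oplaxitor x y), tensorHom_comp_tensorHom,
        Iso.hom_inv_id, Iso.hom_inv_id, id_tensorHom_id, Category.comp_id]
    · change μ K _ _ ≫ K.map (P.F.hb a v).hom ≫ δ K _ _ ≫ (m.ψ v).inv ▷ K.obj a =
        K.obj a ◁ (m.ψ v).inv ≫ (Q.F.hb (K.obj a) v).hom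
      rw [← cancel_epi (K.obj a ◁ (m.ψ v).hom), reassoc_of% (m.halfBraiding a v),
        hom_inv_whiskerRight, Category.comp_id, whiskerLeft_hom_inv_assoc]

namespace Representation

section

variable {C : Type w₁} [EnrichedCategory V C] [EnrichedMonoidalCategory V C]
  {T : Type w₂} [Category.{v} T] [MonoidalCategory T] {Ψ : BraidedOplaxFunctor V T}

/-- A representation by a pair compares the classifying functor with that pair. -/
noncomputable def pairMorphism (R : Representation C Ψ) [R.K.IsEquivalence]
    {Φ : BraidedOplaxFunctor V (ForgetEnrichment V C)} {adj : Φ.F ⊣ unitRepresentable V C}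
    (h : Classifies Φ adj) : PairMorphism Φ Ψ R.K where
  -- Since `η_v` is universal, the morphism of `T` corresponding to it is invertible. The remaining
  -- fields translate the naturality and the defining properties of `η` through the representation.
  ψ v := @asIso _ _ _ _ (R.elt (gunit adj v))
    ((R.isIso_elt_iff _).2 (R.isIso_E (isUniv_gunit adj v)))
  naturality p := by
    rw [asIso_hom, asIso_hom, ← R.pull_elt, gunit_naturality, R.elt_gpost]
  counit := by
    rw [asIso_hom, ← Category.assoc, ← R.elt_gpost, h.counit, R.elt_gid, Category.assoc,
      Functor.Monoidal.ε_η, Category.comp_id]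
  oplaxitor x y := by
    rw [asIso_hom, ← Category.assoc, ← R.elt_gpost, h.oplaxitor, R.elt_gcomp, R.E_gidl,
      Category.assoc, Category.assoc, Category.assoc, Functor.Monoidal.μ_δ, Category.comp_id,
      MonoidalCategory.tensorHom_def]
    rfl
  halfBraiding a v := by
    rw [asIso_hom, ← Category.assoc (μ R.K _ _), ← Category.assoc (_ ◁ _), ← Category.assoc
      (_ ◁ _), ← R.E_gidl, ← R.E_gpost, h.halfBraiding, R.E_gidr, Category.assoc, Category.assoc,
      Functor.Monoidal.μ_δ, Category.comp_id]

section

variable {T' : Type w} [Category.{v} T'] [MonoidalCategory T'] (R : Representation C Ψ)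
  {Ψ' : BraidedOplaxFunctor V T'} {K : T ⥤ T'} [K.Monoidal] (m : PairMorphism Ψ Ψ' K)

/-- The morphism of `T'` corresponding to a graded morphism. -/
def transE {v : V} {X Y : ForgetEnrichment V C} (f : GHom v X Y) :
    K.obj (R.K.obj X) ⊗ Ψ'.F.obj v ⟶ K.obj (R.K.obj Y) :=
  K.obj (R.K.obj X) ◁ (m.ψ v).hom ≫ μ K _ _ ≫ K.map (R.E f)

theorem transE_pull {v v' : V} {X Y : ForgetEnrichment V C} (p : v' ⟶ v) (f : GHom v X Y) :
    R.transE m (p ≫ f) = K.obj (R.K.obj X) ◁ Ψ'.F.map p ≫ R.transE m f := by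
  rw [transE, transE, R.E_pull, ← MonoidalCategory.whiskerLeft_comp_assoc, m.naturality,
    MonoidalCategory.whiskerLeft_comp_assoc, K.map_comp, μ_natural_right_assoc]

theorem transE_gid (X : ForgetEnrichment V C) :
    R.transE m (gid X) = K.obj (R.K.obj X) ◁ Ψ'.cou ≫ (ρ_ _).hom := by
  rw [transE, R.E_gid, ← m.counit, K.map_comp, ← μ_natural_right_assoc,
    MonoidalCategory.whiskerLeft_comp, MonoidalCategory.whiskerLeft_comp, Category.assoc,
    Category.assoc, Functor.Monoidal.map_rightUnitor]
  simp

/-- The point is `h`, the compatibility of `ψ` with oplaxitors; the rest is naturality and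
associativity of the tensorator of `K`. -/
theorem transE_gcomp {u v : V} {X Y Z : ForgetEnrichment V C} (f : GHom u X Y) (g : GHom v Y Z) :
    R.transE m (gcomp f g) = K.obj (R.K.obj X) ◁ Ψ'.ν u v ≫ (α_ _ _ _).inv ≫
      R.transE m f ▷ Ψ'.F.obj v ≫ R.transE m g := by
  have h : (m.ψ (u ⊗ v)).hom ≫ K.map (Ψ.ν u v) =
      Ψ'.ν u v ≫ (m.ψ u).hom ▷ _ ≫ _ ◁ (m.ψ v).hom ≫ μ K _ _ := by
    rw [← MonoidalCategory.tensorHom_def_assoc, ← reassoc_of% (m.oplaxitor u v),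
      Functor.Monoidal.δ_μ, Category.comp_id]
  simp only [transE]
  rw [R.E_gcomp, K.map_comp, ← μ_natural_right_assoc, ← MonoidalCategory.whiskerLeft_comp_assoc,
    h]
  simp only [MonoidalCategory.whiskerLeft_comp, Functor.map_comp, Category.assoc,
    comp_whiskerRight]
  rw [Functor.LaxMonoidal.associativity_inv_assoc, ← μ_natural_left_assoc,
    ← whisker_exchange_assoc, ← whisker_exchange_assoc,
    associator_inv_naturality_right_assoc, associator_inv_naturality_middle_assoc]

theorem μ_associator {A B D : T} : μ K (A ⊗ B) D ≫ K.map (α_ A B D).hom =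
    δ K A B ▷ K.obj D ≫ (α_ _ _ _).hom ≫ K.obj A ◁ μ K B D ≫ μ K A (B ⊗ D) := by
  rw [← Functor.LaxMonoidal.associativity, ← comp_whiskerRight_assoc, Functor.Monoidal.δ_μ,
    id_whiskerRight, Category.id_comp]

theorem transE_gwl {v : V} (Z : ForgetEnrichment V C) {X Y : ForgetEnrichment V C}
    (f : GHom v X Y) :
    R.transE m (gwl Z f) = δ (R.K ⋙ K) Z X ▷ Ψ'.F.obj v ≫ (α_ _ _ _).hom ≫
      K.obj (R.K.obj Z) ◁ R.transE m f ≫ μ (R.K ⋙ K) Z Y := by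
  simp only [transE, Functor.OplaxMonoidal.comp_δ, Functor.LaxMonoidal.comp_μ]
  rw [R.E_gwl]
  simp only [MonoidalCategory.whiskerLeft_comp, Functor.map_comp, Category.assoc,
    comp_whiskerRight, Functor.comp_obj]
  rw [← μ_natural_left_assoc, reassoc_of% (μ_associator (K := K)), ← μ_natural_right_assoc,
    whisker_exchange_assoc, whisker_exchange_assoc, associator_naturality_right_assoc]

theorem transE_gwr {v : V} {X Y : ForgetEnrichment V C} (f : GHom v X Y)
    (Z : ForgetEnrichment V C) :
    R.transE m (gwr f Z) = δ (R.K ⋙ K) X Z ▷ Ψ'.F.obj v ≫ (α_ _ _ _).hom ≫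
      K.obj (R.K.obj X) ◁ (Ψ'.hb (K.obj (R.K.obj Z)) v).hom ≫
      (α_ _ _ _).inv ≫ R.transE m f ▷ K.obj (R.K.obj Z) ≫ μ (R.K ⋙ K) Y Z := by
  have h : K.obj (R.K.obj Z) ◁ (m.ψ v).hom ≫ μ K _ _ ≫ K.map (Ψ.hb (R.K.obj Z) v).hom =
      (Ψ'.hb (K.obj (R.K.obj Z)) v).hom ≫ (m.ψ v).hom ▷ K.obj (R.K.obj Z) ≫ μ K _ _ := by
    rw [← reassoc_of% (m.halfBraiding (R.K.obj Z) v), Functor.Monoidal.δ_μ, Category.comp_id]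
  have h' := congrArg (K.obj (R.K.obj X) ◁ ·) h
  simp only [transE, Functor.OplaxMonoidal.comp_δ, Functor.LaxMonoidal.comp_μ]
  rw [R.E_gwr]
  simp only [MonoidalCategory.whiskerLeft_comp, Functor.map_comp, Category.assoc,
    comp_whiskerRight, Functor.comp_obj] at h' ⊢
  rw [← μ_natural_left_assoc, reassoc_of% (μ_associator (K := K)), ← μ_natural_right_assoc,
    whisker_exchange_assoc, whisker_exchange_assoc, associator_naturality_right_assoc,
    reassoc_of% h', Functor.LaxMonoidal.associativity_inv_assoc, ← μ_natural_left_assoc,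
    associator_inv_naturality_middle_assoc]

/-- A composite of three bijections: `R.E`, the action of the fully faithful `K`, and precomposition
with an isomorphism. -/
theorem transE_bijective [K.Full] [K.Faithful] {v : V} {X Y : ForgetEnrichment V C} :
    Function.Bijective (R.transE m : GHom v X Y → _) := by
  have : (R.transE m : GHom v X Y → _) = R.E.trans ((Functor.FullyFaithful.ofFullyFaithful
      K).homEquiv.trans ((whiskerLeftIso _ (m.ψ v)) ≪≫
        Functor.Monoidal.μIso K _ _).symm.homFromEquiv) := by
    funext f
    exact (Category.assoc _ _ _).symm
  rw [this]
  exact Equiv.bijective _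

/-- Transport of a representation along a morphism of pairs. -/
noncomputable def trans [K.Full] [K.Faithful] : Representation C Ψ' where
  K := R.K ⋙ K
  E := Equiv.ofBijective (R.transE m) (R.transE_bijective m)
  E_pull := R.transE_pull m
  E_gpost f t := by
    change R.transE m _ = R.transE m _ ≫ _
    simp only [transE, R.E_gpost, K.map_comp, Category.assoc, Functor.comp_map]
  E_gid := R.transE_gid m
  E_gcomp := R.transE_gcomp m
  E_gwl := R.transE_gwl m
  E_gwr := R.transE_gwr m

end

end

end Representation

end BraidedEnriched

namespace BraidedEnriched

open ForgetEnrichment Functor.LaxMonoidal Functor.OplaxMonoidal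

variable {V : Type u} [Category.{v} V] [MonoidalCategory V] [BraidedCategory V]

/-! ### Representations and `V`-monoidal functors -/

section

variable {C : Type w₁} [EnrichedCategory V C] [EnrichedMonoidalCategory V C]
  {D : Type w₂} [EnrichedCategory V D] [EnrichedMonoidalCategory V D]

attribute [instance] EnrichedMonoidalFunctor.monoidal

namespace EnrichedMonoidalFunctor

variable (H : EnrichedMonoidalFunctor (V := V) C D)

/-- The underlying functor. -/
abbrev Q : ForgetEnrichment V C ⥤ ForgetEnrichment V D := H.toFunctor.forget

theorem gtensor_gmap {u v : V} {X Y Z W : ForgetEnrichment V C} (f : GHom u X Y) (g : GHom v Z W) :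
    gpre (δ H.Q X Z) (gtensor (EnrichedFunctor.gmap H.toFunctor f)
      (EnrichedFunctor.gmap H.toFunctor g)) =
    gpost (EnrichedFunctor.gmap H.toFunctor (gtensor f g)) (δ H.Q Y W) := by
  have h := congrArg ((f ⊗ₘ g) ≫ ·) (H.naturality (ForgetEnrichment.to V X)
    (ForgetEnrichment.to V Z) (ForgetEnrichment.to V Y) (ForgetEnrichment.to V W))
  simp only [tensorHom_comp_tensorHom_assoc] at h
  refine (Category.assoc _ _ _).trans (h.trans ?_)
  simp only [gpost, EnrichedFunctor.gmap, gtensor, Category.assoc]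
  rfl

theorem gmap_gwl {v : V} (Z : ForgetEnrichment V C) {X Y : ForgetEnrichment V C} (f : GHom v X Y) :
    EnrichedFunctor.gmap H.toFunctor (gwl Z f) =
      gpost (gpre (δ H.Q Z X) (gwl (H.Q.obj Z) (EnrichedFunctor.gmap H.toFunctor f)))
        (μ H.Q Z Y) := by
  apply gpost_iso_cancel (Functor.Monoidal.μIso H.Q Z Y).symm
  rw [gpost_gpost, Iso.symm_hom, Functor.Monoidal.μIso_inv, Functor.Monoidal.μ_δ, gpost_id, gwl_eq,
    gwl_eq, EnrichedFunctor.gmap_pull, ← pull_gpost, ← gtensor_gmap, EnrichedFunctor.gmap_gid,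
    pull_gpre]

theorem gmap_gwr {v : V} {X Y : ForgetEnrichment V C} (f : GHom v X Y) (Z : ForgetEnrichment V C) :
    EnrichedFunctor.gmap H.toFunctor (gwr f Z) =
      gpost (gpre (δ H.Q X Z) (gwr (EnrichedFunctor.gmap H.toFunctor f) (H.Q.obj Z)))
        (μ H.Q Y Z) := by
  apply gpost_iso_cancel (Functor.Monoidal.μIso H.Q Y Z).symm
  rw [gpost_gpost, Iso.symm_hom, Functor.Monoidal.μIso_inv, Functor.Monoidal.μ_δ, gpost_id, gwr_eq,
    gwr_eq, EnrichedFunctor.gmap_pull, ← pull_gpost, ← gtensor_gmap, EnrichedFunctor.gmap_gid,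
    pull_gpre]

theorem gmap_bijective [∀ a b, IsIso (H.toFunctor.map a b)] {v : V}
    {X Y : ForgetEnrichment V C} :
    Function.Bijective (EnrichedFunctor.gmap H.toFunctor : GHom v X Y → _) :=
  (asIso (H.toFunctor.map (ForgetEnrichment.to V X) (ForgetEnrichment.to V Y))).homToEquiv.bijective

end EnrichedMonoidalFunctor

namespace Representation

variable {T : Type w} [Category.{v} T] [MonoidalCategory T] {Ψ : BraidedOplaxFunctor V T}

/-- Restriction of a representation along a fully faithful `V`-monoidal functor. -/
noncomputable def comap (R : Representation D Ψ) (H : EnrichedMonoidalFunctor (V := V) C D)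
    [∀ a b, IsIso (H.toFunctor.map a b)] : Representation C Ψ where
  K := H.Q ⋙ R.K
  E := (Equiv.ofBijective _ H.gmap_bijective).trans R.E
  E_pull p f := by
    change R.E (EnrichedFunctor.gmap H.toFunctor _) = _
    rw [EnrichedFunctor.gmap_pull, R.E_pull]
    rfl
  E_gpost f t := by
    change R.E (EnrichedFunctor.gmap H.toFunctor _) = _
    rw [EnrichedFunctor.gmap_gpost, R.E_gpost]
    rfl
  E_gid X := by
    change R.E (EnrichedFunctor.gmap H.toFunctor _) = _
    rw [EnrichedFunctor.gmap_gid, R.E_gid]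
    rfl
  E_gcomp f g := by
    change R.E (EnrichedFunctor.gmap H.toFunctor _) = _
    rw [EnrichedFunctor.gmap_gcomp, R.E_gcomp]
    rfl
  E_gwl Z _ _ f := by
    change R.E (EnrichedFunctor.gmap H.toFunctor _) = _
    rw [H.gmap_gwl, R.E_gpost, R.E_gpre, R.E_gwl, comp_δ, comp_μ]
    simp only [comp_whiskerRight, Category.assoc]
    rfl
  E_gwr f Z := by
    change R.E (EnrichedFunctor.gmap H.toFunctor _) = _
    rw [H.gmap_gwr, R.E_gpost, R.E_gpre, R.E_gwr, comp_δ, comp_μ]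
    simp only [comp_whiskerRight, Category.assoc]
    rfl

section

variable {Φ : BraidedOplaxFunctor V (ForgetEnrichment V D)} {adj : Φ.F ⊣ unitRepresentable V D}
  (R : Representation C Φ)

/-- The action on graded morphisms of the `V`-functor given by a representation. -/
def toG (adj : Φ.F ⊣ unitRepresentable V D) {v : V} {X Y : ForgetEnrichment V C}
    (f : GHom v X Y) : GHom v (R.K.obj X) (R.K.obj Y) :=
  gev adj (R.E f)

theorem toG_pull {v v' : V} {X Y : ForgetEnrichment V C} (p : v' ⟶ v) (f : GHom v X Y) :
    R.toG adj (p ≫ f) = p ≫ R.toG adj f := by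
  rw [toG, toG, pull_gev, R.E_pull]

theorem toG_gwl {v : V} (Z : ForgetEnrichment V C) {X Y : ForgetEnrichment V C} (f : GHom v X Y) :
    gpost (R.toG adj (gwl Z f)) (δ R.K Z Y) = gpre (δ R.K Z X) (gwl (R.K.obj Z) (R.toG adj f)) := by
  rw [toG, toG, R.E_gwl, gwl_gev, gpre_gev, gev_gpost]
  simp only [Category.assoc, Functor.Monoidal.μ_δ, Category.comp_id]

variable (h : Classifies Φ adj)

include h

theorem toG_gid (X : ForgetEnrichment V C) : R.toG adj (gid X) = gid (R.K.obj X) := by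
  rw [toG, R.E_gid, h.gid_eq]

theorem toG_gcomp {u v : V} {X Y Z : ForgetEnrichment V C} (f : GHom u X Y) (g : GHom v Y Z) :
    R.toG adj (gcomp f g) = gcomp (R.toG adj f) (R.toG adj g) := by
  rw [toG, toG, toG, R.E_gcomp, h.gcomp_gev]

theorem toG_homTo {X Y : ForgetEnrichment V C} (t : X ⟶ Y) :
    R.toG adj (homTo V t) = homTo V (R.K.map t) := by
  rw [toG, R.E_homTo, ← gid_gpost, h.gid_eq, gev_gpost, Category.assoc]

theorem toG_gwr {v : V} {X Y : ForgetEnrichment V C} (f : GHom v X Y) (Z : ForgetEnrichment V C) :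
    gpost (R.toG adj (gwr f Z)) (δ R.K Y Z) = gpre (δ R.K X Z) (gwr (R.toG adj f) (R.K.obj Z)) := by
  rw [toG, toG, R.E_gwr, h.gwr_gev, gpre_gev, gev_gpost]
  simp only [Category.assoc, Functor.Monoidal.μ_δ, Category.comp_id]

/-- The tensor product is a composite of whiskerings, so compatibility with composition and both
whiskerings suffices. This is why `Representation` has no field for `gtensor`. -/
theorem toG_gtensor {u v : V} {X Y Z W : ForgetEnrichment V C} (f : GHom u X Y) (g : GHom v Z W) :
    gpre (δ R.K X Z) (gtensor (R.toG adj f) (R.toG adj g)) =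
      gpost (R.toG adj (gtensor f g)) (δ R.K Y W) := by
  rw [gtensor_eq_gcomp, gtensor_eq_gcomp, R.toG_gcomp h, ← gpre_gcomp, ← R.toG_gwr h, gpost_gcomp,
    ← R.toG_gwl, gcomp_gpost]

/-- The `V`-functor given by a representation by a classifying functor. -/
def enrichedFunctor : EnrichedFunctor V C D where
  obj c := ForgetEnrichment.to V (R.K.obj (ForgetEnrichment.of V c))
  map a b := R.toG adj (X := ForgetEnrichment.of V a) (Y := ForgetEnrichment.of V b) (𝟙 _)
  map_id a := by
    refine (R.toG_pull _ _).symm.trans ?_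
    rw [Category.comp_id]
    exact R.toG_gid h (ForgetEnrichment.of V a)
  map_comp a b c := by
    refine (R.toG_pull _ _).symm.trans ?_
    refine Eq.trans ?_ (R.toG_gcomp h _ _)
    rw [Category.comp_id, gcomp, id_tensorHom_id, Category.id_comp]
    rfl

/-- Yoneda: `toG` is natural in the degree, hence is composition with its value at the identity of
the hom object. -/
theorem comp_enrichedFunctor_map {v : V} {a b : C} (f : v ⟶ (a ⟶[V] b)) :
    f ≫ (R.enrichedFunctor h).map a b =
      R.toG adj (X := ForgetEnrichment.of V a) (Y := ForgetEnrichment.of V b) f := by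
  refine (R.toG_pull _ _).symm.trans ?_
  rw [Category.comp_id]

/-- The underlying functor of the `V`-functor given by a representation. -/
def enrichedFunctorForgetIso : R.K ≅ (R.enrichedFunctor h).forget :=
  NatIso.ofComponents (fun X => Iso.refl (R.K.obj X)) fun {X Y} t => by
    refine (Category.comp_id _).trans (Eq.trans ?_ (Category.id_comp _).symm)
    change _ = homOf V (homTo V t ≫ (R.enrichedFunctor h).map _ _)
    rw [comp_enrichedFunctor_map]
    exact (congrArg (homOf V) (R.toG_homTo h t)).symm

instance enrichedFunctorMonoidal : (R.enrichedFunctor h).forget.Monoidal :=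
  Functor.Monoidal.transport (R.enrichedFunctorForgetIso h)

theorem enrichedFunctor_δ (X Y : ForgetEnrichment V C) :
    δ (R.enrichedFunctor h).forget X Y = δ R.K X Y := by
  refine (Functor.Monoidal.transport_δ (R.enrichedFunctorForgetIso h) X Y).trans ?_
  refine (Category.id_comp _).trans ?_
  refine Eq.trans ?_ (Category.comp_id _)
  exact congrArg (δ R.K X Y ≫ ·) (id_tensorHom_id _ _)

/-- The `V`-monoidal functor given by a representation by a classifying functor. -/
def enrichedMonoidalFunctor : EnrichedMonoidalFunctor (V := V) C D where
  toFunctor := R.enrichedFunctor h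
  naturality a b c d := by
    have e := R.toG_gtensor (h := h) (X := ForgetEnrichment.of V a) (Y := ForgetEnrichment.of V c)
      (Z := ForgetEnrichment.of V b) (W := ForgetEnrichment.of V d) (𝟙 _) (𝟙 _)
    refine (Category.assoc _ _ _).symm.trans ?_
    refine (congrArg (fun t => gpre t (gtensor (R.toG adj (𝟙 _)) (R.toG adj (𝟙 _))))
      (R.enrichedFunctor_δ h _ _)).trans (e.trans ?_)
    refine Eq.trans ?_ (Category.assoc _ _ _)
    refine congrArg₂ gpost ?_ (R.enrichedFunctor_δ h _ _).symm
    refine Eq.trans ?_ (R.comp_enrichedFunctor_map h _).symm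
    refine congrArg (R.toG adj) ?_
    rw [gtensor, id_tensorHom_id, Category.id_comp]
    rfl

omit h in
theorem toG_bijective (hu : ∀ (X : ForgetEnrichment V D) (v : V), IsUniv (gidl X (gunit adj v)))
    {v : V} {X Y : ForgetEnrichment V C} :
    Function.Bijective (R.toG adj : GHom v X Y → _) :=
  (R.E.trans (gevEquiv hu)).bijective

/-- By Yoneda it suffices that `toG` is bijective in every degree, which follows from the two
dictionaries, for `C` by `E` and for `D` by `gevEquiv`. -/
theorem isIso_enrichedFunctor_map
    (hu : ∀ (X : ForgetEnrichment V D) (v : V), IsUniv (gidl X (gunit adj v))) (a b : C) :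
    IsIso ((R.enrichedFunctor h).map a b) := by
  refine isIso_of_yoneda_map_bijective _ fun v => ?_
  have : (fun f : v ⟶ (a ⟶[V] b) => f ≫ (R.enrichedFunctor h).map a b) =
      R.toG adj (X := ForgetEnrichment.of V a) (Y := ForgetEnrichment.of V b) :=
    funext fun f => R.comp_enrichedFunctor_map h f
  exact this ▸ R.toG_bijective hu

end

end Representation

end

/-! ### Equivalences of `V`-monoidal categories and of pairs -/

theorem EnrMonCat.equivalent_iff {C D : EnrMonCat.{v, u, w} V}
    {Φ : BraidedOplaxFunctor V C.underlying} {Ψ : BraidedOplaxFunctor V D.underlying}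
    (hC : IsClosedEnriched V C.carrier) (hD : IsClosedEnriched V D.carrier)
    (hΦ : C.IsClassifying Φ) (hΨ : D.IsClassifying Ψ) :
    C.Equivalent D ↔ (C.pair Φ).Equivalent (D.pair Ψ) := by
  obtain ⟨adj, h⟩ := hΦ.exists_classifies
  obtain ⟨adj', h'⟩ := hΨ.exists_classifies
  have hu : ∀ X v, IsUniv (gidl X (gunit adj v)) :=
    fun X v => isUniv_gidl hC X (isUniv_gunit adj v)
  have hu' : ∀ X v, IsUniv (gidl X (gunit adj' v)) :=
    fun X v => isUniv_gidl hD X (isUniv_gunit adj' v)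
  constructor
  · rintro ⟨H, h₁, h₂⟩
    -- Restricting the dictionary of `D` along `H` represents `C` by the pair of `D`, and comparison
    -- with the classifying functor of `C` yields a morphism of pairs.
    let R := (Representation.ofClassifies hu' h').comap H
    -- Full faithfulness of the underlying functor is the case of degree `𝟙_ V`.
    have : H.Q.Full := ⟨fun {X Y} t => by
      obtain ⟨f, hf⟩ := (H.gmap_bijective (X := X) (Y := Y)).2 (homTo V t)
      exact ⟨homOf V f, congrArg (homOf V) hf⟩⟩
    have : H.Q.Faithful := ⟨fun {X Y} s t hst => by
      have := (H.gmap_bijective (X := X) (Y := Y)).1 (a₁ := homTo V s) (a₂ := homTo V t)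
        (congrArg (homTo V) hst)
      exact congrArg (homOf V) this⟩
    have : H.Q.IsEquivalence := {}
    have : R.K.IsEquivalence := inferInstanceAs (H.Q ⋙ 𝟭 _).IsEquivalence
    exact CenterPair.equivalent_iff.2 ⟨R.K, R.monoidal, this, ⟨R.pairMorphism h⟩⟩
  · intro e
    obtain ⟨K, hK, h₁, ⟨m⟩⟩ : ∃ (K : C.underlying ⥤ D.underlying) (_ : K.Monoidal),
        K.IsEquivalence ∧ Nonempty (PairMorphism Φ Ψ K) := CenterPair.equivalent_iff.1 e
    -- Conversely, transporting the dictionary of `C` along the morphism of pairs represents `C` by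
    -- the classifying functor of `D`; such a representation is a `V`-monoidal functor.
    let R := (Representation.ofClassifies hu h).trans m
    refine ⟨R.enrichedMonoidalFunctor h', fun a b => R.isIso_enrichedFunctor_map h' hu' a b, ?_⟩
    have : R.K.EssSurj := inferInstanceAs (𝟭 _ ⋙ K).EssSurj
    exact Functor.essSurj_of_iso (R.enrichedFunctorForgetIso h')

theorem Representation.pair_equivalent {C : EnrMonCat.{v, u, w} V} {P : CenterPair.{v, u, w} V}
    (R : Representation C.carrier P.F) [hK : R.K.IsEquivalence]
    {Φ : BraidedOplaxFunctor V C.underlying} (hΦ : C.IsClassifying Φ) :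
    (C.pair Φ).Equivalent P := by
  obtain ⟨adj, h⟩ := hΦ.exists_classifies
  exact CenterPair.equivalent_iff.2 ⟨R.K, R.monoidal, hK, ⟨R.pairMorphism h⟩⟩

end BraidedEnriched

namespace BraidedEnriched

variable {V : Type u} [Category.{v} V] [MonoidalCategory V] [BraidedCategory V]

/-! ### Graded morphisms of a pair -/

namespace BraidedOplaxFunctor

variable {T : Type w} [Category.{v} T] [MonoidalCategory T] (Φ : BraidedOplaxFunctor V T)
  {u v v' u' x y : V} {a b c d e z z' : T}

/-- The identity, as a graded morphism of a pair. -/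
def tid (a : T) : a ⊗ Φ.F.obj (𝟙_ V) ⟶ a := a ◁ Φ.cou ≫ (ρ_ a).hom

/-- Composition of graded morphisms of a pair. -/
def tcomp (s : a ⊗ Φ.F.obj u ⟶ b) (t : b ⊗ Φ.F.obj v ⟶ c) : a ⊗ Φ.F.obj (u ⊗ v) ⟶ c :=
  a ◁ Φ.ν u v ≫ (α_ _ _ _).inv ≫ s ▷ Φ.F.obj v ≫ t

/-- Left whiskering of graded morphisms of a pair. -/
def twl (z : T) (t : a ⊗ Φ.F.obj v ⟶ b) : (z ⊗ a) ⊗ Φ.F.obj v ⟶ z ⊗ b := (α_ _ _ _).hom ≫ z ◁ t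

/-- Right whiskering of graded morphisms of a pair. -/
def twr (t : a ⊗ Φ.F.obj v ⟶ b) (z : T) : (a ⊗ z) ⊗ Φ.F.obj v ⟶ b ⊗ z :=
  (α_ _ _ _).hom ≫ a ◁ (Φ.hb z v).hom ≫ (α_ _ _ _).inv ≫ t ▷ z

/-- The tensor product of graded morphisms of a pair. -/
def ttensor (s : a ⊗ Φ.F.obj u ⟶ b) (t : c ⊗ Φ.F.obj v ⟶ d) :
    (a ⊗ c) ⊗ Φ.F.obj (u ⊗ v) ⟶ b ⊗ d :=
  Φ.tcomp (Φ.twr s c) (Φ.twl b t)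

variable (s : a ⊗ Φ.F.obj u ⟶ b) (t : b ⊗ Φ.F.obj v ⟶ c) (t' : d ⊗ Φ.F.obj v ⟶ e)

theorem tcomp_pull_left (p : u' ⟶ u) :
    Φ.tcomp (a ◁ Φ.F.map p ≫ s) t = a ◁ Φ.F.map (p ▷ v) ≫ Φ.tcomp s t := by
  rw [tcomp, tcomp, ← MonoidalCategory.whiskerLeft_comp_assoc, ← ν_natural_left]
  simp

theorem tcomp_pull_right (p : v' ⟶ v) :
    Φ.tcomp s (b ◁ Φ.F.map p ≫ t) = a ◁ Φ.F.map (u ◁ p) ≫ Φ.tcomp s t := by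
  rw [tcomp, tcomp, ← MonoidalCategory.whiskerLeft_comp_assoc, ← ν_natural_right,
    ← whisker_exchange_assoc]
  simp

theorem tcomp_pull (p : u' ⟶ u) (q : v' ⟶ v) :
    Φ.tcomp (a ◁ Φ.F.map p ≫ s) (b ◁ Φ.F.map q ≫ t) =
      a ◁ Φ.F.map (p ⊗ₘ q) ≫ Φ.tcomp s t := by
  rw [tcomp_pull_left, tcomp_pull_right, MonoidalCategory.tensorHom_def, Functor.map_comp,
    MonoidalCategory.whiskerLeft_comp_assoc]

theorem tcomp_comp (f : c ⟶ d) : Φ.tcomp s t ≫ f = Φ.tcomp s (t ≫ f) := by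
  simp only [tcomp, Category.assoc]

theorem comp_tcomp (f : d ⟶ a) :
    Φ.tcomp (f ▷ Φ.F.obj u ≫ s) t = f ▷ Φ.F.obj (u ⊗ v) ≫ Φ.tcomp s t := by
  rw [tcomp, tcomp, ← whisker_exchange_assoc]
  simp

theorem tcomp_comp_left (s : a ⊗ Φ.F.obj u ⟶ d) (f : d ⟶ b) :
    Φ.tcomp (s ≫ f) t = Φ.tcomp s (f ▷ Φ.F.obj v ≫ t) := by
  simp only [tcomp, comp_whiskerRight, Category.assoc]

/-- Coassociativity of the oplaxitor; `tid_tcomp` and `tcomp_tid` are likewise the two counit laws.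
-/
theorem tcomp_assoc (r : c ⊗ Φ.F.obj x ⟶ d) :
    Φ.tcomp (Φ.tcomp s t) r = a ◁ Φ.F.map (α_ u v x).hom ≫ Φ.tcomp s (Φ.tcomp t r) := by
  have h := congrArg (a ◁ ·) (Φ.ν_assoc u v x)
  simp only [MonoidalCategory.whiskerLeft_comp] at h
  simp only [tcomp, comp_whiskerRight, Category.assoc]
  rw [← whisker_exchange_assoc, ← associator_inv_naturality_right_assoc, ← reassoc_of% h]
  simp

theorem tid_tcomp : Φ.tcomp (Φ.tid a) s = a ◁ Φ.F.map (λ_ u).hom ≫ s := by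
  have h := congrArg (a ◁ ·) (Φ.ν_cou_left u)
  simp only [MonoidalCategory.whiskerLeft_comp] at h
  rw [tcomp, tid, ← cancel_epi (a ◁ Φ.F.map (λ_ u).inv),
    ← MonoidalCategory.whiskerLeft_comp_assoc a (Φ.F.map _) (Φ.F.map _), Iso.map_inv_hom_id,
    MonoidalCategory.whiskerLeft_id, Category.id_comp, comp_whiskerRight_assoc, ← associator_inv_naturality_middle_assoc,
    reassoc_of% h]
  simp

theorem tcomp_tid : Φ.tcomp s (Φ.tid b) = a ◁ Φ.F.map (ρ_ u).hom ≫ s := by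
  have h := congrArg (a ◁ ·) (Φ.ν_cou_right u)
  simp only [MonoidalCategory.whiskerLeft_comp] at h
  rw [tcomp, tid, ← cancel_epi (a ◁ Φ.F.map (ρ_ u).inv),
    ← MonoidalCategory.whiskerLeft_comp_assoc a (Φ.F.map _) (Φ.F.map _), Iso.map_inv_hom_id,
    MonoidalCategory.whiskerLeft_id, Category.id_comp, ← whisker_exchange_assoc, ← associator_inv_naturality_right_assoc,
    reassoc_of% h]
  simp

theorem pull_twl (p : v' ⟶ v) :
    Φ.twl z (b ◁ Φ.F.map p ≫ t) = (z ⊗ b) ◁ Φ.F.map p ≫ Φ.twl z t := by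
  simp [twl]

theorem pull_twr (p : v' ⟶ v) :
    Φ.twr (b ◁ Φ.F.map p ≫ t) z = (b ⊗ z) ◁ Φ.F.map p ≫ Φ.twr t z := by
  rw [twr, twr, associator_naturality_right_assoc, ← MonoidalCategory.whiskerLeft_comp_assoc,
    hb_map, MonoidalCategory.whiskerLeft_comp_assoc, comp_whiskerRight,
    ← associator_inv_naturality_middle_assoc]

theorem twl_tid : Φ.twl z (Φ.tid a) = Φ.tid (z ⊗ a) := by
  simp [twl, tid]

theorem twr_tid : Φ.twr (Φ.tid a) z = Φ.tid (a ⊗ z) := by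
  have h := congrArg (a ◁ ·) (Φ.hb_cou z)
  simp only [MonoidalCategory.whiskerLeft_comp] at h
  rw [twr, tid, tid, comp_whiskerRight, ← associator_inv_naturality_middle_assoc,
    triangle_assoc_comp_right, ← h]
  simp

theorem twl_tcomp : Φ.twl z (Φ.tcomp s t) = Φ.tcomp (Φ.twl z s) (Φ.twl z t) := by
  simp only [twl, tcomp, comp_whiskerRight, MonoidalCategory.whiskerLeft_comp, Category.assoc]
  rw [associator_naturality_middle_assoc]
  simp

/-- Says that the oplaxitor is a morphism of the center: moving `z` past `F (u ⊗ v)` agrees with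
moving it past `F u` and `F v` in turn. -/
theorem twr_tcomp : Φ.twr (Φ.tcomp s t) z = Φ.tcomp (Φ.twr s z) (Φ.twr t z) := by
  have h := congrArg (a ◁ ·) (Φ.hb_ν z u v)
  simp only [MonoidalCategory.whiskerLeft_comp] at h
  simp only [twr, tcomp, comp_whiskerRight, Category.assoc]
  rw [← associator_inv_naturality_middle_assoc, ← reassoc_of% h, associator_naturality_left_assoc,
    ← whisker_exchange_assoc]
  monoidal

theorem twl_comp (f : c ⟶ d) : Φ.twl z (t ≫ f) = Φ.twl z t ≫ z ◁ f := by
  simp [twl]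

theorem twr_comp (f : c ⟶ d) : Φ.twr (t ≫ f) z = Φ.twr t z ≫ f ▷ z := by
  simp [twr]

/-- Naturality of the half-braiding moves `t'` past `F u`; the tensor rule then splits off the
half-braiding of `F v` with `F u`, and braidedness turns it into `F` of the braiding of `V`. The
interchange law rests on this. -/
theorem twl_exchange :
    Φ.tcomp (Φ.twl a t') (Φ.twr s e) =
      (a ⊗ d) ◁ Φ.F.map (β_ v u).hom ≫ Φ.tcomp (Φ.twr s d) (Φ.twl b t') := by
  have h := congrArg ((a ⊗ d) ◁ ·) (Φ.hb_braided v u)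
  have h' := congrArg (a ◁ ·) (Φ.hb_natural t' u)
  simp only [MonoidalCategory.whiskerLeft_comp, hb_tensor] at h h'
  simp only [twr, twl, tcomp, comp_whiskerRight, Category.assoc]
  rw [← reassoc_of% h, associator_naturality_left_assoc, ← whisker_exchange,
    associator_naturality_middle_assoc, reassoc_of% h']
  monoidal

theorem twl_associator : Φ.twl (z ⊗ z') t ≫ (α_ _ _ _).hom =
    (α_ _ _ _).hom ▷ _ ≫ Φ.twl z (Φ.twl z' t) := by
  simp [twl]

theorem twr_associator : Φ.twr (Φ.twr t z) z' ≫ (α_ _ _ _).hom =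
    (α_ _ _ _).hom ▷ _ ≫ Φ.twr t (z ⊗ z') := by
  simp only [twr, hb_tensor]
  simp

theorem twr_twl_associator : Φ.twr (Φ.twl z t) z' ≫ (α_ _ _ _).hom =
    (α_ _ _ _).hom ▷ _ ≫ Φ.twl z (Φ.twr t z') := by
  simp [twl, twr]

theorem twl_leftUnitor : Φ.twl (𝟙_ T) t ≫ (λ_ _).hom = (λ_ _).hom ▷ _ ≫ t := by
  simp [twl]

theorem twr_rightUnitor : Φ.twr t (𝟙_ T) ≫ (ρ_ _).hom = (ρ_ _).hom ▷ _ ≫ t := by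
  rw [twr, hb_tensorUnit]
  simp

end BraidedOplaxFunctor

end BraidedEnriched

namespace BraidedEnriched

variable {V : Type u} [Category.{v} V] [MonoidalCategory V] [BraidedCategory V]

namespace BraidedOplaxFunctor

section

variable {T : Type w} [Category.{v} T] [MonoidalCategory T] (Φ : BraidedOplaxFunctor V T)
  {u v v' u' x y : V} {a b c d e f z z' : T}

theorem tcomp_assoc' (s : a ⊗ Φ.F.obj u ⟶ b) (t : b ⊗ Φ.F.obj v ⟶ c) (r : c ⊗ Φ.F.obj x ⟶ d) :
    Φ.tcomp s (Φ.tcomp t r) = a ◁ Φ.F.map (α_ u v x).inv ≫ Φ.tcomp (Φ.tcomp s t) r := by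
  rw [tcomp_assoc, ← MonoidalCategory.whiskerLeft_comp_assoc, Iso.map_inv_hom_id,
    MonoidalCategory.whiskerLeft_id, Category.id_comp]

theorem ttensor_pull (s : a ⊗ Φ.F.obj u ⟶ b) (t : c ⊗ Φ.F.obj v ⟶ d) (p : u' ⟶ u) (q : v' ⟶ v) :
    Φ.ttensor (a ◁ Φ.F.map p ≫ s) (c ◁ Φ.F.map q ≫ t) =
      (a ⊗ c) ◁ Φ.F.map (p ⊗ₘ q) ≫ Φ.ttensor s t := by
  rw [ttensor, pull_twl, pull_twr, tcomp_pull, ttensor]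

theorem ttensor_tid (s : a ⊗ Φ.F.obj u ⟶ b) :
    Φ.ttensor s (Φ.tid c) = (a ⊗ c) ◁ Φ.F.map (ρ_ u).hom ≫ Φ.twr s c := by
  rw [ttensor, twl_tid, tcomp_tid]

theorem tid_ttensor (t : c ⊗ Φ.F.obj v ⟶ d) :
    Φ.ttensor (Φ.tid a) t = (a ⊗ c) ◁ Φ.F.map (λ_ v).hom ≫ Φ.twl a t := by
  rw [ttensor, twr_tid, tid_tcomp]

theorem ttensor_associator (s : a ⊗ Φ.F.obj u ⟶ b) (t : c ⊗ Φ.F.obj v ⟶ d)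
    (r : e ⊗ Φ.F.obj x ⟶ f) :
    Φ.ttensor (Φ.ttensor s t) r ≫ (α_ _ _ _).hom =
      (α_ _ _ _).hom ▷ _ ≫ (a ⊗ c ⊗ e) ◁ Φ.F.map (α_ u v x).hom ≫
        Φ.ttensor s (Φ.ttensor t r) := by
  simp only [ttensor, twr_tcomp, twl_tcomp]
  rw [tcomp_comp, twl_associator, ← tcomp_comp_left, tcomp_comp, twr_twl_associator,
    ← tcomp_comp_left, twr_associator, comp_tcomp, comp_tcomp, tcomp_assoc]

/-- Reassociate until the whiskerings of `t` and `s'` are adjacent and exchange them. The maps of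
degrees that accumulate are the factors of `tensorμ`. -/
theorem ttensor_interchange (s : a ⊗ Φ.F.obj u ⟶ b) (s' : b ⊗ Φ.F.obj u' ⟶ c)
    (t : d ⊗ Φ.F.obj v ⟶ e) (t' : e ⊗ Φ.F.obj v' ⟶ f) :
    Φ.tcomp (Φ.ttensor s t) (Φ.ttensor s' t') = (a ⊗ d) ◁ Φ.F.map (tensorμ u v u' v') ≫
      Φ.ttensor (Φ.tcomp s s') (Φ.tcomp t t') := by
  simp only [ttensor, twr_tcomp, twl_tcomp]
  rw [tcomp_assoc, tcomp_assoc' _ (Φ.twl b t), twl_exchange, tcomp_pull_left, tcomp_assoc,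
    tcomp_pull_right, tcomp_pull_right, tcomp_pull_right, tcomp_assoc' _ (Φ.twr s d), tensorμ]
  simp only [Functor.map_comp, MonoidalCategory.whiskerLeft_comp, Category.assoc]

end

end BraidedOplaxFunctor

/-! ### The `V`-monoidal category of a pair -/

/-- Objects of `V` representing the graded morphisms of a pair. -/
structure GradedHoms {T : Type w} [Category.{v} T] [MonoidalCategory T]
    (Φ : BraidedOplaxFunctor V T) where
  /-- the hom objects -/
  hom : T → T → V
  /-- the universal property of hom objects -/
  E {v : V} {a b : T} : (v ⟶ hom a b) ≃ (a ⊗ Φ.F.obj v ⟶ b)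
  E_pull {v v' : V} {a b : T} (p : v' ⟶ v) (f : v ⟶ hom a b) : E (p ≫ f) = a ◁ Φ.F.map p ≫ E f

/-- The hom objects given by right adjoints. -/
noncomputable def GradedHoms.ofIsLeftAdjoint {T : Type w} [Category.{v} T] [MonoidalCategory T]
    (Φ : BraidedOplaxFunctor V T) (hT : ∀ a : T, (tensorLeft a).IsLeftAdjoint)
    (hF : Φ.F.IsLeftAdjoint) : GradedHoms Φ where
  -- Chosen so that `T(a ⊗ F v, b) ≅ T(F v, [a, b]) ≅ V(v, F^R [a, b])`.
  hom a b := Φ.F.rightAdjoint.obj ((tensorLeft a).rightAdjoint.obj b)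
  E {v a b} := ((Adjunction.ofIsLeftAdjoint Φ.F).homEquiv _ _).symm.trans
    ((Adjunction.ofIsLeftAdjoint (tensorLeft a)).homEquiv _ _).symm
  E_pull p f := by
    rw [Equiv.trans_apply, Equiv.trans_apply, Adjunction.homEquiv_naturality_left_symm,
      Adjunction.homEquiv_naturality_left_symm]
    rfl

/-- The objects of `T`, as objects of the `V`-monoidal category of a pair. -/
@[nolint unusedArguments]
def GradedHoms.Obj {T : Type w} [Category.{v} T] [MonoidalCategory T]
    {Φ : BraidedOplaxFunctor V T} (_ : GradedHoms Φ) : Type w := T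

namespace GradedHoms

section

variable {T : Type w} [Category.{v} T] [MonoidalCategory T] {Φ : BraidedOplaxFunctor V T}
  (G : GradedHoms Φ)

/-- The evaluation. -/
def ev (a b : T) : a ⊗ Φ.F.obj (G.hom a b) ⟶ b := G.E (𝟙 _)

theorem pull_ev {v : V} {a b : T} (f : v ⟶ G.hom a b) : a ◁ Φ.F.map f ≫ G.ev a b = G.E f := by
  rw [ev, ← G.E_pull, Category.comp_id]

/-- The composition. -/
def comp (a b c : T) : G.hom a b ⊗ G.hom b c ⟶ G.hom a c :=
  G.E.symm (Φ.tcomp (G.ev a b) (G.ev b c))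

/-- The identity element. -/
def id (a : T) : 𝟙_ V ⟶ G.hom a a := G.E.symm (Φ.tid a)

/-- The tensor product of hom objects. -/
def tensor (a b c d : T) : G.hom a b ⊗ G.hom c d ⟶ G.hom (a ⊗ c) (b ⊗ d) :=
  G.E.symm (Φ.ttensor (G.ev a b) (G.ev c d))

theorem E_id (a : T) : G.E (G.id a) = Φ.tid a := G.E.apply_symm_apply _

variable {u v : V} {a b c d : T}

/-- With `E_tensor`, this turns the axioms of a `V`-monoidal category, by injectivity of `E`, into
the identities already proved for graded morphisms of the pair. -/
theorem E_comp (f : u ⟶ G.hom a b) (g : v ⟶ G.hom b c) :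
    G.E ((f ⊗ₘ g) ≫ G.comp a b c) = Φ.tcomp (G.E f) (G.E g) := by
  rw [G.E_pull, comp, Equiv.apply_symm_apply, ← BraidedOplaxFunctor.tcomp_pull, pull_ev, pull_ev]

theorem E_tensor (f : u ⟶ G.hom a b) (g : v ⟶ G.hom c d) :
    G.E ((f ⊗ₘ g) ≫ G.tensor a b c d) = Φ.ttensor (G.E f) (G.E g) := by
  rw [G.E_pull, tensor, Equiv.apply_symm_apply, ← BraidedOplaxFunctor.ttensor_pull, pull_ev,
    pull_ev]

theorem E_comp_id : G.E (G.comp a b c) = Φ.tcomp (G.ev a b) (G.ev b c) :=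
  G.E.apply_symm_apply _

theorem E_tensor_id : G.E (G.tensor a b c d) = Φ.ttensor (G.ev a b) (G.ev c d) :=
  G.E.apply_symm_apply _

theorem id_comp (a b : T) :
    (λ_ (G.hom a b)).inv ≫ G.id a ▷ G.hom a b ≫ G.comp a a b = 𝟙 (G.hom a b) := by
  apply G.E.injective
  rw [← MonoidalCategory.tensorHom_id, G.E_pull, E_comp, E_id, BraidedOplaxFunctor.tid_tcomp,
    ← MonoidalCategory.whiskerLeft_comp_assoc, Iso.map_inv_hom_id,
    MonoidalCategory.whiskerLeft_id, Category.id_comp]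

theorem comp_id (a b : T) :
    (ρ_ (G.hom a b)).inv ≫ G.hom a b ◁ G.id b ≫ G.comp a b b = 𝟙 (G.hom a b) := by
  apply G.E.injective
  rw [← MonoidalCategory.id_tensorHom, G.E_pull, E_comp, E_id, BraidedOplaxFunctor.tcomp_tid,
    ← MonoidalCategory.whiskerLeft_comp_assoc, Iso.map_inv_hom_id,
    MonoidalCategory.whiskerLeft_id, Category.id_comp]

theorem assoc (a b c d : T) :
    (α_ (G.hom a b) (G.hom b c) (G.hom c d)).inv ≫ G.comp a b c ▷ G.hom c d ≫ G.comp a c d =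
      G.hom a b ◁ G.comp b c d ≫ G.comp a b d := by
  apply G.E.injective
  rw [← MonoidalCategory.tensorHom_id, ← MonoidalCategory.id_tensorHom, G.E_pull, E_comp, E_comp,
    E_comp_id, E_comp_id, BraidedOplaxFunctor.tcomp_assoc', ev, ev, ev]

/-- The element of a hom object given by a morphism. -/
def elt (t : a ⟶ b) : 𝟙_ V ⟶ G.hom a b := G.E.symm (Φ.tid a ≫ t)

theorem E_elt (t : a ⟶ b) : G.E (G.elt t) = Φ.tid a ≫ t := G.E.apply_symm_apply _

theorem elt_id (a : T) : G.elt (𝟙 a) = G.id a := by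
  rw [elt, Category.comp_id, id]

/-- Postcomposition with a morphism. -/
def post (a : T) (t : b ⟶ c) : G.hom a b ⟶ G.hom a c :=
  (ρ_ _).inv ≫ _ ◁ G.elt t ≫ G.comp a b c

/-- Precomposition with a morphism. -/
def pre (t : a ⟶ b) (c : T) : G.hom b c ⟶ G.hom a c :=
  (λ_ _).inv ≫ G.elt t ▷ _ ≫ G.comp a b c

theorem E_post (f : v ⟶ G.hom a b) (t : b ⟶ c) : G.E (f ≫ G.post a t) = G.E f ≫ t := by
  rw [post, rightUnitor_inv_naturality_assoc, ← MonoidalCategory.tensorHom_def_assoc, G.E_pull,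
    E_comp, E_elt, ← BraidedOplaxFunctor.tcomp_comp, BraidedOplaxFunctor.tcomp_tid,
    Category.assoc, ← MonoidalCategory.whiskerLeft_comp_assoc, Iso.map_inv_hom_id,
    MonoidalCategory.whiskerLeft_id, Category.id_comp]

theorem E_pre (t : a ⟶ b) (f : v ⟶ G.hom b c) : G.E (f ≫ G.pre t c) = t ▷ Φ.F.obj v ≫ G.E f := by
  rw [pre, leftUnitor_inv_naturality_assoc, ← MonoidalCategory.tensorHom_def'_assoc, G.E_pull,
    E_comp, E_elt, BraidedOplaxFunctor.tcomp_comp_left, BraidedOplaxFunctor.tid_tcomp,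
    ← MonoidalCategory.whiskerLeft_comp_assoc, Iso.map_inv_hom_id,
    MonoidalCategory.whiskerLeft_id, Category.id_comp]

theorem elt_post (t : a ⟶ b) (s : b ⟶ c) : G.elt t ≫ G.post a s = G.elt (t ≫ s) := by
  apply G.E.injective
  rw [E_post, E_elt, E_elt, Category.assoc]

theorem elt_comp (t : a ⟶ b) (s : b ⟶ c) :
    ((λ_ (𝟙_ V)).inv ≫ (G.elt t ⊗ₘ G.elt s)) ≫ G.comp a b c = G.elt (t ≫ s) := by
  rw [← elt_post, post, rightUnitor_inv_naturality_assoc, ← MonoidalCategory.tensorHom_def_assoc,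
    unitors_inv_equal, Category.assoc]

theorem tensor_elt_id (t : a ⟶ b) (c : T) :
    (λ_ (𝟙_ V)).inv ≫ (G.elt t ⊗ₘ G.id c) ≫ G.tensor a b c c = G.elt (t ▷ c) := by
  apply G.E.injective
  rw [G.E_pull, E_tensor, E_elt, E_id, E_elt, BraidedOplaxFunctor.ttensor_tid,
    ← MonoidalCategory.whiskerLeft_comp_assoc, ← unitors_equal, Iso.map_inv_hom_id,
    MonoidalCategory.whiskerLeft_id, Category.id_comp, BraidedOplaxFunctor.twr_comp,
    BraidedOplaxFunctor.twr_tid]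

theorem tensor_id_elt (c : T) (t : a ⟶ b) :
    (λ_ (𝟙_ V)).inv ≫ (G.id c ⊗ₘ G.elt t) ≫ G.tensor c c a b = G.elt (c ◁ t) := by
  apply G.E.injective
  rw [G.E_pull, E_tensor, E_elt, E_id, E_elt, BraidedOplaxFunctor.tid_ttensor,
    ← MonoidalCategory.whiskerLeft_comp_assoc, Iso.map_inv_hom_id,
    MonoidalCategory.whiskerLeft_id, Category.id_comp, BraidedOplaxFunctor.twl_comp,
    BraidedOplaxFunctor.twl_tid]

theorem tensor_id (a b : T) :
    (λ_ (𝟙_ V)).inv ≫ (G.id a ⊗ₘ G.id b) ≫ G.tensor a a b b = G.id (a ⊗ b) := by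
  rw [← elt_id, tensor_elt_id, id_whiskerRight, elt_id]

theorem interchange (a b c d e f : T) :
    (G.tensor a b d e ⊗ₘ G.tensor b c e f) ≫ G.comp (a ⊗ d) (b ⊗ e) (c ⊗ f) =
      tensorμ (G.hom a b) (G.hom d e) (G.hom b c) (G.hom e f) ≫
        (G.comp a b c ⊗ₘ G.comp d e f) ≫ G.tensor a c d f := by
  apply G.E.injective
  rw [E_comp, E_tensor_id, E_tensor_id, G.E_pull, E_tensor, E_comp_id, E_comp_id,
    BraidedOplaxFunctor.ttensor_interchange]

theorem associator_naturality (a a' b b' c c' : T) :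
    G.tensor a a' b b' ▷ G.hom c c' ≫ G.tensor (a ⊗ b) (a' ⊗ b') c c' ≫
        G.post _ (α_ a' b' c').hom =
      (α_ _ _ _).hom ≫ G.hom a a' ◁ G.tensor b b' c c' ≫ G.tensor a a' (b ⊗ c) (b' ⊗ c') ≫
        G.pre (α_ a b c).hom _ := by
  apply G.E.injective
  rw [← Category.assoc, E_post, ← MonoidalCategory.tensorHom_id, E_tensor, E_tensor_id,
    ← Category.assoc (_ ◁ _), ← Category.assoc (Iso.hom _), E_pre, G.E_pull,
    ← MonoidalCategory.id_tensorHom (G.hom a a'), E_tensor, E_tensor_id, ← ev, ← ev,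
    BraidedOplaxFunctor.ttensor_associator]

theorem leftUnitor_naturality (a b : T) :
    (λ_ _).inv ≫ G.id (𝟙_ T) ▷ G.hom a b ≫ G.tensor (𝟙_ T) (𝟙_ T) a b ≫
      G.post _ (λ_ b).hom = G.pre (λ_ a).hom b := by
  apply G.E.injective
  rw [← Category.assoc, ← Category.assoc, E_post, ← Category.id_comp (G.pre _ _), E_pre,
    Category.assoc, G.E_pull, ← MonoidalCategory.tensorHom_id, E_tensor, E_id,
    BraidedOplaxFunctor.tid_ttensor, ← MonoidalCategory.whiskerLeft_comp_assoc,
    Iso.map_inv_hom_id, MonoidalCategory.whiskerLeft_id, Category.id_comp,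
    BraidedOplaxFunctor.twl_leftUnitor]

theorem rightUnitor_naturality (a b : T) :
    (ρ_ _).inv ≫ G.hom a b ◁ G.id (𝟙_ T) ≫ G.tensor a b (𝟙_ T) (𝟙_ T) ≫
      G.post _ (ρ_ b).hom = G.pre (ρ_ a).hom b := by
  apply G.E.injective
  rw [← Category.assoc, ← Category.assoc, E_post, ← Category.id_comp (G.pre _ _), E_pre,
    Category.assoc, G.E_pull, ← MonoidalCategory.id_tensorHom (G.hom a b), E_tensor, E_id,
    BraidedOplaxFunctor.ttensor_tid, ← MonoidalCategory.whiskerLeft_comp_assoc,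
    Iso.map_inv_hom_id, MonoidalCategory.whiskerLeft_id, Category.id_comp,
    BraidedOplaxFunctor.twr_rightUnitor]

instance : EnrichedCategory V G.Obj where
  Hom a b := G.hom (T := T) a b
  id a := G.id (T := T) a
  comp a b c := G.comp (T := T) a b c
  id_comp a b := G.id_comp (T := T) a b
  comp_id a b := G.comp_id (T := T) a b
  assoc a b c d := G.assoc (T := T) a b c d

/-- A morphism of `T`, in the underlying category of the `V`-category of a pair. -/
def lift {a b : T} (t : a ⟶ b) :
    ForgetEnrichment.of V (show G.Obj from a) ⟶ ForgetEnrichment.of V (show G.Obj from b) :=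
  ForgetEnrichment.homOf V (C := G.Obj) (G.elt t)

theorem lift_comp {a b c : T} (t : a ⟶ b) (s : b ⟶ c) :
    G.lift (t ≫ s) = G.lift t ≫ G.lift s :=
  (congrArg (ForgetEnrichment.homOf V (C := G.Obj)) (G.elt_comp t s)).symm

theorem lift_id (a : T) :
    G.lift (𝟙 a) = 𝟙 (ForgetEnrichment.of V (show G.Obj from a)) :=
  (congrArg (ForgetEnrichment.homOf V (C := G.Obj)) (G.elt_id a)).trans
    (ForgetEnrichment.homOf_eId V _)

/-- An isomorphism of `T`, in the underlying category of the `V`-category of a pair. -/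
def liftIso {a b : T} (e : a ≅ b) :
    ForgetEnrichment.of V (show G.Obj from a) ≅ ForgetEnrichment.of V (show G.Obj from b) where
  hom := G.lift e.hom
  inv := G.lift e.inv
  hom_inv_id := by rw [← lift_comp, Iso.hom_inv_id, lift_id]
  inv_hom_id := by rw [← lift_comp, Iso.inv_hom_id, lift_id]

theorem lift_whiskerRight {a b : T} (t : a ⟶ b) (c : T) : G.lift (t ▷ c) =
    ForgetEnrichment.homOf V (C := G.Obj)
      ((λ_ (𝟙_ V)).inv ≫ (G.elt t ⊗ₘ G.id c) ≫ G.tensor a b c c) :=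
  congrArg (ForgetEnrichment.homOf V (C := G.Obj)) (G.tensor_elt_id t c).symm

theorem lift_whiskerLeft {a b : T} (c : T) (t : a ⟶ b) : G.lift (c ◁ t) =
    ForgetEnrichment.homOf V (C := G.Obj)
      ((λ_ (𝟙_ V)).inv ≫ (G.id c ⊗ₘ G.elt t) ≫ G.tensor c c a b) :=
  congrArg (ForgetEnrichment.homOf V (C := G.Obj)) (G.tensor_id_elt c t).symm

theorem lift_pentagon (a b c d : T) :
    ForgetEnrichment.homOf V (C := G.Obj) ((λ_ (𝟙_ V)).inv ≫ (G.elt (α_ a b c).hom ⊗ₘ G.id d) ≫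
        G.tensor _ _ d d) ≫ G.lift (α_ a (b ⊗ c) d).hom ≫
      ForgetEnrichment.homOf V (C := G.Obj) ((λ_ (𝟙_ V)).inv ≫
        (G.id a ⊗ₘ G.elt (α_ b c d).hom) ≫ G.tensor a a _ _) =
      G.lift (α_ (a ⊗ b) c d).hom ≫ G.lift (α_ a b (c ⊗ d)).hom := by
  have h := congrArg G.lift (MonoidalCategory.pentagon a b c d)
  rw [lift_comp, lift_comp, lift_comp, lift_whiskerRight, lift_whiskerLeft] at h
  exact h

theorem lift_triangle (a b : T) :
    G.lift (α_ a (𝟙_ T) b).hom ≫ ForgetEnrichment.homOf V (C := G.Obj) ((λ_ (𝟙_ V)).inv ≫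
        (G.id a ⊗ₘ G.elt (λ_ b).hom) ≫ G.tensor a a _ _) =
      ForgetEnrichment.homOf V (C := G.Obj) ((λ_ (𝟙_ V)).inv ≫ (G.elt (ρ_ a).hom ⊗ₘ G.id b) ≫
        G.tensor _ _ b b) := by
  have h := congrArg G.lift (MonoidalCategory.triangle a b)
  rw [lift_comp, lift_whiskerRight, lift_whiskerLeft] at h
  exact h

instance : EnrichedMonoidalCategory V G.Obj where
  unit := 𝟙_ T
  tObj a b := tensorObj (C := T) a b
  tHom a b c d := G.tensor (T := T) a b c d
  associator a b c := G.liftIso (@MonoidalCategoryStruct.associator T _ _ a b c)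
  leftUnitor a := G.liftIso (@MonoidalCategoryStruct.leftUnitor T _ _ a)
  rightUnitor a := G.liftIso (@MonoidalCategoryStruct.rightUnitor T _ _ a)
  tensor_id a b := G.tensor_id (T := T) a b
  interchange a b c d e f := G.interchange (T := T) a b c d e f
  associator_naturality a a' b b' c c' := G.associator_naturality (T := T) a a' b b' c c'
  leftUnitor_naturality a b := G.leftUnitor_naturality (T := T) a b
  rightUnitor_naturality a b := G.rightUnitor_naturality (T := T) a b
  pentagon a b c d := G.lift_pentagon (T := T) a b c d
  triangle a b := G.lift_triangle (T := T) a b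

end

end GradedHoms

end BraidedEnriched

/-! ### The underlying category of the enrichment compared with `T`. -/

namespace BraidedEnriched

open ForgetEnrichment Functor.LaxMonoidal Functor.OplaxMonoidal

variable {V : Type u} [Category.{v} V] [MonoidalCategory V] [BraidedCategory V]

namespace GradedHoms

variable {T : Type w} [Category.{v} T] [MonoidalCategory T] {Φ : BraidedOplaxFunctor V T}
  (G : GradedHoms Φ)

/-- Strong unitality is used here: it identifies `T(a ⊗ F 1, b)` with `T(a, b)`, so that the
elements of `hom a b` are the morphisms of `T`. -/
theorem isIso_tid (a : T) : IsIso (Φ.tid a) := by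
  have := Φ.isIso_cou
  rw [BraidedOplaxFunctor.tid]
  infer_instance

/-- Morphisms of `T` are elements of hom objects. -/
noncomputable def eltEquiv {a b : T} : (a ⟶ b) ≃ (𝟙_ V ⟶ G.hom a b) :=
  have := isIso_tid (Φ := Φ) a
  ((asIso (Φ.tid a)).symm.homFromEquiv).trans G.E.symm

/-- The object of `T` underlying an object of the enrichment. -/
abbrev under (X : ForgetEnrichment V G.Obj) : T := ForgetEnrichment.to (C := G.Obj) V X

/-- The morphism of `T` given by a morphism of the underlying category of its enrichment. -/
noncomputable def lower {X Y : ForgetEnrichment V G.Obj} (f : X ⟶ Y) :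
    G.under X ⟶ G.under Y :=
  G.eltEquiv.symm (homTo V f)

theorem elt_lower {X Y : ForgetEnrichment V G.Obj} (f : X ⟶ Y) : G.elt (G.lower f) = homTo V f :=
  G.eltEquiv.apply_symm_apply _

theorem lower_eq {X Y : ForgetEnrichment V G.Obj} {f : X ⟶ Y}
    {t : G.under X ⟶ G.under Y}
    (h : G.elt t = homTo V f) : G.lower f = t :=
  G.eltEquiv.injective ((G.elt_lower f).trans h.symm)

/-- The underlying category of the `V`-category of a pair is equivalent to `T`. -/
noncomputable def toT : ForgetEnrichment V G.Obj ⥤ T where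
  obj X := G.under X
  map f := G.lower f
  map_id X := G.lower_eq ((G.elt_id (G.under X)).trans (homTo_id V X).symm)
  map_comp f g := G.lower_eq ((G.elt_comp _ _).symm.trans (by
    rw [G.elt_lower, G.elt_lower]
    exact (homTo_comp V f g).symm))

theorem elt_toT_map {X Y : ForgetEnrichment V G.Obj} (f : X ⟶ Y) :
    G.elt (G.toT.map f) = homTo V f := G.elt_lower f

theorem toT_map_eq {X Y : ForgetEnrichment V G.Obj} {f : X ⟶ Y} {t : G.toT.obj X ⟶ G.toT.obj Y}
    (h : G.elt t = homTo V f) : G.toT.map f = t := G.lower_eq h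

theorem toT_map_lift {a b : T} (t : a ⟶ b) : G.toT.map (G.lift t) = t := G.toT_map_eq rfl

instance : G.toT.IsEquivalence where
  faithful := ⟨fun {X Y f g} h => by
    have := (G.elt_toT_map f).symm.trans ((congrArg G.elt h).trans (G.elt_toT_map g))
    exact congrArg (homOf V) this⟩
  full := ⟨fun {X Y} t => ⟨G.lift t, G.toT_map_lift t⟩⟩
  essSurj := ⟨fun a => ⟨ForgetEnrichment.of V (show G.Obj from a), ⟨Iso.refl a⟩⟩⟩

theorem toT_map_whiskerRight {X Y : ForgetEnrichment V G.Obj} (f : X ⟶ Y)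
    (Z : ForgetEnrichment V G.Obj) : G.toT.map (f ▷ Z) = G.toT.map f ▷ G.toT.obj Z := by
  refine G.toT_map_eq ((G.tensor_elt_id _ _).symm.trans ?_)
  rw [G.elt_toT_map]
  rfl

theorem toT_map_whiskerLeft {X Y : ForgetEnrichment V G.Obj} (Z : ForgetEnrichment V G.Obj)
    (f : X ⟶ Y) : G.toT.map (Z ◁ f) = G.toT.obj Z ◁ G.toT.map f := by
  refine G.toT_map_eq ((G.tensor_id_elt _ _).symm.trans ?_)
  rw [G.elt_toT_map]
  rfl

theorem toT_map_associator (X Y Z : ForgetEnrichment V G.Obj) : G.toT.map (α_ X Y Z).hom =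
    (α_ (G.toT.obj X) (G.toT.obj Y) (G.toT.obj Z)).hom := G.toT_map_lift _

theorem toT_map_leftUnitor (X : ForgetEnrichment V G.Obj) : G.toT.map (λ_ X).hom =
    (λ_ (G.toT.obj X)).hom := G.toT_map_lift _

theorem toT_map_rightUnitor (X : ForgetEnrichment V G.Obj) : G.toT.map (ρ_ X).hom =
    (ρ_ (G.toT.obj X)).hom := G.toT_map_lift _

theorem refl_associator (a b c : T) : (Iso.refl (a ⊗ b)).hom ▷ c ≫
    (Iso.refl ((a ⊗ b) ⊗ c)).hom ≫ (α_ a b c).hom =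
      (α_ a b c).hom ≫ a ◁ (Iso.refl (b ⊗ c)).hom ≫ (Iso.refl (a ⊗ b ⊗ c)).hom := by
  simp

/-- The functor to `T` is strictly monoidal. -/
noncomputable def coreMonoidal : G.toT.CoreMonoidal where
  εIso := Iso.refl (𝟙_ T)
  μIso X Y := Iso.refl (G.toT.obj X ⊗ G.toT.obj Y)
  μIso_hom_natural_left f Z :=
    (Category.comp_id _).trans ((G.toT_map_whiskerRight f Z).symm.trans (Category.id_comp _).symm)
  μIso_hom_natural_right Z f :=
    (Category.comp_id _).trans ((G.toT_map_whiskerLeft Z f).symm.trans (Category.id_comp _).symm)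
  associativity X Y Z :=
    (congrArg (fun t => (Iso.refl (G.toT.obj X ⊗ G.toT.obj Y)).hom ▷ G.toT.obj Z ≫
      (Iso.refl ((G.toT.obj X ⊗ G.toT.obj Y) ⊗ G.toT.obj Z)).hom ≫ t)
        (G.toT_map_associator X Y Z)).trans (refl_associator _ _ _)
  left_unitality X :=
    Eq.symm ((congrArg (fun t => (Iso.refl (𝟙_ T)).hom ▷ G.toT.obj X ≫
      (Iso.refl (𝟙_ T ⊗ G.toT.obj X)).hom ≫ t) (G.toT_map_leftUnitor X)).trans (by simp))
  right_unitality X :=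
    Eq.symm ((congrArg (fun t => G.toT.obj X ◁ (Iso.refl (𝟙_ T)).hom ≫
      (Iso.refl (G.toT.obj X ⊗ 𝟙_ T)).hom ≫ t) (G.toT_map_rightUnitor X)).trans (by simp))

noncomputable instance : G.toT.Monoidal := G.coreMonoidal.toMonoidal

/-- The universal property of the hom objects of the enrichment. -/
def eqv {v : V} {X Y : ForgetEnrichment V G.Obj} :
    GHom v X Y ≃ (G.toT.obj X ⊗ Φ.F.obj v ⟶ G.toT.obj Y) :=
  G.E (a := G.under X) (b := G.under Y)

section

variable {u v : V} {X Y Z W : ForgetEnrichment V G.Obj}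

theorem eqv_pull {v' : V} (p : v' ⟶ v) (f : GHom v X Y) :
    G.eqv (p ≫ f) = G.toT.obj X ◁ Φ.F.map p ≫ G.eqv f :=
  G.E_pull p f

theorem eqv_gpost (f : GHom v X Y) (t : Y ⟶ Z) : G.eqv (gpost f t) = G.eqv f ≫ G.toT.map t := by
  refine Eq.trans ?_ (G.E_post (a := G.under X) (b := G.under Y) (c := G.under Z) f (G.toT.map t))
  have h : G.post (G.under X) (G.toT.map t) = ePost (ForgetEnrichment.to V X) (homTo V t) :=
    congrArg (fun s => (ρ_ _).inv ≫ _ ◁ s ≫ G.comp (G.under X) (G.under Y) (G.under Z))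
      (G.elt_toT_map t)
  exact congrArg (fun s => G.E (a := G.under X) (b := G.under Z) (f ≫ s)) h.symm

theorem eqv_gid : G.eqv (gid X) = Φ.tid (G.toT.obj X) := G.E_id _

theorem eqv_gcomp (f : GHom u X Y) (g : GHom v Y Z) :
    G.eqv (gcomp f g) = Φ.tcomp (G.eqv f) (G.eqv g) :=
  G.E_comp (a := G.under X) (b := G.under Y) (c := G.under Z) f g

theorem eqv_gtensor (f : GHom u X Y) (g : GHom v Z W) :
    G.eqv (gtensor f g) = Φ.ttensor (G.eqv f) (G.eqv g) :=
  G.E_tensor (a := G.under X) (b := G.under Y) (c := G.under Z) (d := G.under W) f g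

theorem eqv_gwl (f : GHom v X Y) : G.eqv (gwl Z f) = Φ.twl (G.toT.obj Z) (G.eqv f) := by
  rw [gwl_eq, eqv_pull]
  refine (congrArg (_ ≫ ·) (G.eqv_gtensor (gid Z) f)).trans ?_
  rw [eqv_gid]
  refine (congrArg (_ ≫ ·) (Φ.tid_ttensor (G.eqv f))).trans ?_
  refine (MonoidalCategory.whiskerLeft_comp_assoc _ _ _ _).symm.trans ?_
  rw [Iso.map_inv_hom_id, MonoidalCategory.whiskerLeft_id]
  exact Category.id_comp _

theorem eqv_gwr (f : GHom v X Y) : G.eqv (gwr f Z) = Φ.twr (G.eqv f) (G.toT.obj Z) := by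
  rw [gwr_eq, eqv_pull]
  refine (congrArg (_ ≫ ·) (G.eqv_gtensor f (gid Z))).trans ?_
  rw [eqv_gid]
  refine (congrArg (_ ≫ ·) (Φ.ttensor_tid (G.eqv f))).trans ?_
  refine (MonoidalCategory.whiskerLeft_comp_assoc _ _ _ _).symm.trans ?_
  rw [Iso.map_inv_hom_id, MonoidalCategory.whiskerLeft_id]
  exact Category.id_comp _

end

theorem twl_eq {v : V} {a b : T} (z : T) (t : a ⊗ Φ.F.obj v ⟶ b) :
    Φ.twl z t = 𝟙 (z ⊗ a) ▷ Φ.F.obj v ≫ (α_ _ _ _).hom ≫ z ◁ t ≫ 𝟙 (z ⊗ b) := by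
  simp [BraidedOplaxFunctor.twl]

theorem twr_eq {v : V} {a b : T} (t : a ⊗ Φ.F.obj v ⟶ b) (z : T) :
    Φ.twr t z = 𝟙 (a ⊗ z) ▷ Φ.F.obj v ≫ (α_ _ _ _).hom ≫ a ◁ (Φ.hb z v).hom ≫
      (α_ _ _ _).inv ≫ t ▷ z ≫ 𝟙 (b ⊗ z) := by
  simp [BraidedOplaxFunctor.twr]

/-- The representation of the `V`-monoidal category of a pair by the pair. -/
noncomputable def representation : Representation G.Obj Φ where
  K := G.toT
  E := G.eqv
  E_pull p f := G.eqv_pull p f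
  E_gpost f t := G.eqv_gpost f t
  E_gid _ := G.eqv_gid
  E_gcomp f g := G.eqv_gcomp f g
  E_gwl _ _ _ f := G.eqv_gwl f |>.trans (twl_eq _ _)
  E_gwr f _ := G.eqv_gwr f |>.trans (twr_eq _ _)

end GradedHoms

/-- Every pair with `T` closed and `F` a left adjoint represents a `V`-monoidal category. -/
theorem CenterPair.exists_representation (P : CenterPair.{v, u, w} V) (hP : P.IsClosed)
    (hF : P.HasRightAdjoint) : ∃ (C : EnrMonCat.{v, u, w} V)
      (R : Representation C.carrier P.F), R.K.IsEquivalence :=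
  let G := GradedHoms.ofIsLeftAdjoint P.F hP hF
  ⟨⟨G.Obj⟩, G.representation, inferInstanceAs G.toT.IsEquivalence⟩

end BraidedEnriched

namespace BraidedEnriched

open ForgetEnrichment Functor.LaxMonoidal Functor.OplaxMonoidal

/-! ### Closed, biclosed and rigid `V`-monoidal categories -/

theorem comp_assoc_five {T : Type w} [Category.{v} T] {a b c d e f : T} (g₁ : a ⟶ b) (g₂ : b ⟶ c)
    (g₃ : c ⟶ d) (g₄ : d ⟶ e) (g₅ : e ⟶ f) :
    g₁ ≫ g₂ ≫ g₃ ≫ g₄ ≫ g₅ = (g₁ ≫ g₂ ≫ g₃ ≫ g₄) ≫ g₅ := by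
  simp

section

variable {V : Type u} [Category.{v} V] [MonoidalCategory V]
  {C : Type w₁} [EnrichedCategory V C] {D : Type w₂} [EnrichedCategory V D]

theorem isIso_transposeRight {L : EnrichedFunctor V C D} {X Z : ForgetEnrichment V C}
    {Y : ForgetEnrichment V D} {ε : L.forget.obj Z ⟶ Y}
    (h : ∀ v : V, Function.Bijective fun f : GHom v X Z => gpost (EnrichedFunctor.gmap L f) ε) :
    IsIso (transposeRight L X ε) := by
  refine isIso_of_yoneda_map_bijective _ fun v => ?_
  have : (fun f : GHom v X Z => f ≫ transposeRight L X ε) =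
      fun f => gpost (EnrichedFunctor.gmap L f) ε :=
    funext fun f => comp_transposeRight L ε f
  exact this ▸ h v

theorem gpre_inv_eq {v : V} {X X' Y Y' : ForgetEnrichment V C} {f : GHom v X Y}
    {g : GHom v X' Y'}
    {e : X ≅ X'} {e' : Y ≅ Y'} (h : gpost f e'.hom = gpre e.hom g) :
    gpre e.inv f = gpost g e'.inv := by
  rw [← gpost_id f, ← e'.hom_inv_id, ← gpost_gpost, h, gpre_gpost, gpre_gpre, e.inv_hom_id,
    gpre_id]

/-- A right `V`-adjoint exists if there are universal arrows to it. -/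
theorem exists_enrichedAdjunction_of_bijective (L : EnrichedFunctor V C D)
    (h : ∀ Y : ForgetEnrichment V D, ∃ (Z : ForgetEnrichment V C) (ε : L.forget.obj Z ⟶ Y),
      ∀ X (v : V), Function.Bijective
        fun f : GHom v X Z => gpost (EnrichedFunctor.gmap L f) ε) :
    ∃ R, Nonempty (EnrichedAdjunction L R) := by
  choose R ε h using h
  have := fun X Y => isIso_transposeRight (h Y X)
  exact ⟨_, ⟨adjunctionOfRightUniversal L R ε⟩⟩

/-- A `V`-adjunction given by a unit and a counit. -/
theorem exists_enrichedAdjunction_of_unit_counit {L : EnrichedFunctor V C D}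
    {R : EnrichedFunctor V D C} (η : ∀ X, X ⟶ R.forget.obj (L.forget.obj X))
    (ε : ∀ Y, L.forget.obj (R.forget.obj Y) ⟶ Y)
    (hη : ∀ {v : V} {X Y : ForgetEnrichment V C} (f : GHom v X Y),
      gpost f (η Y) = gpre (η X) (EnrichedFunctor.gmap R (EnrichedFunctor.gmap L f)))
    (hε : ∀ {v : V} {X Y : ForgetEnrichment V D} (f : GHom v X Y),
      gpre (ε X) f = gpost (EnrichedFunctor.gmap L (EnrichedFunctor.gmap R f)) (ε Y))
    (h₁ : ∀ X, L.forget.map (η X) ≫ ε (L.forget.obj X) = 𝟙 _)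
    (h₂ : ∀ Y, η (R.forget.obj Y) ≫ R.forget.map (ε Y) = 𝟙 _) :
    ∃ R, Nonempty (EnrichedAdjunction L R) := by
  refine exists_enrichedAdjunction_of_bijective L fun Y => ⟨R.forget.obj Y, ε Y, fun X v =>
    Function.bijective_iff_has_inverse.2 ⟨fun g => gpre (η X) (EnrichedFunctor.gmap R g),
      fun f => ?_, fun g => ?_⟩⟩
  · dsimp only
    rw [EnrichedFunctor.gmap_gpost, ← gpre_gpost, ← hη, gpost_gpost, h₂, gpost_id]
  · dsimp only
    rw [EnrichedFunctor.gmap_gpre, gpre_gpost, ← hε, gpre_gpre, h₁, gpre_id]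

/-- Take elements of the hom objects, that is, degree `𝟙_ V`; naturality in the first variable is
enough to construct the adjunction. -/
theorem EnrichedAdjunction.isLeftAdjoint_forget {L : EnrichedFunctor V C D}
    {R : EnrichedFunctor V D C} (θ : EnrichedAdjunction L R) : L.forget.IsLeftAdjoint := by
  let e (X : ForgetEnrichment V C) (Y : ForgetEnrichment V D) :
      (L.forget.obj X ⟶ Y) ≃ (X ⟶ R.forget.obj Y) :=
    (θ.θ (ForgetEnrichment.to V X) (ForgetEnrichment.to V Y)).homToEquiv
  have he : ∀ X' X Y (f : X' ⟶ X) (g : X ⟶ R.forget.obj Y),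
      (e X' Y).symm (f ≫ g) = L.forget.map f ≫ (e X Y).symm g := fun X' X Y f g => by
    have h := congrArg (fun t => ((λ_ (𝟙_ V)).inv ≫ (homTo V f ⊗ₘ homTo V g)) ≫ t)
      (θ.naturality_left (ForgetEnrichment.to V X') (ForgetEnrichment.to V X)
        (ForgetEnrichment.to V Y))
    have h' : ((λ_ (𝟙_ V)).inv ≫ (homTo V f ⊗ₘ homTo V g)) ≫
        (L.map (ForgetEnrichment.to V X') (ForgetEnrichment.to V X) ⊗ₘ
          (θ.θ (ForgetEnrichment.to V X) (ForgetEnrichment.to V Y)).inv) =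
        (λ_ (𝟙_ V)).inv ≫ ((homTo V f ≫ L.map _ _) ⊗ₘ (homTo V g ≫ (θ.θ _ _).inv)) := by
      rw [Category.assoc, tensorHom_comp_tensorHom]
    refine congrArg (homOf V) (a₁ := homTo V (f ≫ g) ≫ (θ.θ _ _).inv)
      (a₂ := ((λ_ (𝟙_ V)).inv ≫ ((homTo V f ≫ L.map _ _) ⊗ₘ (homTo V g ≫ (θ.θ _ _).inv))) ≫
        eComp V _ _ _) (((congrArg (· ≫ _) (homTo_comp V f g)).trans
      (Category.assoc _ _ _)).trans (h.trans ?_))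
    exact (Category.assoc _ _ _).symm.trans (congrArg (· ≫ eComp V _ _ _) h')
  exact (Adjunction.adjunctionOfEquivRight e fun X' X Y f g => by
    rw [← Equiv.eq_symm_apply, he, Equiv.symm_apply_apply]).isLeftAdjoint

end

variable {V : Type u} [Category.{v} V] [MonoidalCategory V] [BraidedCategory V]

section

variable {C : Type w₁} [EnrichedCategory V C] [EnrichedMonoidalCategory V C]

theorem tensorLeftEnriched_forget_map (a : C) {X Y : ForgetEnrichment V C} (t : X ⟶ Y) :
    (tensorLeftEnriched V a).forget.map t = ForgetEnrichment.of V a ◁ t :=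
  congrArg (homOf V) (gwl_homTo (Z := ForgetEnrichment.of V a) t)

theorem tensorRightEnriched_forget_map (a : C) {X Y : ForgetEnrichment V C} (t : X ⟶ Y) :
    (tensorRightEnriched V a).forget.map t = t ▷ ForgetEnrichment.of V a :=
  congrArg (homOf V) (gwr_homTo (Z := ForgetEnrichment.of V a) t)

theorem isLeftAdjoint_tensorLeft (h : IsClosedEnriched V C) (X : ForgetEnrichment V C) :
    (tensorLeft X).IsLeftAdjoint := by
  obtain ⟨R, ⟨θ⟩⟩ := h (ForgetEnrichment.to V X)
  have := θ.isLeftAdjoint_forget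
  exact Functor.isLeftAdjoint_of_iso (F := (tensorLeftEnriched V (ForgetEnrichment.to V X)).forget)
    (NatIso.ofComponents (fun Y => Iso.refl (X ⊗ Y)) fun t =>
      (Category.comp_id _).trans ((tensorLeftEnriched_forget_map _ t).trans
        (Category.id_comp _).symm))

theorem isLeftAdjoint_tensorRight (h : IsBiclosedEnriched V C) (X : ForgetEnrichment V C) :
    (tensorRight X).IsLeftAdjoint := by
  obtain ⟨R, ⟨θ⟩⟩ := h.2 (ForgetEnrichment.to V X)
  have := θ.isLeftAdjoint_forget
  exact Functor.isLeftAdjoint_of_iso (F := (tensorRightEnriched V (ForgetEnrichment.to V X)).forget)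
    (NatIso.ofComponents (fun Y => Iso.refl (Y ⊗ X)) fun t =>
      (Category.comp_id _).trans ((tensorRightEnriched_forget_map _ t).trans
        (Category.id_comp _).symm))

section

variable {T : Type w} [Category.{v} T] [MonoidalCategory T]

/-- These formulas for units and counits reduce their `V`-naturality to that of unitors, associators
and whiskered evaluations and coevaluations. -/
theorem tensorLeftAdjunction_unit_app (Y Y' X : T) [ExactPairing Y Y'] :
    (tensorLeftAdjunction Y Y').unit.app X = (λ_ X).inv ≫ η_ Y Y' ▷ X ≫ (α_ _ _ _).hom := by
  simp [tensorLeftAdjunction, tensorLeftHomEquiv]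

theorem tensorLeftAdjunction_counit_app (Y Y' X : T) [ExactPairing Y Y'] :
    (tensorLeftAdjunction Y Y').counit.app X = (α_ _ _ _).inv ≫ ε_ Y Y' ▷ X ≫ (λ_ X).hom := by
  simp [tensorLeftAdjunction, tensorLeftHomEquiv]

theorem tensorRightAdjunction_unit_app (Y Y' X : T) [ExactPairing Y Y'] :
    (tensorRightAdjunction Y Y').unit.app X = (ρ_ X).inv ≫ X ◁ η_ Y Y' ≫ (α_ _ _ _).inv := by
  simp [tensorRightAdjunction, tensorRightHomEquiv]

theorem tensorRightAdjunction_counit_app (Y Y' X : T) [ExactPairing Y Y'] :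
    (tensorRightAdjunction Y Y').counit.app X = (α_ _ _ _).hom ≫ X ◁ ε_ Y Y' ≫ (ρ_ X).hom := by
  simp [tensorRightAdjunction, tensorRightHomEquiv]

end

/-- A rigid `V`-monoidal category is biclosed. -/
theorem IsRigidEnriched.isBiclosedEnriched (h : IsRigidEnriched V C) : IsBiclosedEnriched V C := by
  obtain ⟨h⟩ := h
  constructor
  · intro a
    let A : ForgetEnrichment V C := ForgetEnrichment.of V a
    -- The left dual gives `A ⊗ - ⊣ ᘁA ⊗ -`, and below the right dual gives `- ⊗ A ⊣ - ⊗ Aᘁ`. The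
    -- triangle identities are the ordinary ones; only naturality with respect to graded morphisms
    -- is new.
    let adj := tensorLeftAdjunction (ᘁA) A
    refine exists_enrichedAdjunction_of_unit_counit
      (R := tensorLeftEnriched V (ForgetEnrichment.to V (ᘁA)))
      (fun X => adj.unit.app X) (fun X => adj.counit.app X) ?_ ?_ ?_ ?_
    · intro v X Y f
      change gpost f (adj.unit.app Y) = gpre (adj.unit.app X) (gwl (ᘁA) (gwl A f))
      rw [tensorLeftAdjunction_unit_app, tensorLeftAdjunction_unit_app, ← gpost_gpost,
        ← gpost_gpost, ← gpre_inv_eq (gwl_unit f), gpre_gpost, gwl_naturality, gpre_gpost,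
        gpre_gpost, gwl_tensor, gpre_gpre, gpre_gpre, Category.assoc]
    · intro v X Y f
      change gpre (adj.counit.app X) f = gpost (gwl A (gwl (ᘁA) f)) (adj.counit.app Y)
      rw [tensorLeftAdjunction_counit_app, tensorLeftAdjunction_counit_app, ← gpost_gpost,
        ← gpost_gpost, ← gpre_inv_eq (gwl_tensor f), gpre_gpost, gwl_naturality, gpre_gpost,
        gpre_gpost, gwl_unit f, gpre_gpre, gpre_gpre, Category.assoc]
    · intro X
      exact (congrArg (· ≫ _) (tensorLeftEnriched_forget_map a _)).trans
        (adj.left_triangle_components X)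
    · intro X
      exact (congrArg (_ ≫ ·) (tensorLeftEnriched_forget_map _ _)).trans
        (adj.right_triangle_components X)
  · intro a
    let A : ForgetEnrichment V C := ForgetEnrichment.of V a
    let adj := tensorRightAdjunction A Aᘁ
    refine exists_enrichedAdjunction_of_unit_counit
      (R := tensorRightEnriched V (ForgetEnrichment.to V Aᘁ))
      (fun X => adj.unit.app X) (fun X => adj.counit.app X) ?_ ?_ ?_ ?_
    · intro v X Y f
      change gpost f (adj.unit.app Y) = gpre (adj.unit.app X) (gwr (gwr f A) Aᘁ)
      rw [tensorRightAdjunction_unit_app, tensorRightAdjunction_unit_app, ← gpost_gpost,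
        ← gpost_gpost, ← gpre_inv_eq (gwr_unit f), gpre_gpost, gwr_naturality, gpre_gpost,
        gpre_gpost, ← gpre_inv_eq (gwr_tensor f), gpre_gpre, gpre_gpre, Category.assoc]
    · intro v X Y f
      change gpre (adj.counit.app X) f = gpost (gwr (gwr f Aᘁ) A) (adj.counit.app Y)
      rw [tensorRightAdjunction_counit_app, tensorRightAdjunction_counit_app, ← gpost_gpost,
        ← gpost_gpost, gwr_tensor, gpre_gpost, gwr_naturality, gpre_gpost,
        gpre_gpost, gwr_unit f, gpre_gpre, gpre_gpre, Category.assoc]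
    · intro X
      exact (congrArg (· ≫ _) (tensorRightEnriched_forget_map a _)).trans
        (adj.left_triangle_components X)
    · intro X
      exact (congrArg (_ ≫ ·) (tensorRightEnriched_forget_map _ _)).trans
        (adj.right_triangle_components X)

end

namespace Representation

variable {C : Type w₁} [EnrichedCategory V C] [EnrichedMonoidalCategory V C]
  {T : Type w₂} [Category.{v} T] [MonoidalCategory T] {Ψ : BraidedOplaxFunctor V T}
  (R : Representation C Ψ) [R.K.IsEquivalence]

/-- A `V`-functor has a right `V`-adjoint if it is represented by a left adjoint functor. -/
theorem exists_enrichedAdjunction (L : EnrichedFunctor V C C) (N : T ⥤ T) [N.IsLeftAdjoint]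
    (σ : ∀ (v : V) (Z : ForgetEnrichment V C),
      R.K.obj (L.forget.obj Z) ⊗ Ψ.F.obj v ≅ N.obj (R.K.obj Z ⊗ Ψ.F.obj v))
    (τ : ∀ Y, N.obj (R.K.obj Y) ≅ R.K.obj (L.forget.obj Y))
    (h : ∀ {v : V} {X Y : ForgetEnrichment V C} (f : GHom v X Y),
      R.E (EnrichedFunctor.gmap L f) = (σ v X).hom ≫ N.map (R.E f) ≫ (τ Y).hom) :
    ∃ R, Nonempty (EnrichedAdjunction L R) := by
  let adj := Adjunction.ofIsLeftAdjoint N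
  refine exists_enrichedAdjunction_of_bijective L fun Y => ?_
  -- The universal arrow at `Y` is a lift through `K` of the ordinary counit of `N` at `K Y`.
  let Z := R.K.objPreimage (N.rightAdjoint.obj (R.K.obj Y))
  let e : R.K.obj Z ≅ N.rightAdjoint.obj (R.K.obj Y) := R.K.objObjPreimageIso _
  refine ⟨Z, R.K.preimage ((τ Z).inv ≫ N.map e.hom ≫ adj.counit.app _), fun X v => ?_⟩
  rw [← Function.Bijective.of_comp_iff' R.E.bijective]
  have : (R.E ∘ fun f : GHom v X Z => gpost (EnrichedFunctor.gmap L f) (R.K.preimage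
        ((τ Z).inv ≫ N.map e.hom ≫ adj.counit.app _))) =
      ((R.E.trans e.homToEquiv).trans (adj.homEquiv _ _).symm).trans
        (σ v X).symm.homFromEquiv := by
    funext f
    simp [R.E_gpost, h, Adjunction.homEquiv_counit]
  rw [this]
  exact Equiv.bijective _

include R

theorem isClosedEnriched (hT : ∀ a : T, (tensorLeft a).IsLeftAdjoint) : IsClosedEnriched V C := by
  intro a
  have := hT (R.K.obj (ForgetEnrichment.of V a))
  exact R.exists_enrichedAdjunction (tensorLeftEnriched V a)
    (tensorLeft (R.K.obj (ForgetEnrichment.of V a)))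
    (fun v Z => whiskerRightIso (Functor.Monoidal.μIso R.K (ForgetEnrichment.of V a) Z).symm _ ≪≫
      α_ _ _ _)
    (fun Y => Functor.Monoidal.μIso R.K (ForgetEnrichment.of V a) Y)
    fun f => (R.E_gwl (ForgetEnrichment.of V a) f).trans (Category.assoc _ _ _).symm

/-- Right whiskering is represented by `- ⊗ K a` only after `F v` has been moved past `K a`, which
the half-braiding does invertibly. -/
theorem isBiclosedEnriched (hT : ∀ a : T, (tensorLeft a).IsLeftAdjoint)
    (hT' : ∀ a : T, (tensorRight a).IsLeftAdjoint) : IsBiclosedEnriched V C := by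
  refine ⟨R.isClosedEnriched hT, fun a => ?_⟩
  have := hT' (R.K.obj (ForgetEnrichment.of V a))
  refine R.exists_enrichedAdjunction (tensorRightEnriched V a)
    (tensorRight (R.K.obj (ForgetEnrichment.of V a)))
    (fun v Z => whiskerRightIso (Functor.Monoidal.μIso R.K Z (ForgetEnrichment.of V a)).symm _ ≪≫
      α_ _ _ _ ≪≫ whiskerLeftIso _ (Ψ.hb (R.K.obj (ForgetEnrichment.of V a)) v) ≪≫
        (α_ _ _ _).symm)
    (fun Y => Functor.Monoidal.μIso R.K Y (ForgetEnrichment.of V a))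
    fun f => (R.E_gwr f (ForgetEnrichment.of V a)).trans
      (comp_assoc_five _ _ _ _ _)

theorem isRigidEnriched [RigidCategory T] : IsRigidEnriched V C :=
  ⟨rigidCategoryOfEquivalence (F := R.K) R.K.asEquivalence.toAdjunction⟩

end Representation

end BraidedEnriched

namespace BraidedEnriched

open ForgetEnrichment Functor.LaxMonoidal Functor.OplaxMonoidal

/-! ### Tensored categories -/

section

variable {V : Type u} [Category.{v} V] [MonoidalCategory V]
  {C : Type w₁} [EnrichedCategory V C]

/-- A graded morphism `f : a → b` such that composition with `f` is a bijection on graded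
morphisms of all degrees. -/
def IsStronglyUniv {u : V} {X Y : ForgetEnrichment V C} (f : GHom u X Y) : Prop :=
  ∀ (v : V) (Z : ForgetEnrichment V C), Function.Bijective
    (fun g : GHom v Y Z => (gcomp f g : GHom (u ⊗ v) X Z))

theorem IsStronglyUniv.isUniv {u : V} {X Y : ForgetEnrichment V C} {f : GHom u X Y}
    (h : IsStronglyUniv f) : IsUniv f := by
  intro Z
  have : (fun t : Y ⟶ Z => gpost f t) =
      (ρ_ u).homFromEquiv ∘ (fun g : GHom (𝟙_ V) Y Z => gcomp f g) ∘ homTo V := by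
    funext t
    exact gpost_eq f t
  rw [this]
  exact (Equiv.bijective _).comp ((h (𝟙_ V) Z).comp
    (Function.bijective_iff_has_inverse.2 ⟨homOf V, fun _ => rfl, fun _ => rfl⟩))

theorem IsStronglyUniv.gpost_iso {u : V} {X Y Z : ForgetEnrichment V C} {f : GHom u X Y}
    (h : IsStronglyUniv f) (e : Y ≅ Z) : IsStronglyUniv (gpost f e.hom) := by
  intro v W
  have : (fun g : GHom v Z W => (gcomp (gpost f e.hom) g : GHom (u ⊗ v) X W)) =
      (fun g => gcomp f g) ∘ fun g => gpre e.hom g := by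
    funext g
    exact gpost_gcomp _ _ _
  rw [this]
  exact (h v W).comp (gpre_iso_bijective e W)

/-- Universal morphisms of a given degree and source are unique up to isomorphism, so one strongly
universal morphism makes all of them so. -/
theorem IsUniv.isStronglyUniv {u : V} {X Y Z : ForgetEnrichment V C} {f : GHom u X Y}
    (hf : IsUniv f) {g : GHom u X Z} (hg : IsStronglyUniv g) : IsStronglyUniv f := by
  obtain ⟨e, rfl⟩ := hg.isUniv.exists_iso hf
  exact hg.gpost_iso e

theorem isUniv_gcomp {u v : V} {X Y Z : ForgetEnrichment V C} {f : GHom u X Y}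
    (hf : IsStronglyUniv f) {g : GHom v Y Z} (hg : IsUniv g) : IsUniv (gcomp f g) := by
  intro W
  have : (fun t : Z ⟶ W => gpost (gcomp f g) t) =
      (fun g => gcomp f g) ∘ fun t : Z ⟶ W => gpost g t := by
    funext t
    exact (gcomp_gpost f g t).symm
  rw [this]
  exact (hf v W).comp (hg W)

theorem isRightAdjoint_representable {X : ForgetEnrichment V C}
    (h : ∀ u : V, ∃ (Y : ForgetEnrichment V C) (f : GHom u X Y), IsUniv f) :
    (representable V (ForgetEnrichment.to V X)).IsRightAdjoint := by
  choose L η hη using h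
  let e (u : V) (Y : ForgetEnrichment V C) :
      (L u ⟶ Y) ≃ (u ⟶ (representable V (ForgetEnrichment.to V X)).obj Y) :=
    Equiv.ofBijective _ (hη u Y)
  exact (Adjunction.adjunctionOfEquivLeft e fun u Y Z t g =>
    (gpost_gpost (η u) g t).symm).isRightAdjoint

variable [MonoidalClosed V]

open scoped MonoidalClosed

theorem curry_bijective {X Y Z : V} :
    Function.Bijective (MonoidalClosed.curry : (X ⊗ Y ⟶ Z) → (Y ⟶ (ihom X).obj Z)) :=
  Function.bijective_iff_has_inverse.2
    ⟨MonoidalClosed.uncurry, MonoidalClosed.uncurry_curry, MonoidalClosed.curry_uncurry⟩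

theorem uncurry_bijective {X Y Z : V} :
    Function.Bijective (MonoidalClosed.uncurry : (Y ⟶ (ihom X).obj Z) → (X ⊗ Y ⟶ Z)) :=
  Function.bijective_iff_has_inverse.2
    ⟨MonoidalClosed.curry, MonoidalClosed.curry_uncurry, MonoidalClosed.uncurry_curry⟩

theorem uncurry_elt_comp {X Y Z v : V} (p : 𝟙_ V ⟶ (ihom X).obj Y) (q : v ⟶ (ihom Y).obj Z) :
    MonoidalClosed.uncurry ((λ_ v).inv ≫ (p ⊗ₘ q) ≫ MonoidalClosed.comp X Y Z) =
      ((ρ_ X).inv ≫ MonoidalClosed.uncurry p) ▷ v ≫ MonoidalClosed.uncurry q := by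
  rw [MonoidalClosed.uncurry_natural_left, MonoidalClosed.uncurry_natural_left,
    whiskerLeft_tensorHom_comp_uncurry_comp]
  simp

/-- Transposition along the element of `[u, C(a → b)]` named by `f` is composition with `f`,
curried. -/
theorem curry_elt_comp {a b c : C} {u v : V} (f : u ⟶ (a ⟶[V] b)) (g : v ⟶ (b ⟶[V] c)) :
    (g ≫ MonoidalClosed.curry (eComp V a b c)) ≫ (λ_ _).inv ≫
        MonoidalClosed.curry ((ρ_ u).hom ≫ f) ▷ _ ≫ MonoidalClosed.comp u _ _ =
      MonoidalClosed.curry ((f ⊗ₘ g) ≫ eComp V a b c) := by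
  apply MonoidalClosed.uncurry_injective
  rw [leftUnitor_inv_naturality_assoc, ← MonoidalCategory.tensorHom_def'_assoc,
    uncurry_elt_comp, MonoidalClosed.uncurry_natural_left, MonoidalClosed.uncurry_curry,
    MonoidalClosed.uncurry_curry, MonoidalClosed.uncurry_curry, Iso.inv_hom_id_assoc,
    MonoidalCategory.tensorHom_def, Category.assoc]

theorem IsTensored.exists_isStronglyUniv (h : IsTensored V C) (X : ForgetEnrichment V C) (u : V) :
    ∃ (Y : ForgetEnrichment V C) (f : GHom u X Y), IsStronglyUniv f := by
  let a : C := ForgetEnrichment.to V X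
  obtain ⟨b, θ, nat⟩ : ∃ (b : C) (θ : ∀ d : C, (b ⟶[V] d) ≅ (ihom u).obj (a ⟶[V] d)),
      ∀ d, eComp V b b d ≫ (θ d).hom =
        ((θ b).hom ⊗ₘ MonoidalClosed.curry (eComp V a b d)) ≫ MonoidalClosed.comp u _ _ := by
    obtain ⟨L, ⟨θ⟩⟩ := h a
    exact ⟨L.obj u, fun d => θ.θ u d, fun d => θ.naturality_right u (L.obj u) d⟩
  -- The image of the identity of `b` under `θ`, uncurried: the unit of the tensor of `X` by `u`.
  let f : u ⟶ (a ⟶[V] b) := (ρ_ u).inv ≫ MonoidalClosed.uncurry (eId V b ≫ (θ b).hom)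
  -- Enriched Yoneda: by naturality `θ` is determined by its value at the identity, so `θ` is
  -- composition with `f`, curried.
  have key (v : V) (d : C) (g : v ⟶ (b ⟶[V] d)) :
      MonoidalClosed.uncurry (g ≫ (θ d).hom) = (f ⊗ₘ g) ≫ eComp V a b d := by
    have h₁ : (λ_ v).inv ≫ (eId V b ⊗ₘ g) ≫ eComp V b b d = g := by
      rw [MonoidalCategory.tensorHom_def', Category.assoc, ← leftUnitor_inv_naturality_assoc,
        e_id_comp, Category.comp_id]
    have h₂ : g ≫ (θ d).hom = (λ_ v).inv ≫ ((eId V b ≫ (θ b).hom) ⊗ₘ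
        (g ≫ MonoidalClosed.curry (eComp V a b d))) ≫ MonoidalClosed.comp u _ _ := by
      rw [← tensorHom_comp_tensorHom_assoc, ← nat]
      nth_rw 1 [← h₁]
      simp only [Category.assoc]
    rw [h₂, uncurry_elt_comp]
    change f ▷ v ≫ _ = _
    rw [MonoidalClosed.uncurry_natural_left, MonoidalClosed.uncurry_curry,
      MonoidalCategory.tensorHom_def, Category.assoc]
  refine ⟨ForgetEnrichment.of V b, f, fun v Z => ?_⟩
  have : (fun g : GHom v (ForgetEnrichment.of V b) Z =>
      (gcomp (Y := ForgetEnrichment.of V b) f g : GHom (u ⊗ v) X Z)) =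
      fun g => MonoidalClosed.uncurry (g ≫ (θ (ForgetEnrichment.to V Z)).hom) :=
    funext fun g => (key v (ForgetEnrichment.to V Z) g).symm
  rw [this]
  exact uncurry_bijective.comp
    (iso_comp_bijective (θ (ForgetEnrichment.to V Z)))

theorem isTensored_of_isStronglyUniv
    (h : ∀ (X : ForgetEnrichment V C) (u : V), ∃ (Y : ForgetEnrichment V C) (f : GHom u X Y),
      IsStronglyUniv f) : IsTensored V C := by
  intro a
  choose Y f hf using h (ForgetEnrichment.of V a)
  let p (u : V) : 𝟙_ V ⟶ (ihom u).obj (a ⟶[V] ForgetEnrichment.to V (Y u)) :=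
    MonoidalClosed.curry ((ρ_ u).hom ≫ f u)
  let η (u : ForgetEnrichment V V) : u ⟶ (enrichedRepresentable V a).forget.obj
      (Y (ForgetEnrichment.to V u)) :=
    homOf V (p (ForgetEnrichment.to V u))
  have (u : ForgetEnrichment V V) (Z : ForgetEnrichment V C) :
      IsIso (transposeLeft (enrichedRepresentable V a) (η u) Z) := by
    refine isIso_of_yoneda_map_bijective _ fun v => ?_
    -- In degree `v`, transposition along `η u` is composition with `f u` followed by currying, both
    -- bijective.
    have key : (fun g : GHom v (Y (ForgetEnrichment.to V u)) Z =>
        g ≫ transposeLeft (enrichedRepresentable V a) (η u) Z) =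
        fun g => MonoidalClosed.curry (gcomp (f (ForgetEnrichment.to V u)) g) := by
      funext g
      refine (comp_transposeLeft (enrichedRepresentable V a) (η u) g).trans ?_
      change (g ≫ MonoidalClosed.curry (eComp V a (ForgetEnrichment.to V
        (Y (ForgetEnrichment.to V u))) (ForgetEnrichment.to V Z))) ≫ (λ_ _).inv ≫
        p (ForgetEnrichment.to V u) ▷ _ ≫ MonoidalClosed.comp (ForgetEnrichment.to V u) _ _ = _
      exact curry_elt_comp (a := a) (b := ForgetEnrichment.to V (Y (ForgetEnrichment.to V u)))
        (c := ForgetEnrichment.to V Z) (u := ForgetEnrichment.to V u)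
        (f (ForgetEnrichment.to V u)) g
    rw [key]
    exact curry_bijective.comp (hf (ForgetEnrichment.to V u) v Z)
  exact ⟨_, ⟨adjunctionOfLeftUniversal (enrichedRepresentable V a) _ η⟩⟩

end

end BraidedEnriched

namespace BraidedEnriched

open ForgetEnrichment Functor.LaxMonoidal Functor.OplaxMonoidal

/-! ### Tensored categories and strong functors -/

variable {V : Type u} [Category.{v} V] [MonoidalCategory V] [BraidedCategory V]

/-- The forgetful functor from the center reflects isomorphisms. -/
theorem BraidedOplaxFunctor.isStrong_iff {T : Type w} [Category.{v} T] [MonoidalCategory T]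
    (Φ : BraidedOplaxFunctor V T) : Φ.IsStrong ↔ ∀ x y : V, IsIso (Φ.ν x y) :=
  forall₂_congr fun x y =>
    (isIso_iff_of_reflects_iso (Functor.OplaxMonoidal.δ Φ.functor x y) (Center.forget T)).symm

omit [BraidedCategory V] in
theorem IsUniv.isIso {C : Type w} [EnrichedCategory V C] {v : V} {X Y Z : ForgetEnrichment V C}
    {f : GHom v X Y} (hf : IsUniv f) {t : Y ⟶ Z} (ht : IsUniv (gpost f t)) : IsIso t := by
  obtain ⟨e, he⟩ := hf.exists_iso ht
  rw [← hf.hom_ext he]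
  infer_instance

namespace Representation

variable {C : Type w₁} [EnrichedCategory V C] [EnrichedMonoidalCategory V C]
  {T : Type w₂} [Category.{v} T] [MonoidalCategory T] {Φ : BraidedOplaxFunctor V T}
  (R : Representation C Φ) [R.K.IsEquivalence]

theorem exists_isIso_E (X : ForgetEnrichment V C) (u : V) :
    ∃ (Y : ForgetEnrichment V C) (f : GHom u X Y), IsIso (R.E f) := by
  refine ⟨R.K.objPreimage (R.K.obj X ⊗ Φ.F.obj u),
    R.E.symm (R.K.objObjPreimageIso (R.K.obj X ⊗ Φ.F.obj u)).inv, ?_⟩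
  rw [Equiv.apply_symm_apply]
  infer_instance

include R in
theorem isRightAdjoint_unitRepresentable : (unitRepresentable V C).IsRightAdjoint :=
  isRightAdjoint_representable (X := 𝟙_ (ForgetEnrichment V C)) fun u =>
    let ⟨Y, f, hf⟩ := R.exists_isIso_E _ u
    ⟨Y, f, R.isUniv hf⟩

-- In the formula for `E (gcomp f g)`, everything in front of `E g` is invertible once `ν u v` and
-- `E f` are.
omit [R.K.IsEquivalence] in
theorem isStronglyUniv (hΦ : Φ.IsStrong) {u : V} {X Y : ForgetEnrichment V C} {f : GHom u X Y}
    (hf : IsIso (R.E f)) : IsStronglyUniv f := by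
  intro v Z
  have := Φ.isStrong_iff.1 hΦ u v
  rw [← Function.Bijective.of_comp_iff' R.E.bijective]
  have : R.E ∘ (fun g : GHom v Y Z => (gcomp f g : GHom (u ⊗ v) X Z)) =
      (whiskerLeftIso (R.K.obj X) (asIso (Φ.ν u v)) ≪≫ (α_ _ _ _).symm ≪≫
        whiskerRightIso (asIso (R.E f)) (Φ.F.obj v)).symm.homFromEquiv ∘ R.E := by
    funext g
    simp [R.E_gcomp]
  rw [this]
  exact (Equiv.bijective _).comp R.E.bijective

include R in
theorem isTensored [MonoidalClosed V] (hΦ : Φ.IsStrong) : IsTensored V C :=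
  isTensored_of_isStronglyUniv fun X u =>
    let ⟨Y, f, hf⟩ := R.exists_isIso_E X u
    ⟨Y, f, R.isStronglyUniv hΦ hf⟩

end Representation

/-! ### Tensored categories and strong classifying functors; the general form of the bijections. -/

section Closed

variable [MonoidalClosed V]

theorem IsTensored.isRightAdjoint_unitRepresentable {C : Type w₁} [EnrichedCategory V C]
    [EnrichedMonoidalCategory V C] (h : IsTensored V C) :
    (unitRepresentable V C).IsRightAdjoint :=
  isRightAdjoint_representable (X := 𝟙_ (ForgetEnrichment V C)) fun u =>
    let ⟨Y, f, hf⟩ := h.exists_isStronglyUniv _ u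
    ⟨Y, f, hf.isUniv⟩

namespace EnrMonCat

variable {C : EnrMonCat.{v, u, w} V} {Φ : BraidedOplaxFunctor V C.underlying}

omit [MonoidalClosed V] in
theorem IsClassifying.hasRightAdjoint (hΦ : C.IsClassifying Φ) :
    (C.pair Φ).HasRightAdjoint :=
  hΦ.choose.isLeftAdjoint

theorem IsClassifying.isTensored_iff (hΦ : C.IsClassifying Φ)
    (hC : IsClosedEnriched V C.carrier) : IsTensored V C.carrier ↔ Φ.IsStrong := by
  obtain ⟨adj, h⟩ := hΦ.exists_classifies
  refine ⟨fun ht => Φ.isStrong_iff.2 fun x y => ?_, fun hs => ?_⟩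
  · obtain ⟨Y, f, hf⟩ := ht.exists_isStronglyUniv (𝟙_ _) x
    -- A comparison of universal elements: the oplaxitor sends `η_{xy}` to `η_x` followed by `j ⊗
    -- η_y`, universal because `η_x` is strongly universal and `j ⊗ η_y` is universal.
    refine (isUniv_gunit adj (x ⊗ y)).isIso ?_
    rw [h.oplaxitor]
    exact isUniv_gcomp ((isUniv_gunit adj x).isStronglyUniv hf)
      (isUniv_gidl hC _ (isUniv_gunit adj y))
  · let R := Representation.ofClassifies
      (fun X v => isUniv_gidl hC X (isUniv_gunit adj v)) h
    have : R.K.IsEquivalence := inferInstanceAs (𝟭 _).IsEquivalence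
    exact R.isTensored hs

end EnrMonCat

-- All four bijections are cases of the closed one. Preservation and reflection of equivalence hold
-- for all closed categories, so only the translation between the conditions `A` and `B` remains to
-- be supplied.
omit [MonoidalClosed V] in
theorem inducesBijection_of_forall {A : EnrMonCat.{v, u, w} V → Prop}
    {B : CenterPair.{v, u, w} V → Prop}
    (hA : ∀ C, A C → IsClosedEnriched V C.carrier ∧ HasInvertibleHalfBraidings V C.carrier ∧
      C.HasLeftAdjoint)
    (hB : ∀ P, B P → P.IsClosed ∧ P.HasRightAdjoint)
    (hAB : ∀ C, A C → ∀ Φ, C.IsClassifying Φ → (C.pair Φ).HasRightAdjoint → B (C.pair Φ))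
    (hBA : ∀ P, B P → ∀ (C : EnrMonCat.{v, u, w} V) (R : Representation C.carrier P.F),
      R.K.IsEquivalence → IsClosedEnriched V C.carrier →
      HasInvertibleHalfBraidings V C.carrier → C.HasLeftAdjoint → A C) :
    InducesBijection A B := by
  refine ⟨fun C hC => ?_, fun C hC Φ hΦ => hAB C hC Φ hΦ hΦ.hasRightAdjoint,
    fun C D hC hD Φ Ψ hΦ hΨ => EnrMonCat.equivalent_iff (hA C hC).1 (hA D hD).1 hΦ hΨ,
    fun P hP => ?_⟩
  · obtain ⟨h₁, h₂, h₃⟩ := hA C hC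
    exact C.exists_isClassifying h₁ h₂ h₃
  -- Surjectivity: build the enriched category of the pair; its representation gives closedness,
  -- invertible half-braidings and the left adjoint, hence a classifying functor, and compares the
  -- resulting pair with `P`.
  · obtain ⟨h₁, h₂⟩ := hB P hP
    obtain ⟨C, R, hR⟩ := P.exists_representation h₁ h₂
    have hc := R.isClosedEnriched h₁
    have hi := R.hasInvertibleHalfBraidings
    have hl : C.HasLeftAdjoint := R.isRightAdjoint_unitRepresentable
    obtain ⟨Φ, hΦ⟩ := C.exists_isClassifying hc hi hl
    exact ⟨C, hBA P hP C R hR hc hi hl, Φ, hΦ, R.pair_equivalent hΦ⟩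

end Closed

theorem CenterPair.IsRigid.isBiclosed {P : CenterPair.{v, u, w} V} (h : P.IsRigid) :
    P.IsBiclosed := by
  obtain ⟨_⟩ := h
  exact ⟨fun a => (tensorLeftAdjunction (ᘁa) a).isLeftAdjoint,
    fun a => (tensorRightAdjunction a aᘁ).isLeftAdjoint⟩

end BraidedEnriched

open BraidedEnriched in
theorem theorem1p2 {V : Type u} [Category.{v} V] [MonoidalCategory V] [BraidedCategory V]
    [MonoidalClosed V] :
    -- the bijection for closed `V`-monoidal categories
    InducesBijection.{v, u, w} (V := V)
      (fun C => IsClosedEnriched V C.carrier ∧ HasInvertibleHalfBraidings V C.carrier ∧ C.HasLeftAdjoint)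
      (fun P => P.IsClosed ∧ P.HasRightAdjoint) ∧
    -- its restriction to tensored closed `V`-monoidal categories
    InducesBijection.{v, u, w} (V := V)
      (fun C => IsClosedEnriched V C.carrier ∧ HasInvertibleHalfBraidings V C.carrier ∧
        IsTensored V C.carrier)
      (fun P => P.IsClosed ∧ P.HasRightAdjoint ∧ P.F.IsStrong) ∧
    -- its restriction to tensored biclosed `V`-monoidal categories
    InducesBijection.{v, u, w} (V := V)
      (fun C => IsBiclosedEnriched V C.carrier ∧ IsTensored V C.carrier)
      (fun P => P.IsBiclosed ∧ P.HasRightAdjoint ∧ P.F.IsStrong) ∧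
    -- its restriction to tensored rigid `V`-monoidal categories
    InducesBijection.{v, u, w} (V := V)
      (fun C => IsRigidEnriched V C.carrier ∧ IsTensored V C.carrier)
      (fun P => P.IsRigid ∧ P.HasRightAdjoint ∧ P.F.IsStrong) ∧
    -- the classifying functor is strong exactly when the category is tensored
    ∀ C : EnrMonCat.{v, u, w} V, IsClosedEnriched V C.carrier → ∀ Φ, C.IsClassifying Φ →
      (IsTensored V C.carrier ↔ Φ.IsStrong) := by
  refine ⟨inducesBijection_of_forall (fun C hC => hC) (fun P hP => hP)
      (fun C hC Φ hΦ hr => ⟨fun a => isLeftAdjoint_tensorLeft hC.1 a, hr⟩)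
      (fun P hP C R hR hc hi hl => ⟨hc, hi, hl⟩),
    inducesBijection_of_forall
      -- Tensoredness at the unit object already gives the left adjoint of `C(1 → -)`.
      (fun C hC => ⟨hC.1, hC.2.1, hC.2.2.isRightAdjoint_unitRepresentable⟩)
      (fun P hP => ⟨hP.1, hP.2.1⟩)
      (fun C hC Φ hΦ hr => ⟨fun a => isLeftAdjoint_tensorLeft hC.1 a, hr,
        (hΦ.isTensored_iff hC.1).1 hC.2.2⟩)
      (fun P hP C R hR hc hi hl => ⟨hc, hi, R.isTensored hP.2.2⟩),
    inducesBijection_of_forall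
      (fun C hC => ⟨hC.1.1, hC.1.hasInvertibleHalfBraidings,
        hC.2.isRightAdjoint_unitRepresentable⟩)
      (fun P hP => ⟨hP.1.1, hP.2.1⟩)
      (fun C hC Φ hΦ hr => ⟨⟨fun a => isLeftAdjoint_tensorLeft hC.1.1 a,
        fun a => isLeftAdjoint_tensorRight hC.1 a⟩, hr, (hΦ.isTensored_iff hC.1.1).1 hC.2⟩)
      (fun P hP C R hR hc hi hl =>
        ⟨R.isBiclosedEnriched hP.1.1 hP.1.2, R.isTensored hP.2.2⟩),
    inducesBijection_of_forall
      (fun C hC => ⟨hC.1.isBiclosedEnriched.1, hC.1.isBiclosedEnriched.hasInvertibleHalfBraidings,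
        hC.2.isRightAdjoint_unitRepresentable⟩)
      (fun P hP => ⟨hP.1.isBiclosed.1, hP.2.1⟩)
      -- Rigidity needs no translation in this direction: for `C` and for its pair it is the same
      -- condition on the underlying category.
      (fun C hC Φ hΦ hr => ⟨hC.1, hr, (hΦ.isTensored_iff hC.1.isBiclosedEnriched.1).1 hC.2⟩)
      (fun P hP C R hR hc hi hl => ⟨hP.1.elim fun _ => R.isRigidEnriched, R.isTensored hP.2.2⟩),
    fun C hC Φ hΦ => hΦ.isTensored_iff hC⟩
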